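/- Let $K$ be a $C^\infty$ manifold without boundary (Hausdorff, second countable) of dimension $l$, equipped with a $C^\infty$ Riemannian metric (for example a $C^\infty$ submanifold of $\mathbb{R}^n$ with the induced metric). A $j$-form $\alpha$ on $K$ is called bounded if there is a constant $C$ with $|\alpha(x)|\le C$ for all $x\in K$, where $|\alpha(x)|$ is the norm of the multilinear map $\alpha(x)$ on $T_xK$ with respect to the metric. Let $\Omega_\infty^j(K)$ be the space of $C^\infty$ $j$-forms $\alpha$ on $K$ such that $\alpha$ and $d\alpha$ are bounded, and let $H_\infty^\bullet(K)$ be the cohomology of the complex $(\Omega_\infty^\bullet(K),d)$. A continuous $j$-form $\alpha$ on an open set $U\subset\mathbb{R}^l$ is weakly differentiable, with weak exterior differential the continuous $(j+1)$-form $\omega=\overline{d}\alpha$, if $$\int_U \alpha\wedge d\varphi=(-1)^{j+1}\int_U\omega\wedge\varphi$$ for every $C^2$ form $\varphi$ of degree $l-j-1$ with compact support in $U$. A continuous $j$-form $\alpha$ on $K$ is weakly differentiable, with weak exterior differential the continuous form $\overline{d}\alpha$ on $K$, if this holds in every coordinate system of $K$. Let $\overline{\Omega}_\infty^j(K)$ be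 the space of bounded weakly differentiable $j$-forms on $K$ with bounded weak exterior differential, and let $\overline{H}_\infty^\bullet(K)$ be the cohomology of the complex $(\overline{\Omega}_\infty^\bullet(K),\overline{d})$. Then $\Omega_\infty^\bullet(K)\subset\overline{\Omega}_\infty^\bullet(K)$, with $\overline{d}\alpha=d\alpha$ for $\alpha\in\Omega_\infty^j(K)$, and for every $j\ge 0$ this inclusion induces an isomorphism $$H_\infty^j(K)\;\cong\;\overline{H}_\infty^j(K).$$ -/

import Mathlib

open scoped Manifold ContDiff TensorProduct
open MeasureTheory

noncomputable section

namespace LInftyForms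

/-! ### Forms on open subsets of Euclidean space -/

/-- The coordinate space `ℝ^l`. -/
abbrev Coord (l : ℕ) : Type := EuclideanSpace ℝ (Fin l)

/-- The value of a differential form of degree `j` on `ℝ^l` at a point. -/
abbrev Alt (l j : ℕ) : Type := Coord l [⋀^Fin j]→L[ℝ] ℝ

/-- The wedge product of alternating forms (the sum over shuffles), through Mathlib's
`AlternatingMap.domCoprod`. -/
def wedge {l p q : ℕ} (a : Alt l p) (b : Alt l q) : Coord l [⋀^Fin (p + q)]→ₗ[ℝ] ℝ :=
  ((LinearMap.mul' ℝ ℝ).compAlternatingMap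
    (a.toAlternatingMap.domCoprod b.toAlternatingMap)).domDomCongr finSumFinEquiv

/-- For `p + q = l`: the coefficient of `a ∧ b` with respect to `dx₁ ∧ ⋯ ∧ dx_l`, that is
`(a ∧ b)(e₁, …, e_l)`. Its integral over an open set `U` is `∫_U a ∧ b`. -/
def topWedge {l p q : ℕ} (h : p + q = l) (a : Alt l p) (b : Alt l q) : ℝ :=
  wedge a b fun i => EuclideanSpace.basisFun (Fin l) ℝ (Fin.cast h i)

/-- `η` is a weak exterior differential of the `j`-form `α` on the open set `U ⊆ ℝ^l`:
`∫_U α ∧ dφ = (-1)^(j+1) ∫_U η ∧ φ` for every `C²` form `φ` of degree `l - j - 1` with compact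
support in `U` (there is no such degree if `j = l`). -/
def IsWeakExtDerivOn {l j : ℕ} (α : Coord l → Alt l j) (η : Coord l → Alt l (j + 1))
    (U : Set (Coord l)) : Prop :=
  ∀ (k : ℕ) (h : j + (k + 1) = l) (h' : j + 1 + k = l) (φ : Coord l → Alt l k),
    ContDiff ℝ 2 φ → HasCompactSupport φ → tsupport φ ⊆ U →
      ∫ y in U, topWedge h (α y) (extDeriv φ y) =
        (-1) ^ (j + 1) * ∫ y in U, topWedge h' (η y) (φ y)

theorem continuousOn_topWedge {l p q : ℕ} (h : p + q = l) {α : Coord l → Alt l p}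
    {β : Coord l → Alt l q} {s : Set (Coord l)} (hα : ContinuousOn α s)
    (hβ : ContinuousOn β s) : ContinuousOn (fun y => topWedge h (α y) (β y)) s := by
  simp only [topWedge, wedge, AlternatingMap.domDomCongr_apply,
    LinearMap.compAlternatingMap_apply, AlternatingMap.domCoprod_apply, sum_apply, map_sum]
  refine continuousOn_finsetSum _ fun σ _ => ?_
  induction σ using Quotient.inductionOn' with | _ σ
  set v : Fin p ⊕ Fin q → Coord l := _ with hv
  have key : ∀ (a : Alt l p) (b : Alt l q), (LinearMap.mul' ℝ ℝ)
      ((AlternatingMap.domCoprod.summand a.toAlternatingMap b.toAlternatingMap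
        (Quotient.mk'' σ)) v) =
      ((Equiv.Perm.sign σ : ℤ) : ℝ) * ((a fun i => v (σ (Sum.inl i))) *
        (b fun i => v (σ (Sum.inr i)))) := by
    intro a b
    have : AlternatingMap.domCoprod.summand a.toAlternatingMap b.toAlternatingMap
        (Quotient.mk'' σ) v = (Equiv.Perm.sign σ : ℤ) •
          ((a fun i => v (σ (Sum.inl i))) ⊗ₜ[ℝ] (b fun i => v (σ (Sum.inr i)))) := rfl
    rw [this, map_zsmul, LinearMap.mul'_apply, zsmul_eq_mul]
  refine ContinuousOn.congr ?_ fun y _ => key (α y) (β y)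
  refine continuousOn_const.mul (ContinuousOn.mul ?_ ?_)
  · exact (ContinuousEvalConst.continuous_eval_const (F := Alt l p)
      (fun i => v (σ (Sum.inl i)))).comp_continuousOn hα
  · exact (ContinuousEvalConst.continuous_eval_const (F := Alt l q)
      (fun i => v (σ (Sum.inr i)))).comp_continuousOn hβ

theorem topWedge_add_left {l p q : ℕ} (h : p + q = l) (a a' : Alt l p) (b : Alt l q) :
    topWedge h (a + a') b = topWedge h a b + topWedge h a' b := by
  have : (a + a').toAlternatingMap = a.toAlternatingMap + a'.toAlternatingMap := rfl
  simp only [topWedge, wedge, this, ← AlternatingMap.domCoprod'_apply, TensorProduct.add_tmul,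
    map_add]
  simp

theorem topWedge_smul_left {l p q : ℕ} (h : p + q = l) (c : ℝ) (a : Alt l p) (b : Alt l q) :
    topWedge h (c • a) b = c * topWedge h a b := by
  have : AlternatingMap.domCoprod (c • a).toAlternatingMap b.toAlternatingMap =
      c • AlternatingMap.domCoprod a.toAlternatingMap b.toAlternatingMap := by
    have h1 : (c • a).toAlternatingMap = c • a.toAlternatingMap := rfl
    rw [h1, ← AlternatingMap.domCoprod'_apply, ← AlternatingMap.domCoprod'_apply,
      ← TensorProduct.smul_tmul', map_smul]
  rw [topWedge, wedge, this]
  exact map_smul (LinearMap.mul' ℝ ℝ) c _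

theorem topWedge_zero_right {l p q : ℕ} (h : p + q = l) (a : Alt l p) :
    topWedge h a (0 : Alt l q) = 0 := by
  have : (0 : Alt l q).toAlternatingMap = 0 := rfl
  simp only [topWedge, wedge, this, ← AlternatingMap.domCoprod'_apply, TensorProduct.tmul_zero,
    map_zero]
  simp

theorem integrableOn_topWedge {l p q : ℕ} (h : p + q = l) {α : Coord l → Alt l p}
    {β : Coord l → Alt l q} {U : Set (Coord l)} (hα : ContinuousOn α U) (hβ : Continuous β)
    (hc : HasCompactSupport β) (hU : tsupport β ⊆ U) :
    IntegrableOn (fun y => topWedge h (α y) (β y)) U := by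
  have h1 : IntegrableOn (fun y => topWedge h (α y) (β y)) (tsupport β) :=
    (continuousOn_topWedge h (hα.mono hU) hβ.continuousOn).integrableOn_compact hc
  refine ((integrableOn_iff_integrable_of_support_subset fun y hy => ?_).mp h1).integrableOn
  by_contra hn
  exact hy (by simp only [image_eq_zero_of_notMem_tsupport hn, topWedge_zero_right])

/-! ### Forms on a manifold without boundary -/

variable {l : ℕ} {K : Type*} [TopologicalSpace K] [ChartedSpace (Coord l) K]

variable (l K) in
/-- Differential forms of degree `j` on `K`, with no regularity assumed. -/
def Form (j : ℕ) : Type _ := (x : K) → (TangentSpace (𝓡 l) x) [⋀^Fin j]→L[ℝ] ℝ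

instance {j : ℕ} : AddCommGroup (Form l K j) :=
  inferInstanceAs (AddCommGroup ((x : K) → (TangentSpace (𝓡 l) x) [⋀^Fin j]→L[ℝ] ℝ))

instance {j : ℕ} : Module ℝ (Form l K j) :=
  inferInstanceAs (Module ℝ ((x : K) → (TangentSpace (𝓡 l) x) [⋀^Fin j]→L[ℝ] ℝ))

/-- The form `α` read in the coordinate system `e`: the pullback of `α` by `e⁻¹`. Only its values
on `e.target` matter. -/
def chartRep {j : ℕ} (e : OpenPartialHomeomorph K (Coord l)) (α : Form l K j) :
    Coord l → Alt l j :=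
  fun y => (α (e.symm y)).compContinuousLinearMap (mfderiv (𝓡 l) (𝓡 l) e.symm y)

/-- `α` is a `C^∞` form. -/
def IsSmooth {j : ℕ} (α : Form l K j) : Prop :=
  ∀ e ∈ IsManifold.maximalAtlas (𝓡 l) ∞ K, ContDiffOn ℝ ∞ (chartRep e α) e.target

/-- `α` is a continuous form. -/
def IsCont {j : ℕ} (α : Form l K j) : Prop :=
  ∀ e ∈ IsManifold.maximalAtlas (𝓡 l) ∞ K, ContinuousOn (chartRep e α) e.target

/-- The exterior differential `dα` of a form on `K`. For smooth `α` its value at `x` may be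
computed in any chart around `x`; we use the preferred one. -/
def extD {j : ℕ} (α : Form l K j) : Form l K (j + 1) := fun x =>
  (extDeriv (chartRep (chartAt (Coord l) x) α)
    (chartAt (Coord l) x x)).compContinuousLinearMap
      (mfderiv (𝓡 l) (𝓡 l) (chartAt (Coord l) x) x)

/-- `η` is a weak exterior differential of `α`: this holds in every coordinate system of `K`. -/
def IsWeakExtDeriv {j : ℕ} (α : Form l K j) (η : Form l K (j + 1)) : Prop :=
  ∀ e ∈ IsManifold.maximalAtlas (𝓡 l) ∞ K,
    IsWeakExtDerivOn (chartRep e α) (chartRep e η) e.target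

/-! ### Linearity, needed for the vector space structures below -/

section Linear

variable {j : ℕ}

theorem chartRep_add (e : OpenPartialHomeomorph K (Coord l)) (α β : Form l K j) :
    chartRep e (α + β) = chartRep e α + chartRep e β := rfl

theorem chartRep_smul (e : OpenPartialHomeomorph K (Coord l)) (c : ℝ) (α : Form l K j) :
    chartRep e (c • α) = c • chartRep e α := rfl

theorem chartRep_zero (e : OpenPartialHomeomorph K (Coord l)) :
    chartRep e (0 : Form l K j) = 0 := rfl

theorem IsSmooth.zero : IsSmooth (0 : Form l K j) :=
  fun e _ => by rw [chartRep_zero]; exact contDiffOn_const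

theorem IsSmooth.add {α β : Form l K j} (hα : IsSmooth α) (hβ : IsSmooth β) :
    IsSmooth (α + β) :=
  fun e he => by rw [chartRep_add]; exact (hα e he).add (hβ e he)

theorem IsSmooth.smul (c : ℝ) {α : Form l K j} (hα : IsSmooth α) : IsSmooth (c • α) :=
  fun e he => by rw [chartRep_smul]; exact contDiffOn_const.smul (hα e he)

theorem IsCont.zero : IsCont (0 : Form l K j) :=
  fun e _ => by rw [chartRep_zero]; exact continuousOn_const

theorem IsCont.add {α β : Form l K j} (hα : IsCont α) (hβ : IsCont β) : IsCont (α + β) :=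
  fun e he => by rw [chartRep_add]; exact (hα e he).add (hβ e he)

theorem IsCont.smul (c : ℝ) {α : Form l K j} (hα : IsCont α) : IsCont (c • α) :=
  fun e he => by rw [chartRep_smul]; exact (hα e he).const_smul c

theorem extD_zero : extD (0 : Form l K j) = 0 := by
  funext x
  have : extDeriv (0 : Coord l → Alt l j) = 0 := by
    funext y
    simpa using extDeriv_smul (0 : ℝ) (0 : Coord l → Alt l j) (x := y)
  rw [extD, chartRep_zero, this]
  rfl

theorem extD_smul (c : ℝ) (α : Form l K j) : extD (c • α) = c • extD α := by
  funext x
  rw [extD, chartRep_smul, extDeriv_smul]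
  rfl

variable [IsManifold (𝓡 l) ∞ K]

theorem IsSmooth.differentiableAt {α : Form l K j} (hα : IsSmooth α) (x : K) :
    DifferentiableAt ℝ (chartRep (chartAt (Coord l) x) α) (chartAt (Coord l) x x) :=
  ((hα _ (IsManifold.chart_mem_maximalAtlas x)).contDiffAt
    ((chartAt (Coord l) x).open_target.mem_nhds (mem_chart_target _ x))).differentiableAt
      (by simp)

theorem extD_add {α β : Form l K j} (hα : IsSmooth α) (hβ : IsSmooth β) :
    extD (α + β) = extD α + extD β := by
  funext x
  rw [extD, chartRep_add, extDeriv_add (hα.differentiableAt x) (hβ.differentiableAt x)]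
  rfl

end Linear

section WeakLinear

variable {j : ℕ}

theorem IsWeakExtDeriv.zero : IsWeakExtDeriv (0 : Form l K j) 0 := by
  intro e _ k h h' φ _ _ _
  have h0 : ∀ {p q : ℕ} (h : p + q = l) (b : Alt l q), topWedge h (0 : Alt l p) b = 0 :=
    fun h b => by simpa using topWedge_smul_left h 0 0 b
  simp [chartRep_zero, h0]

theorem IsWeakExtDeriv.smul (c : ℝ) {α : Form l K j} {η : Form l K (j + 1)}
    (hα : IsWeakExtDeriv α η) : IsWeakExtDeriv (c • α) (c • η) := by
  intro e he k h h' φ h1 h2 h3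
  simp only [chartRep_smul, Pi.smul_apply, topWedge_smul_left, integral_const_mul,
    hα e he k h h' φ h1 h2 h3]
  ring

theorem IsWeakExtDeriv.add {α β : Form l K j} {η θ : Form l K (j + 1)}
    (hα : IsWeakExtDeriv α η) (hβ : IsWeakExtDeriv β θ) (cα : IsCont α) (cβ : IsCont β)
    (cη : IsCont η) (cθ : IsCont θ) : IsWeakExtDeriv (α + β) (η + θ) := by
  intro e he k h h' φ h1 h2 h3
  have hd : Continuous (extDeriv φ) := by
    unfold extDeriv
    exact (ContinuousAlternatingMap.alternatizeUncurryFinCLM ℝ (Coord l) ℝ).continuous.comp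
      (h1.continuous_fderiv (by norm_num))
  have hsub : tsupport (extDeriv φ) ⊆ tsupport φ := by
    refine closure_minimal (fun y hy => ?_) (isClosed_tsupport φ)
    by_contra hn
    refine hy ?_
    rw [(notMem_tsupport_iff_eventuallyEq.mp hn).extDeriv_eq]
    simpa using extDeriv_smul (0 : ℝ) (0 : Coord l → Alt l k) (x := y)
  have hdc : HasCompactSupport (extDeriv φ) := h2.of_isClosed_subset (isClosed_tsupport _) hsub
  have hdU := hsub.trans h3
  simp only [chartRep_add, Pi.add_apply, topWedge_add_left]
  rw [integral_add (integrableOn_topWedge h (cα e he) hd hdc hdU)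
      (integrableOn_topWedge h (cβ e he) hd hdc hdU),
    integral_add (integrableOn_topWedge h' (cη e he) h1.continuous h2 h3)
      (integrableOn_topWedge h' (cθ e he) h1.continuous h2 h3),
    hα e he k h h' φ h1 h2 h3, hβ e he k h h' φ h1 h2 h3]
  ring

end WeakLinear

/-! ### Bounded forms and the two cochain complexes -/

variable [IsManifold (𝓡 l) ∞ K]

variable (l K) in
/-- `C^∞` Riemannian metrics on `K`. -/
abbrev Metric : Type _ :=
  Bundle.ContMDiffRiemannianMetric (𝓡 l) ∞ (Coord l) (fun x : K => TangentSpace (𝓡 l) x)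

/-- `α` is `L^∞`: the norms of the multilinear maps `α x`, with respect to the Riemannian metric,
are bounded by a constant independent of `x`. -/
def IsBdd (g : Metric l K) {j : ℕ} (α : Form l K j) : Prop :=
  ∃ C : ℝ, ∀ (x : K) (v : Fin j → TangentSpace (𝓡 l) x),
    |α x v| ≤ C * ∏ i, √(g.inner x (v i) (v i))

section BddLinear

variable {g : Metric l K} {j : ℕ}

theorem IsBdd.zero : IsBdd g (0 : Form l K j) := 
  ⟨0, fun x v => by
    rw [zero_mul]
    exact (abs_zero (α := ℝ)).le⟩

theorem IsBdd.add {α β : Form l K j} (hα : IsBdd g α) (hβ : IsBdd g β) : IsBdd g (α + β) := by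
  obtain ⟨C, hC⟩ := hα
  obtain ⟨D, hD⟩ := hβ
  refine ⟨C + D, fun x v => ?_⟩
  rw [add_mul]
  exact (abs_add_le _ _).trans (add_le_add (hC x v) (hD x v))

theorem IsBdd.smul (c : ℝ) {α : Form l K j} (hα : IsBdd g α) : IsBdd g (c • α) := by
  obtain ⟨C, hC⟩ := hα
  refine ⟨|c| * C, fun x v => ?_⟩
  rw [mul_assoc]
  refine (abs_mul c (α x v)).le.trans ?_
  exact mul_le_mul_of_nonneg_left (hC x v) (abs_nonneg c)

end BddLinear

/-- `Ω_∞^j(K)`: the `C^∞` forms `α` of degree `j` such that `α` and `dα` are `L^∞`. -/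
def Omega (g : Metric l K) (j : ℕ) : Submodule ℝ (Form l K j) where
  carrier := {α | IsSmooth α ∧ IsBdd g α ∧ IsBdd g (extD α)}
  zero_mem' := ⟨.zero, .zero, by rw [extD_zero]; exact .zero⟩
  add_mem' := fun ha hb =>
    ⟨ha.1.add hb.1, ha.2.1.add hb.2.1, by rw [extD_add ha.1 hb.1]; exact ha.2.2.add hb.2.2⟩
  smul_mem' := fun c _ ha =>
    ⟨ha.1.smul c, ha.2.1.smul c, by rw [extD_smul]; exact ha.2.2.smul c⟩

/-- Cocycles of `Ω_∞^•(K)`: the kernel of `d` in degree `j`. -/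
def Cocycles (g : Metric l K) (j : ℕ) : Submodule ℝ (Form l K j) where
  carrier := {α | α ∈ Omega g j ∧ extD α = 0}
  zero_mem' := ⟨zero_mem _, extD_zero⟩
  add_mem' := fun ha hb => ⟨add_mem ha.1 hb.1, by
    rw [extD_add ha.1.1 hb.1.1, ha.2, hb.2, add_zero]⟩
  smul_mem' := fun c _ ha => ⟨Submodule.smul_mem _ c ha.1, by rw [extD_smul, ha.2, smul_zero]⟩

/-- Coboundaries of `Ω_∞^•(K)`: the image of `d` in degree `j` (zero in degree `0`). -/
def Coboundaries (g : Metric l K) : (j : ℕ) → Submodule ℝ (Form l K j)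
  | 0 => ⊥
  | j + 1 =>
    { carrier := {α | ∃ β ∈ Omega g j, extD β = α}
      zero_mem' := ⟨0, zero_mem _, extD_zero⟩
      add_mem' := by
        rintro _ _ ⟨a, ha, rfl⟩ ⟨b, hb, rfl⟩
        exact ⟨a + b, add_mem ha hb, extD_add ha.1 hb.1⟩
      smul_mem' := by
        rintro c _ ⟨a, ha, rfl⟩
        exact ⟨c • a, Submodule.smul_mem _ c ha, extD_smul c a⟩ }

/-- `H_∞^j(K)`, the cohomology of `Ω_∞^•(K)`: cocycles modulo coboundaries. -/
abbrev Cohomology (g : Metric l K) (j : ℕ) : Type _ :=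
  Cocycles g j ⧸ (Coboundaries g j).submoduleOf (Cocycles g j)

/-- `α` is a bounded continuous form with the bounded continuous weak exterior differential `η`. -/
def HasBddWeakExtDeriv (g : Metric l K) {j : ℕ} (α : Form l K j) (η : Form l K (j + 1)) : Prop :=
  IsCont α ∧ IsBdd g α ∧ IsCont η ∧ IsBdd g η ∧ IsWeakExtDeriv α η

section HasBddLinear

variable {g : Metric l K} {j : ℕ}

theorem HasBddWeakExtDeriv.zero : HasBddWeakExtDeriv g (0 : Form l K j) 0 :=
  ⟨.zero, .zero, .zero, .zero, .zero⟩

theorem HasBddWeakExtDeriv.add {α β : Form l K j} {η θ : Form l K (j + 1)}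
    (hα : HasBddWeakExtDeriv g α η) (hβ : HasBddWeakExtDeriv g β θ) :
    HasBddWeakExtDeriv g (α + β) (η + θ) :=
  ⟨hα.1.add hβ.1, hα.2.1.add hβ.2.1, hα.2.2.1.add hβ.2.2.1, hα.2.2.2.1.add hβ.2.2.2.1,
    hα.2.2.2.2.add hβ.2.2.2.2 hα.1 hβ.1 hα.2.2.1 hβ.2.2.1⟩

theorem HasBddWeakExtDeriv.smul (c : ℝ) {α : Form l K j} {η : Form l K (j + 1)}
    (hα : HasBddWeakExtDeriv g α η) : HasBddWeakExtDeriv g (c • α) (c • η) :=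
  ⟨hα.1.smul c, hα.2.1.smul c, hα.2.2.1.smul c, hα.2.2.2.1.smul c, hα.2.2.2.2.smul c⟩

end HasBddLinear

/-- The space of bounded, weakly differentiable (continuous) forms of degree `j` with a bounded
weak exterior differential. -/
def WeakOmega (g : Metric l K) (j : ℕ) : Submodule ℝ (Form l K j) where
  carrier := {α | ∃ η, HasBddWeakExtDeriv g α η}
  zero_mem' := ⟨0, .zero⟩
  add_mem' := fun ⟨_, ha⟩ ⟨_, hb⟩ => ⟨_, ha.add hb⟩
  smul_mem' := fun c _ ⟨_, ha⟩ => ⟨_, ha.smul c⟩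

/-- Cocycles of the complex of weakly differentiable forms: the forms with weak exterior
differential zero. -/
def WeakCocycles (g : Metric l K) (j : ℕ) : Submodule ℝ (Form l K j) where
  carrier := {α | HasBddWeakExtDeriv g α 0}
  zero_mem' := .zero
  add_mem' := fun ha hb => by simpa using HasBddWeakExtDeriv.add ha hb
  smul_mem' := fun c _ ha => by simpa using HasBddWeakExtDeriv.smul c ha

/-- Coboundaries of the complex of weakly differentiable forms: the weak exterior differentials of
its elements of degree `j - 1` (zero in degree `0`). -/
def WeakCoboundaries (g : Metric l K) : (j : ℕ) → Submodule ℝ (Form l K j)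
  | 0 => ⊥
  | j + 1 =>
    { carrier := {η | ∃ β : Form l K j, HasBddWeakExtDeriv g β η}
      zero_mem' := ⟨0, .zero⟩
      add_mem' := fun ⟨_, ha⟩ ⟨_, hb⟩ => ⟨_, ha.add hb⟩
      smul_mem' := fun c _ ⟨_, ha⟩ => ⟨_, ha.smul c⟩ }

/-- The cohomology of the complex of weakly differentiable forms. -/
abbrev WeakCohomology (g : Metric l K) (j : ℕ) : Type _ :=
  WeakCocycles g j ⧸ (WeakCoboundaries g j).submoduleOf (WeakCocycles g j)

end LInftyForms

end

noncomputable section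

set_option maxSynthPendingDepth 3

namespace LInftyForms

open ContinuousAlternatingMap (alternatizeUncurryFin alternatizeUncurryFinCLM)

/-! ### Algebra of the wedge product -/

/-! The heart of the matter is `HasBddWeakExtDeriv.exists_mem_Omega`: a bounded weakly
differentiable form β whose bounded weak differential is smooth can be written β = γ + d̄Δ with γ
smooth and bounded and with Δ and d̄Δ bounded. If d̄β = 0, then γ is a smooth cocycle in the class
of β, which gives surjectivity in cohomology. If d̄β = z is a smooth cocycle, then γ is a smooth
bounded primitive of z, which gives injectivity. In degree 0 there is no Δ, and β itself turns out
to be smooth.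

The local tool is a chain homotopy on ℝ^l between the identity and mollification. Contracting with a
vector s and averaging along the segments from x to x - s gives an operator H with dH + Hd = id - ρ∗
(`extDeriv_homotopyOp_add`). It does not regularize, but it preserves smoothness, and its norm is at
most a constant times the radius r of the mollifier. For a cutoff χ put θ = d(χ Hβ), with β
truncated to compact support. Where χ = 1 one has β - θ = ρ∗β + H d̄β, which is smooth because d̄β
is. Where β was already smooth, β - θ stays smooth. A small r makes both χ Hβ and θ as small as
desired (`IsWeakExtDerivOn.exists_local_smoothing`).

Globally this correction is made successively in the relatively compact chart domains of a countable
locally finite cover, the n-th one of size at most 2^{-(n+1)} in the Riemannian norm. The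
corrections then add up to at most 1, whatever the geometry of K at infinity, and near each point
only finitely many of them are nonzero (`exists_isPartialSmoothing_univ`).

Products with cutoffs, pullbacks and H are awkward to handle with test forms. They are handled with
strong differentials instead: uniform limits of smooth forms together with their differentials.
Friedrichs' theorem (`IsWeakExtDerivOn.exists_strong`) leads from weak to strong, and Stokes'
theorem with a partition of unity (`isWeakExtDerivOn_of_strong`) leads back, so each identity need
only be proved for smooth forms. -/

/-- Clearing the factor p! q! replaces the sum over shuffles, indexed by a quotient of the
permutation group, by a sum over all permutations, which can be reindexed freely. -/
theorem factorial_mul_topWedge {l p q : ℕ} (h : p + q = l) (a : Alt l p) (b : Alt l q) :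
    ((p.factorial * q.factorial : ℕ) : ℝ) * topWedge h a b =
      ∑ σ : Equiv.Perm (Fin l), ((Equiv.Perm.sign σ : ℤ) : ℝ) *
        ((a fun i => EuclideanSpace.basisFun (Fin l) ℝ (σ (Fin.cast h (Fin.castAdd q i)))) *
         (b fun i => EuclideanSpace.basisFun (Fin l) ℝ (σ (Fin.cast h (Fin.natAdd p i))))) := by
  subst h
  have key := congrArg (fun f => (LinearMap.mul' ℝ ℝ) (f fun i =>
      EuclideanSpace.basisFun (Fin (p + q)) ℝ (finSumFinEquiv i)))
    (MultilinearMap.domCoprod_alternization_eq a.toAlternatingMap b.toAlternatingMap)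
  rw [Fintype.card_fin, Fintype.card_fin, AlternatingMap.smul_apply, map_nsmul,
    nsmul_eq_mul] at key
  have e1 : topWedge rfl a b = (LinearMap.mul' ℝ ℝ)
      ((a.toAlternatingMap.domCoprod b.toAlternatingMap) fun i =>
        EuclideanSpace.basisFun (Fin (p + q)) ℝ (finSumFinEquiv i)) := rfl
  rw [e1, ← key, MultilinearMap.alternatization_apply, map_sum]
  refine Fintype.sum_equiv (Equiv.permCongr finSumFinEquiv) _ _ fun σ => ?_
  rw [map_zsmul_unit, Equiv.Perm.sign_permCongr, Units.smul_def, zsmul_eq_mul]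
  congr 1
  simp [MultilinearMap.domDomCongr_apply, MultilinearMap.domCoprod_apply, Equiv.permCongr_apply]

/-- The exterior product `ξ ∧ b` of a covector and an alternating form. -/
def covWedge {l k : ℕ} : (Coord l →L[ℝ] ℝ) →L[ℝ] Alt l k →L[ℝ] Alt l (k + 1) :=
  (ContinuousLinearMap.compL ℝ (Alt l k) (Coord l →L[ℝ] Alt l k) (Alt l (k + 1))
    (alternatizeUncurryFinCLM ℝ (Coord l) ℝ)).comp
      (ContinuousLinearMap.smulRightL ℝ (Coord l) (Alt l k))

theorem covWedge_eq {l k : ℕ} (ξ : Coord l →L[ℝ] ℝ) (b : Alt l k) :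
    covWedge ξ b = alternatizeUncurryFin (ξ.smulRight b) := rfl

theorem covWedge_apply {l k : ℕ} (ξ : Coord l →L[ℝ] ℝ) (b : Alt l k) (v : Fin (k + 1) → Coord l) :
    covWedge ξ b v = ∑ m : Fin (k + 1), (-1) ^ (m : ℕ) * (ξ (v m) * b fun i => v (m.succAbove i)) := by
  rw [covWedge_eq, ContinuousAlternatingMap.alternatizeUncurryFin_apply]
  simp only [smul_eq_mul, zsmul_eq_mul, ContinuousLinearMap.smulRight_apply,
    ContinuousAlternatingMap.smul_apply]
  push_cast
  rfl

/-- Reindexing by the cycle that moves position `i` to the front and keeps the order of the other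
positions; its sign is (-1)^i. -/
theorem sum_sign_mul_comp_cycleRange {n : ℕ} (G : Equiv.Perm (Fin (n + 1)) → ℝ) (i : Fin (n + 1)) :
    ∑ σ, ((Equiv.Perm.sign σ : ℤ) : ℝ) * G σ =
      (-1) ^ (i : ℕ) * ∑ σ, ((Equiv.Perm.sign σ : ℤ) : ℝ) * G (σ * i.cycleRange) := by
  rw [← Equiv.sum_comp (Equiv.mulRight i.cycleRange), Finset.mul_sum]
  refine Finset.sum_congr rfl fun σ _ => ?_
  simp [Equiv.Perm.sign_mul, Fin.sign_cycleRange]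
  ring

/-- This sign rule is the algebraic half of integration by parts for forms. Both sides are multiples
of the signed sum `Q` in which ξ takes slot 0, followed by the slots of `a` and of `b`. On the left
ξ can sit in k + 1 places, each contributing (-1)^p Q. On the right it can sit in p + 1 places, each
contributing Q. These counts cancel against the factorials. -/
theorem topWedge_covWedge {l p k : ℕ} (h : p + (k + 1) = l) (h' : p + 1 + k = l)
    (a : Alt l p) (ξ : Coord l →L[ℝ] ℝ) (b : Alt l k) :
    topWedge h a (covWedge ξ b) = (-1) ^ p * topWedge h' (covWedge ξ a) b := by
  subst h
  set e := fun i => EuclideanSpace.basisFun (Fin (p + k + 1)) ℝ i with he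
  set Q : ℝ := ∑ σ : Equiv.Perm (Fin (p + k + 1)), ((Equiv.Perm.sign σ : ℤ) : ℝ) *
    ((a fun i => e (σ (Fin.castAdd k i).succ)) *
      (ξ (e (σ 0)) * b fun j => e (σ (Fin.natAdd p j).succ))) with hQ
  have h1 : ((p.factorial * (k + 1).factorial : ℕ) : ℝ) * topWedge rfl a (covWedge ξ b) =
      (k + 1) * ((-1) ^ p * Q) := by
    rw [factorial_mul_topWedge]
    simp only [covWedge_apply, Finset.mul_sum]
    rw [Finset.sum_comm]
    have : ∀ m : Fin (k + 1), (∑ σ : Equiv.Perm (Fin (p + (k + 1))),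
        ((Equiv.Perm.sign σ : ℤ) : ℝ) *
        ((a fun i => e (σ (Fin.cast rfl (Fin.castAdd (k + 1) i)))) * ((-1) ^ (m : ℕ) *
        (ξ (e (σ (Fin.cast rfl (Fin.natAdd p m)))) *
          b fun i => e (σ (Fin.cast rfl (Fin.natAdd p (m.succAbove i)))))))) = (-1) ^ p * Q := by
      intro m
      have := sum_sign_mul_comp_cycleRange (n := p + k)
        (fun σ => (a fun i => e (σ (Fin.cast rfl (Fin.castAdd (k + 1) i)))) * ((-1) ^ (m : ℕ) *
        (ξ (e (σ (Fin.cast rfl (Fin.natAdd p m)))) *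
          b fun i => e (σ (Fin.cast rfl (Fin.natAdd p (m.succAbove i))))))) (Fin.natAdd p m)
      refine this.trans ?_
      rw [hQ, Finset.mul_sum, Finset.mul_sum]
      refine Finset.sum_congr rfl fun σ _ => ?_
      have e1 : ∀ i : Fin p, (Fin.natAdd p m : Fin (p + k + 1)).cycleRange
          (Fin.castAdd (k + 1) i) = (Fin.castAdd k i).succ := by
        intro i
        have : (Fin.castAdd (k + 1) i : Fin (p + k + 1)) =
            (Fin.natAdd p m : Fin (p + k + 1)).succAbove (Fin.castAdd k i) := by
          rw [Fin.succAbove_of_castSucc_lt]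
          · ext; simp
          · rw [Fin.lt_def]; simp; omega
        rw [this, Fin.cycleRange_succAbove]
      have e2 : (Fin.natAdd p m : Fin (p + k + 1)).cycleRange (Fin.natAdd p m) = 0 :=
        Fin.cycleRange_self _
      have e3 : ∀ j : Fin k, (Fin.natAdd p m : Fin (p + k + 1)).cycleRange
          (Fin.natAdd p (m.succAbove j)) = (Fin.natAdd p j).succ := by
        intro j
        have : (Fin.natAdd p (m.succAbove j) : Fin (p + k + 1)) =
            (Fin.natAdd p m : Fin (p + k + 1)).succAbove (Fin.natAdd p j) := by
          ext
          simp only [Fin.succAbove, Fin.lt_def, Fin.val_natAdd, Fin.val_castSucc]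
          split_ifs <;> simp_all <;> omega
        rw [this, Fin.cycleRange_succAbove]
      -- The first factor is the sign of the cycle, the second the sign of the m-th term in the
      -- expansion of ξ ∧ b.
      have e4 : ((-1 : ℝ) ^ (p + (m : ℕ))) * (-1) ^ (m : ℕ) = (-1) ^ p := by
        rw [pow_add, mul_assoc, ← pow_add, ← two_mul, pow_mul]; simp
      simp only [Equiv.Perm.mul_apply, Fin.cast_refl, id, e1, e2, e3,
        Fin.val_natAdd, ← e4]
      ring
    trans ∑ _m : Fin (k + 1), (-1) ^ p * Q
    swap
    · simp
    refine Finset.sum_congr rfl fun m _ => ?_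
    exact this m
  have h2 : (((p + 1).factorial * k.factorial : ℕ) : ℝ) * topWedge h' (covWedge ξ a) b =
      (p + 1) * Q := by
    rw [factorial_mul_topWedge]
    simp only [covWedge_apply, Finset.mul_sum, Finset.sum_mul]
    rw [Finset.sum_comm]
    have : ∀ m : Fin (p + 1), (∑ σ : Equiv.Perm (Fin (p + (k + 1))),
        ((Equiv.Perm.sign σ : ℤ) : ℝ) *
        ((-1) ^ (m : ℕ) * (ξ (e (σ (Fin.cast h' (Fin.castAdd k m)))) *
          a fun i => e (σ (Fin.cast h' (Fin.castAdd k (m.succAbove i))))) *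
          b fun i => e (σ (Fin.cast h' (Fin.natAdd (p + 1) i))))) = Q := by
      intro m
      have := sum_sign_mul_comp_cycleRange (n := p + k)
        (fun σ => (-1) ^ (m : ℕ) * (ξ (e (σ (Fin.cast h' (Fin.castAdd k m)))) *
          a fun i => e (σ (Fin.cast h' (Fin.castAdd k (m.succAbove i))))) *
          b fun i => e (σ (Fin.cast h' (Fin.natAdd (p + 1) i)))) (Fin.cast h' (Fin.castAdd k m))
      refine this.trans ?_
      rw [hQ, Finset.mul_sum]
      refine Finset.sum_congr rfl fun σ _ => ?_
      have e1 : ∀ i : Fin k, (Fin.cast h' (Fin.castAdd k m) : Fin (p + k + 1)).cycleRange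
          (Fin.cast h' (Fin.natAdd (p + 1) i)) = (Fin.natAdd p i).succ := by
        intro i
        have : (Fin.cast h' (Fin.natAdd (p + 1) i) : Fin (p + k + 1)) =
            (Fin.cast h' (Fin.castAdd k m) : Fin (p + k + 1)).succAbove (Fin.natAdd p i) := by
          rw [Fin.succAbove_of_le_castSucc]
          · ext; simp; omega
          · rw [Fin.le_def]; simp; omega
        rw [this, Fin.cycleRange_succAbove]
      have e2 : (Fin.cast h' (Fin.castAdd k m) : Fin (p + k + 1)).cycleRange
        (Fin.cast h' (Fin.castAdd k m)) = 0 := Fin.cycleRange_self _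
      have e3 : ∀ j : Fin p, (Fin.cast h' (Fin.castAdd k m) : Fin (p + k + 1)).cycleRange
          (Fin.cast h' (Fin.castAdd k (m.succAbove j))) = (Fin.castAdd k j).succ := by
        intro j
        have : (Fin.cast h' (Fin.castAdd k (m.succAbove j)) : Fin (p + k + 1)) =
            (Fin.cast h' (Fin.castAdd k m) : Fin (p + k + 1)).succAbove (Fin.castAdd k j) := by
          ext
          simp only [Fin.succAbove, Fin.lt_def, Fin.val_castAdd, Fin.val_castSucc, Fin.val_cast]
          split_ifs <;> simp_all
        rw [this, Fin.cycleRange_succAbove]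
      have e4 : ((-1 : ℝ) ^ (m : ℕ)) * (-1) ^ (m : ℕ) = 1 := by
        rw [← pow_add, ← two_mul, pow_mul]; simp
      simp only [Equiv.Perm.mul_apply, e1, e2, e3, Fin.val_castAdd, Fin.val_cast]
      linear_combination (((Equiv.Perm.sign σ : ℤ) : ℝ) *
        ((a fun i => e (σ (Fin.castAdd k i).succ)) *
        (ξ (e (σ 0)) * b fun j => e (σ (Fin.natAdd p j).succ)))) * e4
    trans ∑ _m : Fin (p + 1), Q
    swap
    · simp
    exact Finset.sum_congr rfl fun m _ => this m
  have hp : ((p.factorial : ℕ) : ℝ) ≠ 0 := by positivity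
  have hk : ((k.factorial : ℕ) : ℝ) ≠ 0 := by positivity
  have hp' : (p + 1 : ℝ) ≠ 0 := by positivity
  have hk' : (k + 1 : ℝ) ≠ 0 := by positivity
  rw [Nat.factorial_succ] at h1 h2
  push_cast at h1 h2
  have h3 : (p.factorial : ℝ) * k.factorial * topWedge rfl a (covWedge ξ b) = (-1) ^ p * Q := by
    apply mul_left_cancel₀ hk'; linear_combination h1
  have h4 : (p.factorial : ℝ) * k.factorial * topWedge h' (covWedge ξ a) b = Q := by
    apply mul_left_cancel₀ hp'; linear_combination h2
  apply mul_left_cancel₀ (mul_ne_zero hp hk)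
  rw [h3, ← h4]; ring

/-- Since p < l, every family of p basis vectors e_I misses some e_i, and (dx_i ∧ a)(e_i, e_I) =
a(e_I). -/
theorem eq_zero_of_covWedge_eq_zero {l p : ℕ} (hp : p < l) (a : Alt l p)
    (ha : ∀ ξ, covWedge ξ a = 0) : a = 0 := by
  apply ContinuousAlternatingMap.toAlternatingMap_injective
  refine Module.Basis.ext_alternating (EuclideanSpace.basisFun (Fin l) ℝ).toBasis fun I hI => ?_
  obtain ⟨i, hi⟩ : ∃ i, i ∉ Set.range I := by
    by_contra hn
    push Not at hn
    have := Fintype.card_le_of_surjective I hn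
    simp at this; omega
  have := DFunLike.congr_fun (ha (EuclideanSpace.proj i))
    (Fin.cons (EuclideanSpace.basisFun (Fin l) ℝ i) fun m => EuclideanSpace.basisFun (Fin l) ℝ (I m))
  rw [covWedge_apply, Fin.sum_univ_succ, Finset.sum_eq_zero] at this
  · simpa [Fin.removeNth] using this
  · intro m _
    have : I m ≠ i := fun h => hi ⟨m, h⟩
    simp [this]

/-- Nondegeneracy of the wedge pairing, by which an identity tested against all forms becomes an
identity of forms. By induction on q, covectors are moved from `b` to `a` until `a` has top degree.
-/
theorem eq_zero_of_topWedge_eq_zero {l p q : ℕ} (h : p + q = l) (a : Alt l p)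
    (ha : ∀ b : Alt l q, topWedge h a b = 0) : a = 0 := by
  induction q generalizing p with
  | zero =>
    obtain rfl : p = l := by omega
    set B := (EuclideanSpace.basisFun (Fin p) ℝ)
    have h1 := factorial_mul_topWedge h a
      (ContinuousAlternatingMap.constOfIsEmpty ℝ (Coord p) (Fin 0) (1 : ℝ))
    rw [ha, mul_zero] at h1
    have h2 : ∀ σ : Equiv.Perm (Fin p), (a fun i => B (σ (Fin.cast h (Fin.castAdd 0 i)))) =
        ((Equiv.Perm.sign σ : ℤ) : ℝ) * a fun i => B i := by
      intro σ
      have := a.toAlternatingMap.map_perm (fun i => B i) σ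
      rw [Units.smul_def, zsmul_eq_mul] at this
      exact this
    simp only [B] at h2
    simp only [h2, ContinuousAlternatingMap.constOfIsEmpty_apply, mul_one] at h1
    have h3 : ∀ σ : Equiv.Perm (Fin p), ((Equiv.Perm.sign σ : ℤ) : ℝ) *
        ((Equiv.Perm.sign σ : ℤ) : ℝ) = 1 := by
      intro σ
      rw [← Int.cast_mul, ← Units.val_mul, Int.units_mul_self]
      simp
    simp only [← mul_assoc, h3, one_mul, Finset.sum_const, nsmul_eq_mul] at h1
    have h4 : a (fun i => B i) = 0 := by
      have : ((Finset.univ : Finset (Equiv.Perm (Fin p))).card : ℝ) ≠ 0 := by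
        simp [Fintype.card_perm, Nat.factorial_ne_zero]
      exact (mul_eq_zero.mp h1.symm).resolve_left this
    apply ContinuousAlternatingMap.toAlternatingMap_injective
    refine Module.Basis.ext_alternating B.toBasis fun I hI => ?_
    have h5 : (a fun i => B (I i)) = 0 := by
      have := h2 (Equiv.ofBijective I (Finite.injective_iff_bijective.mp hI))
      exact this.trans (by rw [show (a fun i => B i) = 0 from h4, mul_zero])
    simpa using h5
  | succ q ih =>
    refine eq_zero_of_covWedge_eq_zero (by omega) a fun ξ => ih (by omega) _ fun b => ?_
    have := topWedge_covWedge h (by omega) a ξ b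
    rw [ha] at this
    exact (mul_eq_zero.mp this.symm).resolve_left (by simp)

/-- Contraction of an alternating form with a vector. -/
def contr {l k : ℕ} : Coord l →L[ℝ] Alt l (k + 1) →L[ℝ] Alt l k :=
  (ContinuousAlternatingMap.curryLeftLI (𝕜 := ℝ) (E := Coord l) (F := ℝ) (n := k)).toContinuousLinearMap.flip

theorem contr_apply {l k : ℕ} (s : Coord l) (a : Alt l (k + 1)) (v : Fin k → Coord l) :
    contr s a v = a (Fin.cons s v) := rfl

/-- Cartan's formula for a constant vector s: with L = Db it reads d(ι_s b) + ι_s db = ∂_s b. In ι_s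
db the slot holding s gives L s, and the remaining slots cancel the first summand. -/
theorem contr_alternatize_add {l k : ℕ} (s : Coord l) (L : Coord l →L[ℝ] Alt l (k + 1)) :
    alternatizeUncurryFin ((contr s).comp L) + contr s (alternatizeUncurryFin L) = L s := by
  ext v
  rw [ContinuousAlternatingMap.add_apply, contr_apply,
    ContinuousAlternatingMap.alternatizeUncurryFin_apply,
    ContinuousAlternatingMap.alternatizeUncurryFin_apply, Fin.sum_univ_succ (n := k + 1)]
  have : ∀ m : Fin (k + 1), (Fin.succ m).removeNth (Fin.cons s v : Fin (k + 2) → Coord l) =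
      Fin.cons s (m.removeNth v) := fun m => by
    ext i : 1
    refine Fin.cases ?_ (fun i => ?_) i <;> simp [Fin.removeNth]
  have h0 : (0 : Fin (k + 2)).removeNth (Fin.cons s v : Fin (k + 2) → Coord l) = v := by
    ext i : 1; simp [Fin.removeNth]
  simp [this, h0, contr_apply, pow_succ]

theorem contr_alternatize_zero {l : ℕ} (s : Coord l) (L : Coord l →L[ℝ] Alt l 0) :
    contr s (alternatizeUncurryFin L) = L s := by
  ext v
  rw [contr_apply, ContinuousAlternatingMap.alternatizeUncurryFin_apply]
  have h0 : ∀ f : Fin (0 + 1) → ℝ, ∑ i, f i = f 0 := fun f => Fin.sum_univ_one f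
  rw [h0]
  simp only [Fin.val_zero, pow_zero, one_smul, Fin.cons_zero]
  congr 1

theorem topWedge_add_right {l p q : ℕ} (h : p + q = l) (a : Alt l p) (b b' : Alt l q) :
    topWedge h a (b + b') = topWedge h a b + topWedge h a b' := by
  have : (b + b').toAlternatingMap = b.toAlternatingMap + b'.toAlternatingMap := rfl
  simp only [topWedge, wedge, this, ← AlternatingMap.domCoprod'_apply, TensorProduct.tmul_add,
    map_add]
  simp

theorem topWedge_smul_right {l p q : ℕ} (h : p + q = l) (c : ℝ) (a : Alt l p) (b : Alt l q) :
    topWedge h a (c • b) = c * topWedge h a b := by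
  have : AlternatingMap.domCoprod a.toAlternatingMap (c • b).toAlternatingMap =
      c • AlternatingMap.domCoprod a.toAlternatingMap b.toAlternatingMap := by
    have h1 : (c • b).toAlternatingMap = c • b.toAlternatingMap := rfl
    rw [h1, ← AlternatingMap.domCoprod'_apply, ← AlternatingMap.domCoprod'_apply,
      TensorProduct.tmul_smul, map_smul]
  rw [topWedge, wedge, this]
  exact map_smul (LinearMap.mul' ℝ ℝ) c _

instance (l k : ℕ) : FiniteDimensional ℝ (Alt l k) :=
  FiniteDimensional.of_injective
    ((ContinuousMultilinearMap.toMultilinearMapLinear (R' := ℝ) (A := ℝ)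
      (M₁ := fun _ : Fin k => Coord l) (M₂ := ℝ)).comp
        (ContinuousAlternatingMap.toContinuousMultilinearMapLinear (R := ℝ) (A := ℝ) (M := Coord l)
          (N := ℝ) (ι := Fin k)))
    (ContinuousMultilinearMap.toMultilinearMap_injective.comp
      ContinuousAlternatingMap.toContinuousMultilinearMap_injective)

/-- `topWedge` as a continuous bilinear map. -/
def topWedgeL {l p q : ℕ} (h : p + q = l) : Alt l p →L[ℝ] Alt l q →L[ℝ] ℝ :=
  LinearMap.toContinuousLinearMap (𝕜 := ℝ) (E := Alt l p) (F' := Alt l q →L[ℝ] ℝ)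
    ((LinearMap.toContinuousLinearMap (𝕜 := ℝ) : (Alt l q →ₗ[ℝ] ℝ) ≃ₗ[ℝ] Alt l q →L[ℝ] ℝ).toLinearMap ∘ₗ
      LinearMap.mk₂ ℝ (topWedge h) (topWedge_add_left h) (topWedge_smul_left h)
        (topWedge_add_right h) (topWedge_smul_right h))

theorem topWedgeL_apply {l p q : ℕ} (h : p + q = l) (a : Alt l p) (b : Alt l q) :
    topWedgeL h a b = topWedge h a b := rfl

end LInftyForms

end

noncomputable section

set_option maxSynthPendingDepth 3

namespace LInftyForms

open ContinuousAlternatingMap (alternatizeUncurryFin alternatizeUncurryFinCLM)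
open Set Filter Topology

/-! ### Exterior derivatives on Euclidean space -/

section ExtDeriv

variable {l j : ℕ}

theorem alt_eq_zero_of_lt {k : ℕ} (h : l < k) (a : Alt l k) : a = 0 := by
  apply ContinuousAlternatingMap.toAlternatingMap_injective
  refine Module.Basis.ext_alternating (EuclideanSpace.basisFun (Fin l) ℝ).toBasis fun I hI => ?_
  have := Fintype.card_le_of_injective I hI
  simp at this; omega

theorem extDeriv_eq {b : Coord l → Alt l j} (y : Coord l) :
    extDeriv b y = alternatizeUncurryFinCLM ℝ (Coord l) ℝ (fderiv ℝ b y) := rfl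

theorem extDeriv_mul {f : Coord l → ℝ} {b : Coord l → Alt l j} {y : Coord l}
    (hf : DifferentiableAt ℝ f y) (hb : DifferentiableAt ℝ b y) :
    extDeriv (fun z => f z • b z) y = covWedge (fderiv ℝ f y) (b y) + f y • extDeriv b y := by
  rw [extDeriv_eq, fderiv_fun_smul hf hb, map_add, map_smul]
  exact add_comm _ _

theorem extDeriv_mul_const {f : Coord l → ℝ} {y : Coord l} (hf : DifferentiableAt ℝ f y)
    (c : Alt l j) : extDeriv (fun z => f z • c) y = covWedge (fderiv ℝ f y) c := by
  have h0 : extDeriv (fun _ : Coord l => c) y = 0 := by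
    rw [extDeriv_eq]; simp [-ContinuousAlternatingMap.alternatizeUncurryFinCLM_apply]
  rw [extDeriv_mul hf (differentiableAt_const c), h0, smul_zero, add_zero]

/-- The formula d = Σ dx_i ∧ ∂_i, which reduces Stokes' theorem to integration by parts in each
coordinate. -/
theorem extDeriv_eq_sum (b : Coord l → Alt l j) (y : Coord l) :
    extDeriv b y = ∑ i, covWedge (EuclideanSpace.proj i : Coord l →L[ℝ] ℝ)
      (fderiv ℝ b y (EuclideanSpace.basisFun (Fin l) ℝ i)) := by
  have : fderiv ℝ b y = ∑ i, (EuclideanSpace.proj i : Coord l →L[ℝ] ℝ).smulRight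
      (fderiv ℝ b y (EuclideanSpace.basisFun (Fin l) ℝ i)) := by
    ext1 v
    conv_lhs => rw [← (EuclideanSpace.basisFun (Fin l) ℝ).sum_repr v]
    simp [map_sum]
  rw [extDeriv_eq]
  conv_lhs => rw [this]
  rw [map_sum]
  rfl

theorem continuous_extDeriv {b : Coord l → Alt l j} (hb : ContDiff ℝ 1 b) :
    Continuous (extDeriv b) :=
  (alternatizeUncurryFinCLM ℝ (Coord l) ℝ).continuous.comp (hb.continuous_fderiv one_ne_zero)

theorem contDiffAt_extDeriv {b : Coord l → Alt l j} {y : Coord l} (hb : ContDiffAt ℝ ∞ b y) :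
    ContDiffAt ℝ ∞ (extDeriv b) y :=
  (alternatizeUncurryFinCLM ℝ (Coord l) ℝ).contDiff.contDiffAt.comp y (hb.fderiv_right (by simp))

theorem contDiffOn_extDeriv {b : Coord l → Alt l j} {U : Set (Coord l)} (hU : IsOpen U)
    (hb : ContDiffOn ℝ ∞ b U) : ContDiffOn ℝ ∞ (extDeriv b) U := fun _ hy =>
  (contDiffAt_extDeriv (hb.contDiffAt (hU.mem_nhds hy))).contDiffWithinAt

theorem extDeriv_eq_zero_of_notMem_tsupport {b : Coord l → Alt l j} {y : Coord l}
    (hy : y ∉ tsupport b) : extDeriv b y = 0 := by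
  rw [(notMem_tsupport_iff_eventuallyEq.mp hy).extDeriv_eq]
  simpa using extDeriv_smul (0 : ℝ) (0 : Coord l → Alt l j) (x := y)

theorem tsupport_extDeriv_subset (b : Coord l → Alt l j) : tsupport (extDeriv b) ⊆ tsupport b := by
  refine closure_minimal (fun y hy => ?_) (isClosed_tsupport b)
  by_contra hn
  exact hy (extDeriv_eq_zero_of_notMem_tsupport hn)

theorem hasCompactSupport_extDeriv {b : Coord l → Alt l j} (hb : HasCompactSupport b) :
    HasCompactSupport (extDeriv b) :=
  hb.of_isClosed_subset (isClosed_tsupport _) (tsupport_extDeriv_subset b)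

/-- **Stokes' theorem**: a form that is smooth on an open set has its exterior derivative as weak
exterior derivative. -/
theorem isWeakExtDerivOn_extDeriv {b : Coord l → Alt l j} {U : Set (Coord l)} (hU : IsOpen U)
    (hb : ContDiffOn ℝ ∞ b U) : IsWeakExtDerivOn b (extDeriv b) U := by
  intro k h h' φ hφ hc hs
  have hdiff : ∀ y ∈ tsupport φ, DifferentiableAt ℝ b y := fun y hy =>
    (hb.contDiffAt (hU.mem_nhds (hs hy))).differentiableAt (by simp)
  have hsφ : Function.support φ ⊆ U := (subset_tsupport φ).trans hs
  have hdφs : Function.support (extDeriv φ) ⊆ U :=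
    (subset_tsupport _).trans ((tsupport_extDeriv_subset φ).trans hs)
  have z1 : ∀ {p q : ℕ} (h : p + q = l) (α : Coord l → Alt l p) (β : Coord l → Alt l q),
      Function.support β ⊆ U →
      ∫ y in U, topWedge h (α y) (β y) = ∫ y, topWedge h (α y) (β y) := by
    intro p q h α β hβ
    refine setIntegral_eq_integral_of_forall_compl_eq_zero fun y hy => ?_
    have : β y = 0 := by
      by_contra hn; exact hy (hβ hn)
    rw [this, topWedge_zero_right]
  -- As φ has compact support in `U`, the integrals may be taken over the whole space, where
  -- integration by parts has no boundary term.
  rw [z1 _ _ _ hdφs, z1 _ _ _ hsφ]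
  let e := EuclideanSpace.basisFun (Fin l) ℝ
  let W : Fin l → ∀ {k : ℕ}, Alt l k →L[ℝ] Alt l (k + 1) := fun i _ =>
    covWedge (EuclideanSpace.proj i : Coord l →L[ℝ] ℝ)
  have hφ1 : ContDiff ℝ 1 φ := hφ.of_le (by norm_num)
  have hcφ' : ∀ i, Continuous fun y => W i (fderiv ℝ φ y (e i)) := fun i =>
    (W i).continuous.comp ((hφ1.continuous_fderiv one_ne_zero).clm_apply continuous_const)
  have hcW : ∀ i, Continuous fun y => W i (φ y) := fun i => (W i).continuous.comp hφ.continuous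
  have int1 : ∀ {p q : ℕ} (h : p + q = l) (α : Coord l → Alt l p) (β : Coord l → Alt l q),
      ContinuousOn α U → Continuous β → tsupport β ⊆ tsupport φ →
      Integrable fun y => topWedge h (α y) (β y) := by
    intro p q h α β hα hβ hβs
    refine (integrableOn_iff_integrable_of_support_subset fun y hy => ?_).mp
      (integrableOn_topWedge h hα hβ (hc.of_isClosed_subset (isClosed_tsupport _) hβs)
        (hβs.trans hs))
    refine hs (hβs (subset_tsupport _ ?_))
    intro hn
    exact hy (by simp only [hn, topWedge_zero_right])
  have sub1 : ∀ i, tsupport (fun y => W i (fderiv ℝ φ y (e i))) ⊆ tsupport φ := fun i => by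
    refine closure_minimal (fun y hy => ?_) (isClosed_tsupport φ)
    by_contra hn
    refine hy ?_
    have : fderiv ℝ φ y = 0 := by
      by_contra h0
      exact hn (tsupport_fderiv_subset ℝ (subset_tsupport _ h0))
    simp [this]
  have sub2 : ∀ i, tsupport (fun y => W i (φ y)) ⊆ tsupport φ := fun i => by
    refine closure_minimal (fun y hy => ?_) (isClosed_tsupport φ)
    by_contra hn
    exact hy (by simp [image_eq_zero_of_notMem_tsupport hn])
  have hbU : ContinuousOn b U := hb.continuousOn
  have hfb : ∀ i, ContinuousOn (fun y => fderiv ℝ b y (e i)) U := fun i =>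
    ((hb.continuousOn_fderiv_of_isOpen hU (by simp))).clm_apply continuousOn_const
  -- The sign (-1)^(j+1) combines the -1 of integration by parts with the (-1)^j of
  -- `topWedge_covWedge`.
  have ibp : ∀ i, ∫ y, topWedge h (b y) (W i (fderiv ℝ φ y (e i))) =
      (-1) ^ (j + 1) * ∫ y, topWedge h' (W i (fderiv ℝ b y (e i))) (φ y) := by
    intro i
    have key := integral_bilinear_fderiv_right_eq_neg_left_of_integrable (μ := volume)
      (f := b) (g := φ) (v := e i)
      (B := ((ContinuousLinearMap.compL ℝ (Alt l k) (Alt l (k + 1)) ℝ).flip (W i)).comp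
        (topWedgeL h)) ?_ ?_ ?_ hdiff
      (fun y _ => (hφ1.differentiable one_ne_zero) y)
    · simp only [ContinuousLinearMap.comp_apply, ContinuousLinearMap.flip_apply,
        ContinuousLinearMap.compL_apply, topWedgeL_apply] at key
      rw [key, ← integral_neg, ← integral_const_mul]
      congr 1 with y
      rw [topWedge_covWedge h h']
      ring
    · exact int1 h (fun y => fderiv ℝ b y (e i)) (fun y => W i (φ y)) (hfb i) (hcW i) (sub2 i)
    · exact int1 h b _ hbU (hcφ' i) (sub1 i)
    · exact int1 h b _ hbU (hcW i) (sub2 i)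
  have e1 : ∀ y, topWedge h (b y) (extDeriv φ y) =
      ∑ i, topWedge h (b y) (W i (fderiv ℝ φ y (e i))) := fun y => by
    rw [extDeriv_eq_sum, ← topWedgeL_apply, map_sum]; rfl
  have e2 : ∀ y, topWedge h' (extDeriv b y) (φ y) =
      ∑ i, topWedge h' (W i (fderiv ℝ b y (e i))) (φ y) := fun y => by
    rw [extDeriv_eq_sum, ← topWedgeL_apply, map_sum, sum_apply]; rfl
  simp only [e1, e2]
  rw [integral_finsetSum _ fun i _ => int1 h b _ hbU (hcφ' i) (sub1 i),
    integral_finsetSum _ fun i _ => int1 h' (fun y => W i (fderiv ℝ b y (e i))) φ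
      ((W i).continuous.comp_continuousOn (hfb i)) hφ.continuous subset_rfl, Finset.mul_sum]
  exact Finset.sum_congr rfl fun i _ => ibp i

end ExtDeriv

/-! ### Mollification -/

section Mollify

variable {l : ℕ}

/-- The convolution with a normalized bump function. -/
def mollify {F : Type*} [NormedAddCommGroup F] [NormedSpace ℝ F] (φ : ContDiffBump (0 : Coord l))
    (b : Coord l → F) : Coord l → F :=
  convolution (φ.normed volume) b (ContinuousLinearMap.lsmul ℝ ℝ) volume

variable {j : ℕ}

theorem contDiff_mollify (φ : ContDiffBump (0 : Coord l)) {b : Coord l → Alt l j}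
    (hb : LocallyIntegrable b) : ContDiff ℝ ∞ (mollify φ b) :=
  φ.hasCompactSupport_normed.contDiff_convolution_left _ φ.contDiff_normed hb

theorem topWedge_integral {p q : ℕ} (h : p + q = l) {f : Coord l → Alt l p}
    (hf : Integrable f) (c : Alt l q) :
    topWedge h (∫ t, f t) c = ∫ t, topWedge h (f t) c :=
  (((topWedgeL h).flip c).integral_comp_comm hf).symm

theorem integral_topWedge_indicator {p q : ℕ} (h : p + q = l) (α : Coord l → Alt l p)
    {β : Coord l → Alt l q} {U L : Set (Coord l)} (hU : MeasurableSet U) (hLU : L ⊆ U)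
    (hβ : tsupport β ⊆ L) :
    ∫ y in U, topWedge h (α y) (β y) = ∫ y, topWedge h (L.indicator α y) (β y) := by
  have h0 : ∀ y ∉ L, β y = 0 := fun y hy =>
    image_eq_zero_of_notMem_tsupport fun h1 => hy (hβ h1)
  rw [← setIntegral_eq_integral_of_forall_compl_eq_zero (s := U)
    (f := fun y => topWedge h (L.indicator α y) (β y))]
  · refine setIntegral_congr_fun hU fun y _ => ?_
    by_cases hy : y ∈ L
    · simp only [indicator_of_mem hy]
    · simp only [h0 y hy, topWedge_zero_right]
  · intro y hy
    simp only [h0 y fun h1 => hy (hLU h1), topWedge_zero_right]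

/-- The differential of a convolution falls on the kernel. The kernel times a constant form c, ψ(t)
= ρ(x - t) c, is an admissible test form when the ball around x lies in `L`, and the weak identity
for ψ is the claim paired with c. Cutting off by the indicator of `L` makes the forms globally
integrable without affecting the values at x. -/
theorem extDeriv_mollify_of_isWeakExtDerivOn {b : Coord l → Alt l j} {a : Coord l → Alt l (j + 1)}
    {U L : Set (Coord l)} (hU : IsOpen U) (hw : IsWeakExtDerivOn b a U) (hb : ContinuousOn b U)
    (ha : ContinuousOn a U) (hL : IsCompact L) (hLU : L ⊆ U) (φ : ContDiffBump (0 : Coord l))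
    {x : Coord l} (hx : Metric.closedBall x φ.rOut ⊆ L) :
    extDeriv (mollify φ (L.indicator b)) x = mollify φ (L.indicator a) x := by
  set ρ := φ.normed volume with hρ
  have hρ1 : ContDiff ℝ ∞ ρ := φ.contDiff_normed
  have hbi : Integrable (L.indicator b) :=
    ((hb.mono hLU).integrableOn_compact hL).integrable_indicator hL.measurableSet
  have hai : Integrable (L.indicator a) :=
    ((ha.mono hLU).integrableOn_compact hL).integrable_indicator hL.measurableSet
  -- Above the top degree there are no test forms, but all forms vanish.
  rcases lt_or_ge l (j + 1) with hlt | hge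
  · rw [alt_eq_zero_of_lt hlt (extDeriv _ x), alt_eq_zero_of_lt hlt (mollify _ _ x)]
  obtain ⟨k, h'⟩ := Nat.exists_eq_add_of_le hge
  have h : j + (k + 1) = l := by omega
  rw [← sub_eq_zero]
  refine eq_zero_of_topWedge_eq_zero h'.symm _ fun c => ?_
  have hint : Integrable (fun t => (fderiv ℝ ρ (x - t)).smulRight (L.indicator b t)) := by
    have := (φ.hasCompactSupport_normed.fderiv (𝕜 := ℝ) (f := ρ)).convolutionExists_left
      (μ := volume) ((ContinuousLinearMap.lsmul ℝ ℝ : ℝ →L[ℝ] Alt l j →L[ℝ] Alt l j).precompL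
        (Coord l)) (hρ1.continuous_fderiv (by simp)) hbi.locallyIntegrable x
    exact this.integrable_swap
  have hexd : extDeriv (mollify φ (L.indicator b)) x =
      ∫ t, covWedge (fderiv ℝ ρ (x - t)) (L.indicator b t) := by
    have h1 := φ.hasCompactSupport_normed.hasFDerivAt_convolution_left (μ := volume)
      (ContinuousLinearMap.lsmul ℝ ℝ : ℝ →L[ℝ] Alt l j →L[ℝ] Alt l j)
      (hρ1.of_le (by simp)) hbi.locallyIntegrable x
    rw [extDeriv_eq]
    rw [show fderiv ℝ (mollify φ (L.indicator b)) x = _ from h1.fderiv, convolution_eq_swap]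
    exact ((alternatizeUncurryFinCLM ℝ (Coord l) ℝ).integral_comp_comm hint).symm
  set ψ : Coord l → Alt l k := fun t => ρ (x - t) • c with hψ
  have hρx : ContDiff ℝ ∞ fun t => ρ (x - t) := hρ1.comp (contDiff_const.sub contDiff_id)
  have hψ1 : ContDiff ℝ ∞ ψ := hρx.smul contDiff_const
  have hψs : tsupport ψ ⊆ Metric.closedBall x φ.rOut := by
    refine closure_minimal (fun t ht => ?_) Metric.isClosed_closedBall
    have h1 : ρ (x - t) ≠ 0 := fun h0 => ht (by simp only [hψ, h0, zero_smul])
    have h2 : x - t ∈ Metric.ball (0 : Coord l) φ.rOut := by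
      rw [← φ.support_normed_eq (μ := volume)]; exact h1
    rw [mem_ball_zero_iff] at h2
    rw [Metric.mem_closedBall, dist_comm, dist_eq_norm]
    exact h2.le
  have hψd : ∀ t, extDeriv ψ t = -covWedge (fderiv ℝ ρ (x - t)) c := by
    intro t
    rw [extDeriv_mul_const ((hρx.differentiable (by simp)) t)]
    have : fderiv ℝ (fun t => ρ (x - t)) t = -fderiv ℝ ρ (x - t) := by
      have h1 := ((hρ1.differentiable (by simp)) (x - t)).hasFDerivAt.comp t
        ((hasFDerivAt_id t).const_sub x)
      refine h1.fderiv.trans ?_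
      simp
    rw [this, map_neg, neg_apply]
  have hsL : tsupport ψ ⊆ L := hψs.trans hx
  have hw' := hw k h h'.symm ψ (hψ1.of_le (by norm_cast))
    (hL.of_isClosed_subset (isClosed_tsupport ψ) hsL) (hsL.trans hLU)
  rw [integral_topWedge_indicator h b hU.measurableSet hLU ((tsupport_extDeriv_subset ψ).trans hsL),
    integral_topWedge_indicator h'.symm a hU.measurableSet hLU hsL] at hw'
  have e1 : topWedge h'.symm (extDeriv (mollify φ (L.indicator b)) x) c =
      (-1) ^ (j + 1) * ∫ y, topWedge h (L.indicator b y) (extDeriv ψ y) := by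
    rw [hexd, topWedge_integral h'.symm
      (f := fun t => covWedge (fderiv ℝ ρ (x - t)) (L.indicator b t))
      ((alternatizeUncurryFinCLM ℝ (Coord l) ℝ).integrable_comp hint), ← integral_const_mul]
    congr 1 with t
    rw [hψd, ← neg_one_smul ℝ (covWedge (fderiv ℝ ρ (x - t)) c), topWedge_smul_right,
      topWedge_covWedge h h'.symm]
    have h1 : ((-1 : ℝ) ^ j) * (-1) ^ j = 1 := by rw [← pow_add, ← two_mul, pow_mul]; simp
    rw [pow_succ]
    linear_combination (-topWedge h'.symm (covWedge (fderiv ℝ ρ (x - t)) (L.indicator b t)) c) * h1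
  have hint' : Integrable fun t => ρ (x - t) • L.indicator a t :=
    (φ.hasCompactSupport_normed.convolutionExists_left (μ := volume)
      (ContinuousLinearMap.lsmul ℝ ℝ : ℝ →L[ℝ] Alt l (j + 1) →L[ℝ] Alt l (j + 1))
      hρ1.continuous hai.locallyIntegrable x).integrable_swap
  have e2 : topWedge h'.symm (mollify φ (L.indicator a) x) c =
      ∫ y, topWedge h'.symm (L.indicator a y) (ψ y) := by
    rw [mollify, convolution_lsmul_swap, topWedge_integral h'.symm hint']
    congr 1 with t
    rw [topWedge_smul_right, topWedge_smul_left]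
  rw [← topWedgeL_apply, map_sub, sub_apply, topWedgeL_apply, topWedgeL_apply, e1, e2, hw',
    ← mul_assoc, ← pow_add, ← two_mul, pow_mul]
  simp

theorem norm_mollify_indicator_sub_le {F : Type*} [NormedAddCommGroup F] [NormedSpace ℝ F]
    [CompleteSpace F] {b : Coord l → F} {L : Set (Coord l)} (hL : IsCompact L)
    (hb : ContinuousOn b L) {ε δ : ℝ}
    (hδ : ∀ x ∈ L, ∀ y ∈ L, dist x y < δ → dist (b x) (b y) ≤ ε)
    (φ : ContDiffBump (0 : Coord l)) (hφ : φ.rOut ≤ δ) {x : Coord l}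
    (hx : Metric.closedBall x φ.rOut ⊆ L) : ‖mollify φ (L.indicator b) x - b x‖ ≤ ε := by
  have hxL : x ∈ L := hx (Metric.mem_closedBall_self φ.rOut_pos.le)
  have h1 : Integrable (L.indicator b) :=
    (hb.integrableOn_compact hL).integrable_indicator hL.measurableSet
  have := φ.dist_normed_convolution_le (μ := volume) (x₀ := x) (ε := ε) h1.aestronglyMeasurable ?_
  · rwa [dist_eq_norm, indicator_of_mem hxL] at this
  · intro y hy
    have hyL := hx (Metric.ball_subset_closedBall hy)
    rw [indicator_of_mem hyL, indicator_of_mem hxL]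
    exact hδ y hyL x hxL ((Metric.mem_ball.mp hy).trans_le hφ)

/-- `b` and `a` are uniform limits on `V` of smooth forms and their exterior derivatives. -/
def IsStrongExtDerivOn (b : Coord l → Alt l j) (a : Coord l → Alt l (j + 1))
    (V : Set (Coord l)) : Prop :=
  ∀ ε > 0, ∃ b' : Coord l → Alt l j, ContDiffOn ℝ ∞ b' V ∧
    ∀ y ∈ V, ‖b' y - b y‖ ≤ ε ∧ ‖extDeriv b' y - a y‖ ≤ ε

theorem IsStrongExtDerivOn.mono {b : Coord l → Alt l j} {a : Coord l → Alt l (j + 1)}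
    {V V' : Set (Coord l)} (h : IsStrongExtDerivOn b a V) (hV : V' ⊆ V) :
    IsStrongExtDerivOn b a V' := fun ε hε => by
  obtain ⟨b', h1, h2⟩ := h ε hε
  exact ⟨b', h1.mono hV, fun y hy => h2 y (hV hy)⟩

/-- **Friedrichs' theorem**: a weak exterior derivative is a strong one near compact sets. -/
theorem IsWeakExtDerivOn.exists_strong {b : Coord l → Alt l j} {a : Coord l → Alt l (j + 1)}
    {U L : Set (Coord l)} (hU : IsOpen U) (hw : IsWeakExtDerivOn b a U) (hb : ContinuousOn b U)
    (ha : ContinuousOn a U) (hL : IsCompact L) (hLU : L ⊆ U) :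
    ∃ V, IsOpen V ∧ L ⊆ V ∧ V ⊆ U ∧ IsStrongExtDerivOn b a V := by
  obtain ⟨δ, hδ, hδU⟩ := hL.exists_cthickening_subset_open hU hLU
  set L' := Metric.cthickening δ L
  have hL' : IsCompact L' := hL.cthickening
  have hV : ∀ x ∈ Metric.thickening (δ / 2) L, Metric.closedBall x (δ / 2) ⊆ L' := by
    intro x hx y hy
    obtain ⟨z, hz, hxz⟩ := Metric.mem_thickening_iff.mp hx
    refine Metric.mem_cthickening_of_dist_le y z δ L hz ?_
    have := dist_triangle y x z
    have := Metric.mem_closedBall.mp hy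
    linarith
  refine ⟨Metric.thickening (δ / 2) L, Metric.isOpen_thickening,
    Metric.self_subset_thickening (by positivity) L,
    (fun x hx => hδU (hV x hx (Metric.mem_closedBall_self (by positivity)))), fun ε hε => ?_⟩
  obtain ⟨δ₁, hδ₁, H₁⟩ := Metric.uniformContinuousOn_iff.mp
    (hL'.uniformContinuousOn_of_continuous (hb.mono hδU)) ε hε
  obtain ⟨δ₂, hδ₂, H₂⟩ := Metric.uniformContinuousOn_iff.mp
    (hL'.uniformContinuousOn_of_continuous (ha.mono hδU)) ε hε
  -- One radius keeps the mollification of points near `L` inside `L'` and respects the moduli of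
  -- continuity of both `b` and `a`.
  set r := min (δ / 2) (min δ₁ δ₂) with hr
  have hr0 : 0 < r := by positivity
  let φ : ContDiffBump (0 : Coord l) := ⟨r / 2, r, by positivity, by linarith⟩
  have hxr : ∀ x ∈ Metric.thickening (δ / 2) L, Metric.closedBall x φ.rOut ⊆ L' := fun x hx =>
    (Metric.closedBall_subset_closedBall (min_le_left _ _)).trans (hV x hx)
  have hbi : Integrable (L'.indicator b) :=
    ((hb.mono hδU).integrableOn_compact hL').integrable_indicator hL'.measurableSet
  refine ⟨mollify φ (L'.indicator b), (contDiff_mollify φ hbi.locallyIntegrable).contDiffOn,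
    fun y hy => ⟨?_, ?_⟩⟩
  · exact norm_mollify_indicator_sub_le hL' (hb.mono hδU)
      (fun x hx y hy h => (H₁ x hx y hy h).le) φ ((min_le_right _ _).trans (min_le_left _ _)) (hxr y hy)
  · rw [extDeriv_mollify_of_isWeakExtDerivOn hU hw hb ha hL' hδU φ (hxr y hy)]
    exact norm_mollify_indicator_sub_le hL' (ha.mono hδU)
      (fun x hx y hy h => (H₂ x hx y hy h).le) φ ((min_le_right _ _).trans (min_le_right _ _)) (hxr y hy)

/-- The weak exterior derivative of a smooth form is its exterior derivative. -/
theorem IsWeakExtDerivOn.eq_extDeriv {b : Coord l → Alt l j} {a : Coord l → Alt l (j + 1)}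
    {U : Set (Coord l)} (hU : IsOpen U) (hw : IsWeakExtDerivOn b a U) (hb : ContDiffOn ℝ ∞ b U)
    (ha : ContinuousOn a U) {x : Coord l} (hx : x ∈ U) : a x = extDeriv b x := by
  obtain ⟨δ, hδ, hδU⟩ := Metric.nhds_basis_closedBall.mem_iff.mp (hU.mem_nhds hx)
  set L' := Metric.closedBall x δ
  have hL' : IsCompact L' := isCompact_closedBall x δ
  have hd : ContinuousOn (extDeriv b) U := (contDiffOn_extDeriv hU hb).continuousOn
  rw [← sub_eq_zero, ← norm_le_zero_iff]
  refine le_of_forall_pos_le_add fun ε hε => ?_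
  obtain ⟨δ₁, hδ₁, H₁⟩ := Metric.uniformContinuousOn_iff.mp
    (hL'.uniformContinuousOn_of_continuous (hd.mono hδU)) (ε / 2) (by positivity)
  obtain ⟨δ₂, hδ₂, H₂⟩ := Metric.uniformContinuousOn_iff.mp
    (hL'.uniformContinuousOn_of_continuous (ha.mono hδU)) (ε / 2) (by positivity)
  set r := min δ (min δ₁ δ₂) with hr
  have hr0 : 0 < r := by positivity
  let φ : ContDiffBump (0 : Coord l) := ⟨r / 2, r, by positivity, by linarith⟩
  have hxr : Metric.closedBall x φ.rOut ⊆ L' := Metric.closedBall_subset_closedBall (min_le_left _ _)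
  -- By Stokes' theorem `extDeriv b` is a weak differential of `b` as well, so its mollification and
  -- that of `a` are both the differential of the mollified `b`. Each is ε/2-close at x to the form
  -- it mollifies.
  have e1 := extDeriv_mollify_of_isWeakExtDerivOn hU hw hb.continuousOn ha hL' hδU φ hxr
  have e2 := extDeriv_mollify_of_isWeakExtDerivOn hU (isWeakExtDerivOn_extDeriv hU hb)
    hb.continuousOn hd hL' hδU φ hxr
  have n1 := norm_mollify_indicator_sub_le hL' (hd.mono hδU)
      (fun x hx y hy h => (H₁ x hx y hy h).le) φ ((min_le_right _ _).trans (min_le_left _ _)) hxr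
  have n2 := norm_mollify_indicator_sub_le hL' (ha.mono hδU)
      (fun x hx y hy h => (H₂ x hx y hy h).le) φ ((min_le_right _ _).trans (min_le_right _ _)) hxr
  rw [← e2] at n1
  rw [← e1] at n2
  rw [zero_add]
  calc ‖a x - extDeriv b x‖ = ‖(extDeriv (mollify φ (L'.indicator b)) x - extDeriv b x) -
        (extDeriv (mollify φ (L'.indicator b)) x - a x)‖ := by congr 1; abel
    _ ≤ ε / 2 + ε / 2 := (norm_sub_le _ _).trans (add_le_add n1 n2)
    _ = ε := by ring

/-- Stokes' theorem is exact for the smooth approximants. Replacing them by `b` and `a` costs at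
most ε C, where C depends only on φ, and ε tends to 0. -/
theorem IsStrongExtDerivOn.integral_eq {b : Coord l → Alt l j} {a : Coord l → Alt l (j + 1)}
    {U V : Set (Coord l)} (hU : IsOpen U) (hV : IsOpen V) (hs : IsStrongExtDerivOn b a V)
    (hb : ContinuousOn b U) (ha : ContinuousOn a U) {k : ℕ} (h : j + (k + 1) = l)
    (h' : j + 1 + k = l) {φ : Coord l → Alt l k} (hφ : ContDiff ℝ 2 φ) (hc : HasCompactSupport φ)
    (hsV : tsupport φ ⊆ V) (hsU : tsupport φ ⊆ U) :
    ∫ y in U, topWedge h (b y) (extDeriv φ y) =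
        (-1) ^ (j + 1) * ∫ y in U, topWedge h' (a y) (φ y) := by
  have hdφ : Continuous (extDeriv φ) := continuous_extDeriv (hφ.of_le (by norm_num))
  have hdc := hasCompactSupport_extDeriv hc
  have hds := tsupport_extDeriv_subset φ
  set C : ℝ := (∫ y, ‖topWedgeL h‖ * ‖extDeriv φ y‖) + ∫ y, ‖topWedgeL h'‖ * ‖φ y‖
  have i1 : Integrable fun y => ‖topWedgeL h‖ * ‖extDeriv φ y‖ :=
    (hdφ.norm.integrable_of_hasCompactSupport hdc.norm).const_mul _
  have i2 : Integrable fun y => ‖topWedgeL h'‖ * ‖φ y‖ :=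
    (hφ.continuous.norm.integrable_of_hasCompactSupport hc.norm).const_mul _
  rw [← sub_eq_zero, ← norm_le_zero_iff]
  refine ge_of_tendsto (x := 𝓝[>] (0 : ℝ)) (f := fun ε => ε * C) ?_ ?_
  · have : Tendsto (fun ε : ℝ => ε * C) (𝓝 0) (𝓝 (0 * C)) := tendsto_id.mul_const C
    rw [zero_mul] at this
    exact this.mono_left nhdsWithin_le_nhds
  filter_upwards [self_mem_nhdsWithin] with ε hε
  obtain ⟨b', hb', H⟩ := hs ε hε
  have W := isWeakExtDerivOn_extDeriv (hV.inter hU) (hb'.mono inter_subset_left) k h h' φ hφ hc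
    (subset_inter hsV hsU)
  have hb'V : ContinuousOn b' (V ∩ U) := hb'.continuousOn.mono inter_subset_left
  have hdV : ContinuousOn (extDeriv b') (V ∩ U) :=
    (contDiffOn_extDeriv hV hb').continuousOn.mono inter_subset_left
  have z1 : ∀ {p q : ℕ} (h : p + q = l) (α : Coord l → Alt l p) (β : Coord l → Alt l q),
      tsupport β ⊆ tsupport φ →
      ∫ y in U, topWedge h (α y) (β y) = ∫ y in V ∩ U, topWedge h (α y) (β y) := by
    intro p q h α β hβ
    rw [setIntegral_eq_of_subset_of_forall_sdiff_eq_zero hU.measurableSet inter_subset_right]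
    intro y hy
    have : β y = 0 := by
      by_contra hn
      have := hβ (subset_tsupport _ hn)
      exact hy.2 ⟨hsV this, hsU this⟩
    rw [this, topWedge_zero_right]
  rw [z1 h b _ hds, z1 h' a φ subset_rfl]
  have d1 : (∫ y in V ∩ U, topWedge h (b y) (extDeriv φ y)) -
      ∫ y in V ∩ U, topWedge h (b' y) (extDeriv φ y) =
      ∫ y in V ∩ U, topWedge h (b y - b' y) (extDeriv φ y) := by
    rw [← integral_sub (integrableOn_topWedge h (hb.mono inter_subset_right) hdφ hdc
      (hds.trans (subset_inter hsV hsU))) (integrableOn_topWedge h hb'V hdφ hdc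
      (hds.trans (subset_inter hsV hsU)))]
    simp only [← topWedgeL_apply, map_sub, sub_apply]
  have d2 : (∫ y in V ∩ U, topWedge h' (a y) (φ y)) -
      ∫ y in V ∩ U, topWedge h' (extDeriv b' y) (φ y) =
      ∫ y in V ∩ U, topWedge h' (a y - extDeriv b' y) (φ y) := by
    rw [← integral_sub (integrableOn_topWedge h' (ha.mono inter_subset_right) hφ.continuous hc
      (subset_inter hsV hsU)) (integrableOn_topWedge h' hdV hφ.continuous hc
      (subset_inter hsV hsU))]
    simp only [← topWedgeL_apply, map_sub, sub_apply]
  have n0 : ∀ {p q : ℕ} (h : p + q = l) (u : Alt l p) (v : Alt l q), ‖u‖ ≤ ε →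
      ‖topWedge h u v‖ ≤ ε * (‖topWedgeL h‖ * ‖v‖) := fun h u v hu => by
    rw [← topWedgeL_apply]
    refine ((topWedgeL h).le_opNorm₂ u v).trans ?_
    rw [mul_assoc, mul_left_comm]
    exact mul_le_mul_of_nonneg_right hu (by positivity)
  have n1 : ‖∫ y in V ∩ U, topWedge h (b y - b' y) (extDeriv φ y)‖ ≤
      ε * ∫ y, ‖topWedgeL h‖ * ‖extDeriv φ y‖ := by
    rw [← integral_const_mul]
    refine (norm_integral_le_of_norm_le (i1.const_mul ε).integrableOn ?_).trans
      (setIntegral_le_integral (i1.const_mul ε) (Eventually.of_forall fun y => ?_))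
    · filter_upwards [ae_restrict_mem (hV.inter hU).measurableSet] with y hy
      exact n0 h _ _ (by rw [norm_sub_rev]; exact (H y hy.1).1)
    · have : 0 < ε := hε
      positivity
  have n2 : ‖∫ y in V ∩ U, topWedge h' (a y - extDeriv b' y) (φ y)‖ ≤
      ε * ∫ y, ‖topWedgeL h'‖ * ‖φ y‖ := by
    rw [← integral_const_mul]
    refine (norm_integral_le_of_norm_le (i2.const_mul ε).integrableOn ?_).trans
      (setIntegral_le_integral (i2.const_mul ε) (Eventually.of_forall fun y => ?_))
    · filter_upwards [ae_restrict_mem (hV.inter hU).measurableSet] with y hy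
      exact n0 h' _ _ (by rw [norm_sub_rev]; exact (H y hy.1).2)
    · have : 0 < ε := hε
      positivity
  have e0 : (∫ y in V ∩ U, topWedge h (b y) (extDeriv φ y)) -
      (-1) ^ (j + 1) * ∫ y in V ∩ U, topWedge h' (a y) (φ y) =
      (∫ y in V ∩ U, topWedge h (b y - b' y) (extDeriv φ y)) -
      (-1) ^ (j + 1) * ∫ y in V ∩ U, topWedge h' (a y - extDeriv b' y) (φ y) := by
    rw [← d1, ← d2, W]; ring
  rw [e0]
  refine (norm_sub_le _ _).trans ?_
  rw [norm_mul, norm_pow, norm_neg, norm_one, one_pow, one_mul, mul_add]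
  exact add_le_add n1 n2

/-- A local strong exterior derivative is a weak exterior derivative. -/
theorem isWeakExtDerivOn_of_strong {b : Coord l → Alt l j} {a : Coord l → Alt l (j + 1)}
    {U : Set (Coord l)} (hU : IsOpen U) (hb : ContinuousOn b U) (ha : ContinuousOn a U)
    (hs : ∀ y ∈ U, ∃ V, IsOpen V ∧ y ∈ V ∧ IsStrongExtDerivOn b a V) :
    IsWeakExtDerivOn b a U := by
  intro k h h' φ hφ hc hsU
  choose! V hVo hyV hVs using hs
  -- The partition of unity cuts φ into pieces, each supported in one of the sets where a strong
  -- differential exists. By compactness only finitely many pieces are nonzero.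
  obtain ⟨f, hf⟩ := SmoothPartitionOfUnity.exists_isSubordinate 𝓘(ℝ, Coord l)
    (isClosed_tsupport φ) (fun y : U => V y) (fun y => hVo y y.2)
    (fun y hy => mem_iUnion.mpr ⟨⟨y, hsU hy⟩, hyV y (hsU hy)⟩)
  have hfin : {i | (Function.support (f i) ∩ tsupport φ).Nonempty}.Finite :=
    f.locallyFinite.finite_nonempty_inter_compact hc
  set T := hfin.toFinset
  have hsm : ∀ i, ContDiff ℝ ∞ (f i) := fun i => (f i).contMDiff.contDiff
  set φi : U → Coord l → Alt l k := fun i y => f i y • φ y with hφi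
  have hφi1 : ∀ i, ContDiff ℝ 2 (φi i) := fun i =>
    ((hsm i).of_le (by norm_cast)).smul hφ
  have hsub : ∀ i, tsupport (φi i) ⊆ tsupport φ := fun i => tsupport_smul_subset_right _ _
  have hφic : ∀ i, HasCompactSupport (φi i) := fun i =>
    hc.of_isClosed_subset (isClosed_tsupport _) (hsub i)
  have hsum : φ = fun y => ∑ i ∈ T, φi i y := by
    funext y
    by_cases hy : y ∈ tsupport φ
    · have h1 : ∑ᶠ i, f i y = ∑ i ∈ T, f i y := by
        refine finsum_eq_sum_of_support_subset _ fun i hi => ?_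
        simp only [T, Finite.coe_toFinset, mem_ofPred_eq]
        exact ⟨y, hi, hy⟩
      simp only [hφi, ← Finset.sum_smul]
      rw [← h1, f.sum_eq_one hy, one_smul]
    · have : φ y = 0 := image_eq_zero_of_notMem_tsupport hy
      simp [hφi, this]
  have hdsum : ∀ y, extDeriv φ y = ∑ i ∈ T, extDeriv (φi i) y := by
    intro y
    conv_lhs => rw [hsum]
    rw [extDeriv_eq, fderiv_fun_sum fun i _ => ((hφi1 i).differentiable (by norm_num)) y, map_sum]
    rfl
  have hi := fun i : U => (hVs i i.2).integral_eq hU (hVo i i.2) hb ha h h' (hφi1 i) (hφic i)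
    ((tsupport_smul_subset_left _ _).trans (hf i)) ((hsub i).trans hsU)
  have e1 : ∀ y, topWedge h (b y) (extDeriv φ y) =
      ∑ i ∈ T, topWedge h (b y) (extDeriv (φi i) y) := fun y => by
    rw [hdsum, ← topWedgeL_apply, map_sum]; rfl
  have e2 : ∀ y, topWedge h' (a y) (φ y) = ∑ i ∈ T, topWedge h' (a y) (φi i y) := fun y => by
    rw [congrFun hsum y, ← topWedgeL_apply, map_sum]; rfl
  simp only [e1, e2]
  rw [integral_finsetSum, integral_finsetSum, Finset.mul_sum]
  · exact Finset.sum_congr rfl fun i _ => hi i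
  · intro i _
    exact integrableOn_topWedge h' ha (hφi1 i).continuous (hφic i) ((hsub i).trans hsU)
  · intro i _
    exact integrableOn_topWedge h hb (continuous_extDeriv ((hφi1 i).of_le (by norm_num)))
      (hasCompactSupport_extDeriv (hφic i))
      ((tsupport_extDeriv_subset _).trans ((hsub i).trans hsU))

end Mollify

end LInftyForms

end

noncomputable section

set_option maxSynthPendingDepth 3

namespace LInftyForms

open ContinuousAlternatingMap (alternatizeUncurryFin alternatizeUncurryFinCLM)
open Set Filter Topology

/-! ### Averages of translates -/

section Average

variable {l : ℕ} {F G : Type} [NormedAddCommGroup F] [NormedSpace ℝ F] [NormedAddCommGroup G]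
  [NormedSpace ℝ G]

/-- The uniform measure on the pairs of a vector of norm at most `r` and a time in `[0, 1]`. -/
def segMeasure (l : ℕ) (r : ℝ) : Measure (Coord l × ℝ) :=
  (volume.restrict (Metric.closedBall 0 r)).prod (volume.restrict (Icc 0 1))

instance (r : ℝ) : IsFiniteMeasure (segMeasure l r) := by
  have : IsFiniteMeasure ((volume : Measure (Coord l)).restrict (Metric.closedBall 0 r)) :=
    ⟨by simpa using measure_closedBall_lt_top⟩
  unfold segMeasure
  infer_instance

theorem ae_segMeasure (r : ℝ) :
    ∀ᵐ p ∂segMeasure l r, p ∈ Metric.closedBall (0 : Coord l) r ×ˢ Icc (0 : ℝ) 1 := by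
  unfold segMeasure
  rw [Measure.prod_restrict]
  exact ae_restrict_mem (Metric.isClosed_closedBall.measurableSet.prod measurableSet_Icc)

/-- The average of the translates `A p (f (x - t s))` over `p = (s, t)`. -/
def segAvg (r : ℝ) (A : Coord l × ℝ → F →L[ℝ] G) (f : Coord l → F) (x : Coord l) : G :=
  ∫ p, A p (f (x - p.2 • p.1)) ∂segMeasure l r

theorem sub_smul_mem_closedBall {r : ℝ} {x : Coord l} {p : Coord l × ℝ}
    (hp : p ∈ Metric.closedBall (0 : Coord l) r ×ˢ Icc (0 : ℝ) 1) :
    x - p.2 • p.1 ∈ Metric.closedBall x r := by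
  obtain ⟨h1, h2, h3⟩ := hp
  rw [mem_closedBall_zero_iff] at h1
  rw [Metric.mem_closedBall, dist_eq_norm, sub_sub_cancel_left, norm_neg, norm_smul,
    Real.norm_of_nonneg h2]
  nlinarith [norm_nonneg p.1]

theorem exists_norm_le_segMeasure {H : Type*} [NormedAddCommGroup H] (r : ℝ)
    {A : Coord l × ℝ → H} (hA : Continuous A) :
    ∃ M, 0 ≤ M ∧ ∀ᵐ p ∂segMeasure l r, ‖A p‖ ≤ M := by
  obtain ⟨M, hM⟩ := ((isCompact_closedBall (0 : Coord l) r).prod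
    (isCompact_Icc (a := (0 : ℝ)) (b := 1))).exists_bound_of_continuousOn hA.continuousOn
  refine ⟨max M 0, le_max_right _ _, ?_⟩
  filter_upwards [ae_segMeasure r] with p hp
  exact (hM p hp).trans (le_max_left _ _)

theorem integrable_segMeasure {H : Type*} [NormedAddCommGroup H] (r : ℝ)
    {A : Coord l × ℝ → H} (hA : Continuous A) :
    Integrable A (segMeasure l r) := by
  obtain ⟨M, _, hM⟩ := exists_norm_le_segMeasure r hA
  exact Integrable.of_bound hA.aestronglyMeasurable M hM

theorem continuous_segAvg_integrand {A : Coord l × ℝ → F →L[ℝ] G} (hA : Continuous A)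
    {f : Coord l → F} (hf : Continuous f) (x : Coord l) :
    Continuous fun p : Coord l × ℝ => A p (f (x - p.2 • p.1)) :=
  hA.clm_apply (hf.comp (continuous_const.sub (continuous_snd.smul continuous_fst)))

theorem continuous_segAvg (r : ℝ) {A : Coord l × ℝ → F →L[ℝ] G} (hA : Continuous A)
    {f : Coord l → F} (hf : Continuous f) : Continuous (segAvg r A f) := by
  rw [continuous_iff_continuousAt]
  intro x₀
  obtain ⟨M, hM0, hM⟩ := exists_norm_le_segMeasure r hA
  obtain ⟨C, hC⟩ := (isCompact_closedBall x₀ (1 + r)).exists_bound_of_continuousOn hf.continuousOn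
  refine continuousAt_of_dominated (bound := fun _ => M * C)
    (Eventually.of_forall fun x => (continuous_segAvg_integrand hA hf x).aestronglyMeasurable)
    ?_ (integrable_const _) (Eventually.of_forall fun p => ?_)
  · filter_upwards [Metric.ball_mem_nhds x₀ one_pos] with x hx
    filter_upwards [hM, ae_segMeasure r] with p hp hp'
    refine ((A p).le_opNorm _).trans (mul_le_mul hp (hC _ ?_) (norm_nonneg _) hM0)
    have h1 := Metric.mem_closedBall.mp (sub_smul_mem_closedBall (x := x) hp')
    have h2 := Metric.mem_ball.mp hx
    have := dist_triangle (x - p.2 • p.1) x x₀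
    rw [Metric.mem_closedBall]; linarith
  · exact ((A p).continuous.comp (hf.comp (continuous_id.sub continuous_const))).continuousAt

theorem hasFDerivAt_segAvg (r : ℝ) {A : Coord l × ℝ → F →L[ℝ] G} (hA : Continuous A)
    {f : Coord l → F} (hf : ContDiff ℝ 1 f) (x₀ : Coord l) :
    HasFDerivAt (segAvg r A f)
      (segAvg r (fun p => ContinuousLinearMap.compL ℝ (Coord l) F G (A p)) (fderiv ℝ f) x₀) x₀ := by
  have hA' : Continuous fun p => ContinuousLinearMap.compL ℝ (Coord l) F G (A p) :=
    (ContinuousLinearMap.compL ℝ (Coord l) F G).continuous.comp hA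
  have hf' : Continuous (fderiv ℝ f) := hf.continuous_fderiv one_ne_zero
  obtain ⟨M, hM0, hM⟩ := exists_norm_le_segMeasure r hA
  obtain ⟨C, hC⟩ := (isCompact_closedBall x₀ (1 + r)).exists_bound_of_continuousOn hf'.continuousOn
  refine hasFDerivAt_integral_of_dominated_of_fderiv_le (bound := fun _ => M * C)
    (F' := fun x p => ContinuousLinearMap.compL ℝ (Coord l) F G (A p) (fderiv ℝ f (x - p.2 • p.1)))
    (Metric.ball_mem_nhds x₀ one_pos)
    (Eventually.of_forall fun x =>
      (continuous_segAvg_integrand hA hf.continuous x).aestronglyMeasurable)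
    (integrable_segMeasure r (continuous_segAvg_integrand hA hf.continuous x₀))
    (continuous_segAvg_integrand hA' hf' x₀).aestronglyMeasurable ?_ (integrable_const _)
    (Eventually.of_forall fun p x _ => ?_)
  · filter_upwards [hM, ae_segMeasure r] with p hp hp' x hx
    refine (ContinuousLinearMap.opNorm_comp_le _ _).trans
      (mul_le_mul hp (hC _ ?_) (norm_nonneg _) hM0)
    have h1 := Metric.mem_closedBall.mp (sub_smul_mem_closedBall (x := x) hp')
    have h2 := Metric.mem_ball.mp hx
    have := dist_triangle (x - p.2 • p.1) x x₀
    rw [Metric.mem_closedBall]; linarith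
  · have h1 := ((hf.differentiable one_ne_zero) (x - p.2 • p.1)).hasFDerivAt.comp x
      ((hasFDerivAt_id x).sub_const (p.2 • p.1))
    exact (A p).hasFDerivAt.comp x h1

/-- The derivative of an average is the average of the derivative, with kernel "compose with `A p`"
and with values in a space of linear maps. The spaces `F` and `G` therefore have to vary in the
induction. -/
theorem contDiff_segAvg_nat (n : ℕ) : ∀ {F G : Type} [NormedAddCommGroup F] [NormedSpace ℝ F]
    [NormedAddCommGroup G] [NormedSpace ℝ G] (r : ℝ) {A : Coord l × ℝ → F →L[ℝ] G}
    (_ : Continuous A) {f : Coord l → F} (_ : ContDiff ℝ n f), ContDiff ℝ n (segAvg r A f) := by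
  induction n with
  | zero =>
    intro F G _ _ _ _ r A hA f hf
    exact contDiff_zero.mpr (continuous_segAvg r hA hf.continuous)
  | succ n ih =>
    intro F G _ _ _ _ r A hA f hf
    have hd := hasFDerivAt_segAvg r hA (hf.of_le (by norm_cast; omega))
    rw [Nat.cast_add, Nat.cast_one, contDiff_succ_iff_fderiv] at hf ⊢
    refine ⟨fun x => (hd x).differentiableAt, by simp, ?_⟩
    have : fderiv ℝ (segAvg r A f) =
        segAvg r (fun p => ContinuousLinearMap.compL ℝ (Coord l) F G (A p)) (fderiv ℝ f) :=
      funext fun x => (hd x).fderiv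
    rw [this]
    exact ih r ((ContinuousLinearMap.compL ℝ (Coord l) F G).continuous.comp hA) hf.2.2

theorem contDiff_segAvg (r : ℝ) {A : Coord l × ℝ → F →L[ℝ] G} (hA : Continuous A)
    {f : Coord l → F} (hf : ContDiff ℝ ∞ f) : ContDiff ℝ ∞ (segAvg r A f) :=
  contDiff_infty.mpr fun n => contDiff_segAvg_nat n r hA (contDiff_infty.mp hf n)

theorem contDiff_smul_of_tsupport_subset {χ : Coord l → ℝ} (hχ : ContDiff ℝ ∞ χ) {f : Coord l → F}
    {V : Set (Coord l)} (hV : IsOpen V) (hf : ContDiffOn ℝ ∞ f V) (hs : tsupport χ ⊆ V) :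
    ContDiff ℝ ∞ fun y => χ y • f y :=
  contDiff_iff_contDiffAt.mpr fun y => by
    by_cases hy : y ∈ tsupport χ
    · exact hχ.contDiffAt.smul (hf.contDiffAt (hV.mem_nhds (hs hy)))
    · refine (contDiffAt_const (c := (0 : F))).congr_of_eventuallyEq ?_
      filter_upwards [notMem_tsupport_iff_eventuallyEq.mp hy] with z hz
      simp [hz]

/-- Averaging over translates of length at most r preserves smoothness locally: near x it sees `f`
only near the closed ball of radius r, so `f` can be replaced by its product with a bump function.
-/
theorem contDiffAt_segAvg {r : ℝ} {A : Coord l × ℝ → F →L[ℝ] G} (hA : Continuous A)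
    {f : Coord l → F} {V : Set (Coord l)} (hV : IsOpen V) (hf : ContDiffOn ℝ ∞ f V) {x : Coord l}
    (hr : 0 < r) (hx : Metric.closedBall x r ⊆ V) : ContDiffAt ℝ ∞ (segAvg r A f) x := by
  obtain ⟨δ, hδ, hδV⟩ := (isCompact_closedBall x r).exists_cthickening_subset_open hV hx
  rw [cthickening_closedBall hδ.le hr.le, add_comm] at hδV
  -- Translates of points of the ball of radius δ/2 around x stay within r + δ/2, where χ = 1.
  let χ : ContDiffBump x := ⟨r + δ / 2, r + δ, by positivity, by linarith⟩
  have hχ : ContDiff ℝ ∞ fun y => χ y • f y :=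
    contDiff_smul_of_tsupport_subset χ.contDiff hV hf (by
      rw [χ.tsupport_eq]; exact hδV)
  refine (contDiff_segAvg r hA hχ).contDiffAt.congr_of_eventuallyEq ?_
  filter_upwards [Metric.ball_mem_nhds x (by positivity : 0 < δ / 2)] with y hy
  refine integral_congr_ae ?_
  filter_upwards [ae_segMeasure r] with p hp
  have : χ (y - p.2 • p.1) = 1 := χ.one_of_mem_closedBall (by
    have h1 := Metric.mem_closedBall.mp (sub_smul_mem_closedBall (x := y) hp)
    have h2 := Metric.mem_ball.mp hy
    have := dist_triangle (y - p.2 • p.1) y x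
    rw [Metric.mem_closedBall]
    change _ ≤ r + δ / 2
    linarith)
  simp only [this, one_smul]

end Average

/-! ### The homotopy operator -/

section Homotopy

variable {l j : ℕ}

/-- The homotopy operator between the identity and the mollification by `φ`, along segments. -/
def homotopyOp (φ : ContDiffBump (0 : Coord l)) (b : Coord l → Alt l (j + 1)) :
    Coord l → Alt l j :=
  segAvg φ.rOut (fun p => φ.normed volume p.1 • contr p.1) b

theorem continuous_homotopy_kernel (φ : ContDiffBump (0 : Coord l)) :
    Continuous fun p : Coord l × ℝ =>
      (φ.normed volume p.1 • contr p.1 : Alt l (j + 1) →L[ℝ] Alt l j) :=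
  (φ.continuous_normed.comp continuous_fst).smul (contr.continuous.comp continuous_fst)

theorem integral_segMeasure_normed (φ : ContDiffBump (0 : Coord l)) :
    ∫ p, φ.normed volume p.1 ∂segMeasure l φ.rOut = 1 := by
  rw [segMeasure, integral_fun_fst (fun s => φ.normed volume s),
    setIntegral_eq_integral_of_forall_compl_eq_zero, φ.integral_normed]
  · simp
  · intro s hs
    by_contra h
    have : s ∈ Function.support (φ.normed volume) := h
    rw [φ.support_normed_eq] at this
    exact hs (Metric.ball_subset_closedBall this)

/-- Contraction with a vector of length at most r contributes the factor r; this is why the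
corrections become small with the radius. -/
theorem norm_homotopyOp_le (φ : ContDiffBump (0 : Coord l)) {b : Coord l → Alt l (j + 1)} {B : ℝ}
    (hB : ∀ y, ‖b y‖ ≤ B) (x : Coord l) :
    ‖homotopyOp φ b x‖ ≤ ‖(contr : Coord l →L[ℝ] Alt l (j + 1) →L[ℝ] Alt l j)‖ * φ.rOut * B := by
  set c := ‖(contr : Coord l →L[ℝ] Alt l (j + 1) →L[ℝ] Alt l j)‖
  have h1 : Integrable (fun p : Coord l × ℝ => φ.normed volume p.1) (segMeasure l φ.rOut) :=
    integrable_segMeasure _ (φ.continuous_normed.comp continuous_fst)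
  refine (norm_integral_le_of_norm_le (h1.mul_const (c * φ.rOut * B)) ?_).trans_eq ?_
  · filter_upwards [ae_segMeasure φ.rOut] with p hp
    have hp1 : ‖p.1‖ ≤ φ.rOut := mem_closedBall_zero_iff.mp hp.1
    rw [smul_apply, norm_smul, Real.norm_of_nonneg (φ.nonneg_normed _)]
    refine mul_le_mul_of_nonneg_left ?_ (φ.nonneg_normed _)
    refine ((contr : Coord l →L[ℝ] Alt l (j + 1) →L[ℝ] Alt l j).le_opNorm₂ _ _).trans ?_
    have := norm_nonneg (b (x - p.2 • p.1))
    exact mul_le_mul (mul_le_mul_of_nonneg_left hp1 (norm_nonneg _)) (hB _) this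
      (mul_nonneg (norm_nonneg _) φ.rOut_pos.le)
  · rw [integral_mul_const, integral_segMeasure_normed, one_mul]

theorem homotopyOp_sub (φ : ContDiffBump (0 : Coord l)) {b b' : Coord l → Alt l (j + 1)}
    (hb : Continuous b) (hb' : Continuous b') :
    homotopyOp φ (fun y => b y - b' y) = fun x => homotopyOp φ b x - homotopyOp φ b' x := by
  funext x
  simp only [homotopyOp, segAvg, map_sub]
  exact integral_sub
    (integrable_segMeasure _ (continuous_segAvg_integrand (continuous_homotopy_kernel φ) hb x))
    (integrable_segMeasure _ (continuous_segAvg_integrand (continuous_homotopy_kernel φ) hb' x))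

theorem integrable_mollify_integrand {F : Type*} [NormedAddCommGroup F] [NormedSpace ℝ F]
    (φ : ContDiffBump (0 : Coord l)) {b : Coord l → F} (hb : Continuous b) (x : Coord l) :
    Integrable fun s => φ.normed volume s • b (x - s) :=
  (φ.continuous_normed.smul (hb.comp (continuous_const.sub continuous_id))).integrable_of_hasCompactSupport
    φ.hasCompactSupport_normed.smul_right

theorem mollify_sub {F : Type*} [NormedAddCommGroup F] [NormedSpace ℝ F]
    (φ : ContDiffBump (0 : Coord l)) {b b' : Coord l → F} (hb : Continuous b)
    (hb' : Continuous b') :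
    mollify φ (fun y => b y - b' y) = fun x => mollify φ b x - mollify φ b' x := by
  funext x
  simp only [mollify, convolution_lsmul, smul_sub]
  exact integral_sub (integrable_mollify_integrand φ hb x) (integrable_mollify_integrand φ hb' x)

theorem norm_mollify_le {F : Type*} [NormedAddCommGroup F] [NormedSpace ℝ F]
    (φ : ContDiffBump (0 : Coord l)) {b : Coord l → F} {B : ℝ}
    (hB : ∀ y, ‖b y‖ ≤ B) (x : Coord l) : ‖mollify φ b x‖ ≤ B := by
  rw [mollify, convolution_lsmul]
  refine (norm_integral_le_of_norm_le (φ.integrable_normed.mul_const B)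
    (Eventually.of_forall fun s => ?_)).trans_eq ?_
  · rw [norm_smul, Real.norm_of_nonneg (φ.nonneg_normed _)]
    exact mul_le_mul_of_nonneg_left (hB _) (φ.nonneg_normed _)
  · rw [integral_mul_const, φ.integral_normed, one_mul]

/-- The fundamental theorem of calculus along the segment from x to x - s, averaged over s. -/
theorem integral_segMeasure_fderiv (φ : ContDiffBump (0 : Coord l)) {b : Coord l → Alt l j}
    (hb : ContDiff ℝ 1 b) (x : Coord l) :
    ∫ p, φ.normed volume p.1 • fderiv ℝ b (x - p.2 • p.1) p.1 ∂segMeasure l φ.rOut =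
      b x - mollify φ b x := by
  have hb' : Continuous (fderiv ℝ b) := hb.continuous_fderiv one_ne_zero
  have hc : Continuous fun p : Coord l × ℝ =>
      φ.normed volume p.1 • fderiv ℝ b (x - p.2 • p.1) p.1 :=
    (φ.continuous_normed.comp continuous_fst).smul
      ((hb'.comp (continuous_const.sub (continuous_snd.smul continuous_fst))).clm_apply
        continuous_fst)
  have hi := integrable_segMeasure φ.rOut hc
  rw [segMeasure] at hi ⊢
  rw [integral_prod _ hi]
  have h1 : ∀ s : Coord l, ∫ t in Icc (0 : ℝ) 1, φ.normed volume s • fderiv ℝ b (x - t • s) s =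
      φ.normed volume s • (b x - b (x - s)) := by
    intro s
    rw [integral_smul]
    congr 1
    have hd : ∀ t ∈ uIcc (0 : ℝ) 1, HasDerivAt (fun t : ℝ => -b (x - t • s))
        (fderiv ℝ b (x - t • s) s) t := by
      intro t _
      have h2 : HasDerivAt (fun t : ℝ => x - t • s) (-s) t := by
        simpa using ((hasDerivAt_id t).smul_const s).const_sub x
      have h3 := ((hb.differentiable one_ne_zero) (x - t • s)).hasFDerivAt.comp_hasDerivAt t h2
      rw [map_neg] at h3
      exact h3.neg.congr_deriv (neg_neg _)
    have hc' : Continuous fun t : ℝ => fderiv ℝ b (x - t • s) s :=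
      (hb'.comp (continuous_const.sub (continuous_id.smul continuous_const))).clm_apply
        continuous_const
    have h4 := intervalIntegral.integral_eq_sub_of_hasDerivAt hd (hc'.intervalIntegrable _ _)
    rw [intervalIntegral.integral_of_le zero_le_one, ← integral_Icc_eq_integral_Ioc] at h4
    rw [h4]
    simp [add_comm, sub_eq_add_neg]
  simp only [h1]
  rw [setIntegral_eq_integral_of_forall_compl_eq_zero]
  · simp only [smul_sub]
    rw [integral_sub (φ.integrable_normed.smul_const _) (integrable_mollify_integrand φ hb.continuous x),
      integral_smul_const, φ.integral_normed, one_smul, mollify, convolution_lsmul]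
  · intro s hs
    have : φ.normed volume s = 0 := by
      by_contra h
      have : s ∈ Function.support (φ.normed volume) := h
      rw [φ.support_normed_eq] at this
      exact hs (Metric.ball_subset_closedBall this)
    rw [this, zero_smul]

/-- The homotopy formula dH + Hd = id - ρ∗: Cartan's formula under the integral turns the left side
into the average of ∂_s b along the segments. -/
theorem extDeriv_homotopyOp_add (φ : ContDiffBump (0 : Coord l)) {b : Coord l → Alt l (j + 1)}
    (hb : ContDiff ℝ 1 b) (x : Coord l) :
    extDeriv (homotopyOp φ b) x + homotopyOp φ (extDeriv b) x = b x - mollify φ b x := by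
  rw [← integral_segMeasure_fderiv φ hb x, extDeriv_eq,
    show fderiv ℝ (homotopyOp φ b) x = _ from
      (hasFDerivAt_segAvg φ.rOut (continuous_homotopy_kernel φ) hb x).fderiv]
  have hb' : Continuous (fderiv ℝ b) := hb.continuous_fderiv one_ne_zero
  have i1 := integrable_segMeasure φ.rOut (continuous_segAvg_integrand
    ((ContinuousLinearMap.compL ℝ (Coord l) (Alt l (j + 1)) (Alt l j)).continuous.comp
      (continuous_homotopy_kernel φ)) hb' x)
  rw [segAvg]
  refine (congrArg₂ (· + ·) (ContinuousLinearMap.integral_comp_comm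
    (alternatizeUncurryFinCLM ℝ (Coord l) ℝ) i1).symm rfl).trans ?_
  refine (integral_add ((alternatizeUncurryFinCLM ℝ (Coord l) ℝ).integrable_comp i1)
    (integrable_segMeasure _ (continuous_segAvg_integrand (continuous_homotopy_kernel φ)
      (continuous_extDeriv hb) x))).symm.trans ?_
  congr 1 with p : 1
  have e1 : (alternatizeUncurryFinCLM ℝ (Coord l) ℝ)
      ((ContinuousLinearMap.compL ℝ (Coord l) (Alt l (j + 1)) (Alt l j))
        (φ.normed volume p.1 • contr p.1) (fderiv ℝ b (x - p.2 • p.1))) =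
      φ.normed volume p.1 • alternatizeUncurryFin
        ((contr p.1).comp (fderiv ℝ b (x - p.2 • p.1))) := by
    exact (alternatizeUncurryFinCLM ℝ (Coord l) ℝ).map_smul (φ.normed volume p.1)
      ((contr p.1).comp (fderiv ℝ b (x - p.2 • p.1)))
  refine (congrArg₂ (· + ·) e1 rfl).trans ?_
  rw [← contr_alternatize_add p.1 (fderiv ℝ b (x - p.2 • p.1)), smul_add]
  rfl

theorem homotopyOp_extDeriv_zero (φ : ContDiffBump (0 : Coord l)) {b : Coord l → Alt l 0}
    (hb : ContDiff ℝ 1 b) (x : Coord l) :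
    homotopyOp φ (extDeriv b) x = b x - mollify φ b x := by
  rw [← integral_segMeasure_fderiv φ hb x]
  refine integral_congr_ae (Eventually.of_forall fun p => ?_)
  simp only [← contr_alternatize_zero p.1 (fderiv ℝ b (x - p.2 • p.1))]
  rfl

/-! ### Operations on strong exterior derivatives -/

/-- The differentials of the approximants converge to `a` and are closed. -/
theorem IsStrongExtDerivOn.extDeriv_eq_zero {b : Coord l → Alt l j} {a : Coord l → Alt l (j + 1)}
    {V : Set (Coord l)} (hV : IsOpen V) (h : IsStrongExtDerivOn b a V) :
    IsStrongExtDerivOn a (0 : Coord l → Alt l (j + 2)) V := fun ε hε => by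
  obtain ⟨b', h1, h2⟩ := h ε hε
  refine ⟨extDeriv b', contDiffOn_extDeriv hV h1, fun y hy => ⟨(h2 y hy).2, ?_⟩⟩
  rw [extDeriv_extDeriv_apply (h1.contDiffAt (hV.mem_nhds hy))
    (by rw [minSmoothness_of_isRCLikeNormedField]; norm_cast)]
  simpa using hε.le

/-- The Leibniz rule for the approximants passes to the limit. Off the support of χ everything
vanishes, so the conclusion holds on the whole space. -/
theorem IsStrongExtDerivOn.smul_cutoff {b : Coord l → Alt l j} {a : Coord l → Alt l (j + 1)}
    {V : Set (Coord l)} (hV : IsOpen V) (h : IsStrongExtDerivOn b a V) {χ : Coord l → ℝ}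
    (hχ : ContDiff ℝ ∞ χ) (hc : HasCompactSupport χ) (hs : tsupport χ ⊆ V) :
    IsStrongExtDerivOn (fun y => χ y • b y)
      (fun y => covWedge (fderiv ℝ χ y) (b y) + χ y • a y) univ := by
  intro ε hε
  obtain ⟨M, hM⟩ := hχ.continuous.bounded_above_of_compact_support hc
  obtain ⟨M', hM'⟩ := (hχ.continuous_fderiv (by simp)).bounded_above_of_compact_support
    (hc.fderiv (𝕜 := ℝ))
  have hM0 : 0 ≤ M := (norm_nonneg _).trans (hM 0)
  have hM0' : 0 ≤ M' := (norm_nonneg _).trans (hM' 0)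
  set c := ‖(covWedge : (Coord l →L[ℝ] ℝ) →L[ℝ] Alt l j →L[ℝ] Alt l (j + 1))‖
  have hc0 : 0 ≤ c := norm_nonneg _
  -- An error ε/D in `b` and `a` is multiplied by at most c M' through dχ ∧ · and by at most M
  -- through χ; the 1 only keeps D positive.
  set D := c * M' + M + 1
  have hD : 0 < D := by positivity
  obtain ⟨b', h1, h2⟩ := h (ε / D) (by positivity)
  have hε' : 0 ≤ ε / D := by positivity
  have hDε : D * (ε / D) = ε := mul_div_cancel₀ ε hD.ne'
  refine ⟨fun y => χ y • b' y, (contDiff_smul_of_tsupport_subset hχ hV h1 hs).contDiffOn,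
    fun y _ => ?_⟩
  by_cases hy : y ∈ tsupport χ
  · obtain ⟨h3, h4⟩ := h2 y (hs hy)
    have hM1 : ‖χ y • (b' y - b y)‖ ≤ M * (ε / D) := by
      rw [norm_smul]; exact mul_le_mul (hM y) h3 (norm_nonneg _) hM0
    constructor
    · rw [← smul_sub]
      have : D * (ε / D) = c * M' * (ε / D) + M * (ε / D) + ε / D := by ring
      have := mul_nonneg (mul_nonneg hc0 hM0') hε'
      exact hM1.trans (by linarith)
    · rw [extDeriv_mul ((hχ.differentiable (by simp)) y)
        ((h1.contDiffAt (hV.mem_nhds (hs hy))).differentiableAt (by simp))]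
      have e1 : covWedge (fderiv ℝ χ y) (b' y) + χ y • extDeriv b' y -
          (covWedge (fderiv ℝ χ y) (b y) + χ y • a y) =
          covWedge (fderiv ℝ χ y) (b' y - b y) + χ y • (extDeriv b' y - a y) := by
        rw [map_sub, smul_sub]; abel
      rw [e1]
      refine (norm_add_le _ _).trans ?_
      have h5 : ‖covWedge (fderiv ℝ χ y) (b' y - b y)‖ ≤ c * M' * (ε / D) :=
        ((covWedge : (Coord l →L[ℝ] ℝ) →L[ℝ] Alt l j →L[ℝ] Alt l (j + 1)).le_opNorm₂ _ _).trans
          (mul_le_mul (mul_le_mul_of_nonneg_left (hM' y) hc0) h3 (norm_nonneg _)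
            (mul_nonneg hc0 hM0'))
      have h6 : ‖χ y • (extDeriv b' y - a y)‖ ≤ M * (ε / D) := by
        rw [norm_smul]; exact mul_le_mul (hM y) h4 (norm_nonneg _) hM0
      have : D * (ε / D) = c * M' * (ε / D) + M * (ε / D) + ε / D := by ring
      linarith
  · have e1 : χ y = 0 := image_eq_zero_of_notMem_tsupport hy
    have e2 : fderiv ℝ χ y = 0 := by
      by_contra h0
      exact hy (tsupport_fderiv_subset ℝ (subset_tsupport _ h0))
    have e3 : extDeriv (fun y => χ y • b' y) y = 0 :=
      extDeriv_eq_zero_of_notMem_tsupport fun h0 => hy (tsupport_smul_subset_left _ _ h0)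
    simp only [e3, e1, e2]
    simpa using hε.le

/-- H and mollification are bounded in the sup norm, so the homotopy formula survives uniform
limits: Hb has the strong differential b - ρ∗b - Ha. -/
theorem IsStrongExtDerivOn.homotopyOp {b : Coord l → Alt l (j + 1)} {a : Coord l → Alt l (j + 2)}
    (h : IsStrongExtDerivOn b a univ) (hb : Continuous b) (ha : Continuous a)
    (φ : ContDiffBump (0 : Coord l)) :
    IsStrongExtDerivOn (homotopyOp φ b) (fun y => b y - mollify φ b y - homotopyOp φ a y)
      univ := by
  intro ε hε
  set c := ‖(contr : Coord l →L[ℝ] Alt l (j + 1) →L[ℝ] Alt l j)‖ * φ.rOut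
  set c' := ‖(contr : Coord l →L[ℝ] Alt l (j + 2) →L[ℝ] Alt l (j + 1))‖ * φ.rOut
  have hr := φ.rOut_pos
  set D := c + c' + 2
  have hD : 0 < D := by positivity
  obtain ⟨b', h1, h2⟩ := h (ε / D) (by positivity)
  have hDε : D * (ε / D) = ε := mul_div_cancel₀ ε hD.ne'
  have hs : ContDiff ℝ ∞ b' := contDiffOn_univ.mp h1
  have hd := continuous_extDeriv (hs.of_le (by norm_cast : (1 : WithTop ℕ∞) ≤ ∞))
  have n1 := fun y => norm_homotopyOp_le φ (fun y => (h2 y (mem_univ _)).1) y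
  have n2 := fun y => norm_homotopyOp_le φ (fun y => (h2 y (mem_univ _)).2) y
  have n3 := fun y => norm_mollify_le φ (fun y => (h2 y (mem_univ _)).1) y
  rw [homotopyOp_sub φ hs.continuous hb] at n1
  rw [homotopyOp_sub φ hd ha] at n2
  rw [mollify_sub φ hs.continuous hb] at n3
  have hε' : 0 ≤ ε / D := by positivity
  have hc : 0 ≤ c := by positivity
  have hc' : 0 ≤ c' := by positivity
  have hDε' : D * (ε / D) = c * (ε / D) + c' * (ε / D) + 2 * (ε / D) := by ring
  refine ⟨LInftyForms.homotopyOp φ b',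
    (contDiff_segAvg _ (continuous_homotopy_kernel φ) hs).contDiffOn, fun y _ => ⟨?_, ?_⟩⟩
  · refine (n1 y).trans ?_
    linarith [mul_nonneg hc' hε']
  · have e1 := extDeriv_homotopyOp_add φ (hs.of_le (by norm_cast : (1 : WithTop ℕ∞) ≤ ∞)) y
    rw [← eq_sub_iff_add_eq] at e1
    rw [e1]
    have e2 : b' y - mollify φ b' y - LInftyForms.homotopyOp φ (extDeriv b') y -
        (b y - mollify φ b y - LInftyForms.homotopyOp φ a y) = (b' y - b y) -
        (mollify φ b' y - mollify φ b y) -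
        (LInftyForms.homotopyOp φ (extDeriv b') y - LInftyForms.homotopyOp φ a y) := by abel
    rw [e2]
    refine (norm_sub_le _ _).trans ((add_le_add (norm_sub_le _ _) le_rfl).trans ?_)
    have := (h2 y (mem_univ _)).1
    have := n2 y
    have := n3 y
    linarith [mul_nonneg hc hε']

/-- In degree 0 the homotopy formula has no dH term, so it expresses a function through its
mollification and its differential alone. -/
theorem IsStrongExtDerivOn.homotopyOp_zero {b : Coord l → Alt l 0} {a : Coord l → Alt l 1}
    (h : IsStrongExtDerivOn b a univ) (hb : Continuous b) (ha : Continuous a)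
    (φ : ContDiffBump (0 : Coord l)) (y : Coord l) :
    LInftyForms.homotopyOp φ a y = b y - mollify φ b y := by
  rw [← sub_eq_zero, ← norm_le_zero_iff]
  refine le_of_forall_pos_le_add fun ε hε => ?_
  set c := ‖(contr : Coord l →L[ℝ] Alt l 1 →L[ℝ] Alt l 0)‖ * φ.rOut
  have hr := φ.rOut_pos
  have hc : 0 ≤ c := by positivity
  set D := c + 2
  have hD : 0 < D := by positivity
  obtain ⟨b', h1, h2⟩ := h (ε / D) (by positivity)
  have hDε : D * (ε / D) = ε := mul_div_cancel₀ ε hD.ne'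
  have hs : ContDiff ℝ ∞ b' := contDiffOn_univ.mp h1
  have hd := continuous_extDeriv (hs.of_le (by norm_cast : (1 : WithTop ℕ∞) ≤ ∞))
  have n1 := (h2 y (mem_univ _)).1
  have n2 := norm_homotopyOp_le φ (fun y => (h2 y (mem_univ _)).2) y
  have n3 := norm_mollify_le φ (fun y => (h2 y (mem_univ _)).1) y
  rw [homotopyOp_sub φ hd ha] at n2
  rw [mollify_sub φ hs.continuous hb] at n3
  have e1 := homotopyOp_extDeriv_zero φ (hs.of_le (by norm_cast : (1 : WithTop ℕ∞) ≤ ∞)) y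
  simp only [e1] at n2
  have e2 : LInftyForms.homotopyOp φ a y - (b y - mollify φ b y) = (b' y - b y) -
      (mollify φ b' y - mollify φ b y) -
      (b' y - mollify φ b' y - LInftyForms.homotopyOp φ a y) := by abel
  rw [e2]
  refine (norm_sub_le _ _).trans ((add_le_add (norm_sub_le _ _) le_rfl).trans ?_)
  have hDε' : D * (ε / D) = c * (ε / D) + 2 * (ε / D) := by ring
  linarith

end Homotopy

end LInftyForms

end

noncomputable section

set_option maxSynthPendingDepth 3

namespace LInftyForms

open Set Filter Topology

/-! ### Local smoothing -/

section LocalSmoothing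

variable {l j : ℕ}

theorem exists_cutoff {C U : Set (Coord l)} (hC : IsCompact C) (hU : IsOpen U) (hCU : C ⊆ U) :
    ∃ χ : Coord l → ℝ, ContDiff ℝ ∞ χ ∧ HasCompactSupport χ ∧ tsupport χ ⊆ U ∧
      ∀ x ∈ C, ∀ᶠ y in 𝓝 x, χ y = 1 := by
  obtain ⟨K', hK', h1, h2⟩ := exists_compact_between hC hU hCU
  obtain ⟨f, hf1, hf2, -⟩ := exists_contMDiffMap_one_nhds_of_subset_interior (n := ⊤)
    𝓘(ℝ, Coord l) hC.isClosed h1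
  have hs : tsupport f ⊆ K' := closure_minimal (fun x hx => by
    by_contra h; exact hx (hf2 x h)) hK'.isClosed
  exact ⟨f, f.contMDiff.contDiff, hK'.of_isClosed_subset (isClosed_tsupport _) hs, hs.trans h2,
    fun x hx => (mem_nhdsSet_iff_forall.mp hf1) x hx⟩

theorem continuous_of_continuousOn_of_eq_zero {X F : Type*} [TopologicalSpace X]
    [TopologicalSpace F] [Zero F] {f : X → F} {U S : Set X} (hU : IsOpen U) (hS : IsClosed S)
    (hSU : S ⊆ U) (hf : ContinuousOn f U) (h0 : ∀ x ∉ S, f x = 0) : Continuous f := by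
  rw [continuous_iff_continuousAt]
  intro x
  by_cases hx : x ∈ S
  · exact hf.continuousAt (hU.mem_nhds (hSU hx))
  · refine (continuousAt_const (y := (0 : F))).congr ?_
    filter_upwards [hS.isOpen_compl.mem_nhds hx] with y hy using (h0 y hy).symm

/-- H and mollification act on forms defined on all of ℝ^l. Friedrichs' theorem near the support of
a cutoff ψ, followed by the Leibniz rule for ψ, provides a compactly supported pair with a global
strong differential, unchanged where ψ is locally 1. -/
theorem IsWeakExtDerivOn.exists_truncation {b : Coord l → Alt l j} {a : Coord l → Alt l (j + 1)}
    {U L : Set (Coord l)} (hU : IsOpen U) (hw : IsWeakExtDerivOn b a U) (hb : ContinuousOn b U)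
    (ha : ContinuousOn a U) (hL : IsCompact L) (hLU : L ⊆ U) :
    ∃ (b' : Coord l → Alt l j) (a' : Coord l → Alt l (j + 1)) (M : Set (Coord l)),
      Continuous b' ∧ HasCompactSupport b' ∧ Continuous a' ∧ HasCompactSupport a' ∧
      IsStrongExtDerivOn b' a' univ ∧ IsOpen M ∧ L ⊆ M ∧ M ⊆ U ∧
      EqOn b' b M ∧ EqOn a' a M := by
  obtain ⟨ψ, hψ, hψc, hψU, hψ1⟩ := exists_cutoff hL hU hLU
  obtain ⟨V, hV, hψV, hVU, hs⟩ := hw.exists_strong hU hb ha hψc hψU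
  have hψd : ∀ y ∉ tsupport ψ, fderiv ℝ ψ y = 0 := fun y hy => by
    by_contra h0
    exact hy (tsupport_fderiv_subset ℝ (subset_tsupport _ h0))
  have hb0 : ∀ y ∉ tsupport ψ, ψ y • b y = 0 := fun y hy => by
    rw [image_eq_zero_of_notMem_tsupport hy, zero_smul]
  have ha0 : ∀ y ∉ tsupport ψ, covWedge (fderiv ℝ ψ y) (b y) + ψ y • a y = 0 := fun y hy => by
    simp [image_eq_zero_of_notMem_tsupport hy, hψd y hy]
  refine ⟨fun y => ψ y • b y, fun y => covWedge (fderiv ℝ ψ y) (b y) + ψ y • a y,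
    {x | ∀ᶠ y in 𝓝 x, ψ y = 1}, ?_, HasCompactSupport.intro hψc hb0, ?_,
    HasCompactSupport.intro hψc ha0, hs.smul_cutoff hV hψ hψc hψV, isOpen_setOfPred_eventually_nhds,
    hψ1, ?_, ?_, ?_⟩
  · exact continuous_of_continuousOn_of_eq_zero hU (isClosed_tsupport ψ) hψU
      (hψ.continuous.continuousOn.smul hb) hb0
  · refine continuous_of_continuousOn_of_eq_zero hU (isClosed_tsupport ψ) hψU
      (ContinuousOn.add ?_ (hψ.continuous.continuousOn.smul ha)) ha0
    exact (covWedge.continuous.comp (hψ.continuous_fderiv (by simp))).continuousOn.clm_apply hb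
  · intro x hx
    refine hψU (subset_tsupport _ ?_)
    have : ψ x = 1 := hx.self_of_nhds
    simp [this]
  · intro x hx
    have : ψ x = 1 := hx.self_of_nhds
    simp [this]
  · intro x hx
    have h1 : ψ x = 1 := hx.self_of_nhds
    have h2 : fderiv ℝ ψ x = 0 := by
      have : ψ =ᶠ[𝓝 x] fun _ => (1 : ℝ) := hx
      rw [this.fderiv_eq]
      simp
    simp [h1, h2]

/-- The radius is doubled so that balls of radius r around all points within r of x are still
contained in `M`. -/
theorem eventually_closedBall_subset {L M : Set (Coord l)} (hL : IsCompact L) (hM : IsOpen M)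
    (hLM : L ⊆ M) : ∀ᶠ r in 𝓝[>] (0 : ℝ), ∀ x ∈ L, Metric.closedBall x (2 * r) ⊆ M := by
  obtain ⟨δ, hδ, h⟩ := hL.exists_cthickening_subset_open hM hLM
  filter_upwards [Ioo_mem_nhdsGT (half_pos hδ)] with r hr x hx
  refine ((Metric.closedBall_subset_cthickening hx (2 * r)).trans
    (Metric.cthickening_mono ?_ L)).trans h
  linarith [hr.2]

/-- The bump function of outer radius `r` used for mollification. -/
def mollifier (l : ℕ) {r : ℝ} (hr : 0 < r) : ContDiffBump (0 : Coord l) :=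
  ⟨r / 2, r, half_pos hr, half_lt_self hr⟩

theorem contDiffOn_congr_eqOn {F : Type*} [NormedAddCommGroup F] [NormedSpace ℝ F]
    {f g : Coord l → F} {U M : Set (Coord l)} (hg : ContDiffOn ℝ ∞ g U) (hMU : M ⊆ U)
    (h : EqOn f g M) : ContDiffOn ℝ ∞ f M := (hg.mono hMU).congr h

/-- A function with a smooth weak differential is smooth. -/
theorem IsWeakExtDerivOn.contDiffOn_zero {b : Coord l → Alt l 0} {a : Coord l → Alt l 1}
    {U : Set (Coord l)} (hU : IsOpen U) (hw : IsWeakExtDerivOn b a U) (hb : ContinuousOn b U)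
    (ha : ContDiffOn ℝ ∞ a U) : ContDiffOn ℝ ∞ b U := by
  intro x hx
  obtain ⟨b', a', M, hb', -, ha', -, hs, hM, hxM, hMU, eb, ea⟩ :=
    hw.exists_truncation hU hb ha.continuousOn (isCompact_singleton (x := x)) (by simpa using hx)
  obtain ⟨r, hrM, hr⟩ := ((eventually_closedBall_subset isCompact_singleton hM hxM).and
    self_mem_nhdsWithin).exists
  have hr : 0 < r := hr
  have hxr : Metric.closedBall x r ⊆ M :=
    (Metric.closedBall_subset_closedBall (by linarith)).trans (hrM x rfl)
  set φ := mollifier l hr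
  -- The first summand is smooth everywhere, the second near x because `a` is smooth there.
  have e1 : b' = fun y => mollify φ b' y + homotopyOp φ a' y := by
    funext y
    rw [hs.homotopyOp_zero hb' ha' φ y]; abel
  have h1 : ContDiffAt ℝ ∞ b' x := by
    rw [e1]
    exact (contDiff_mollify φ hb'.locallyIntegrable).contDiffAt.add
      (contDiffAt_segAvg (continuous_homotopy_kernel φ) hM (contDiffOn_congr_eqOn ha hMU ea)
        hr hxr)
  exact (h1.congr_of_eventuallyEq ((eb.symm.eventuallyEq_of_mem
    (hM.mem_nhds (hxM rfl))))).contDiffWithinAt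

/-- Smoothing near a compact set: a weak primitive `b` of a smooth form is changed by a small
exact form `θ`, so that it becomes smooth near `C` and remains so near `T`. -/
theorem IsWeakExtDerivOn.exists_local_smoothing {b : Coord l → Alt l (j + 1)}
    {a : Coord l → Alt l (j + 2)} {U C T : Set (Coord l)} (hU : IsOpen U)
    (hw : IsWeakExtDerivOn b a U) (hb : ContinuousOn b U) (ha : ContDiffOn ℝ ∞ a U)
    (hC : IsCompact C) (hCU : C ⊆ U) (hT : ∀ L ⊆ U, IsCompact L → IsCompact (L ∩ T))
    (hbT : ∀ x ∈ U ∩ T, ∀ᶠ y in 𝓝 x, ContDiffAt ℝ ∞ b y) {κ : ℝ} (hκ : 0 < κ) :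
    ∃ (δ : Coord l → Alt l j) (θ : Coord l → Alt l (j + 1)) (L : Set (Coord l)),
      IsCompact L ∧ L ⊆ U ∧ (∀ y ∉ L, δ y = 0) ∧ (∀ y ∉ L, θ y = 0) ∧ Continuous δ ∧
      Continuous θ ∧ (∀ y, ‖δ y‖ ≤ κ) ∧ (∀ y, ‖θ y‖ ≤ κ) ∧ IsStrongExtDerivOn δ θ univ ∧
      ∀ x ∈ C ∪ U ∩ T, ∀ᶠ y in 𝓝 x, ContDiffAt ℝ ∞ (fun z => b z - θ z) y := by
  obtain ⟨χ, hχ, hχc, hχU, hχ1⟩ := exists_cutoff hC hU hCU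
  set L := tsupport χ with hL
  obtain ⟨b', a', M, hb', hbc, ha', hac, hs, hM, hLM, hMU, eb, ea⟩ :=
    hw.exists_truncation hU hb ha.continuousOn hχc hχU
  set N := {x | ∀ᶠ y in 𝓝 x, ContDiffAt ℝ ∞ b y} with hN
  have hNo : IsOpen N := isOpen_setOfPred_eventually_nhds
  have hbN : ContDiffOn ℝ ∞ b N := fun x hx =>
    (show ∀ᶠ y in 𝓝 x, ContDiffAt ℝ ∞ b y from hx).self_of_nhds.contDiffWithinAt
  obtain ⟨B, hB⟩ := hb'.bounded_above_of_compact_support hbc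
  obtain ⟨A, hA⟩ := ha'.bounded_above_of_compact_support hac
  obtain ⟨m, hm⟩ := hχ.continuous.bounded_above_of_compact_support hχc
  obtain ⟨m', hm'⟩ := (hχ.continuous_fderiv (by simp)).bounded_above_of_compact_support
    (hχc.fderiv (𝕜 := ℝ))
  have hm0 : 0 ≤ m := (norm_nonneg _).trans (hm 0)
  have hm0' : 0 ≤ m' := (norm_nonneg _).trans (hm' 0)
  set cw := ‖(covWedge : (Coord l →L[ℝ] ℝ) →L[ℝ] Alt l j →L[ℝ] Alt l (j + 1))‖
  have hcw : 0 ≤ cw := norm_nonneg _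
  -- With Hb' of size η and u of size 2η, the form dχ ∧ Hb' + χu has size at most (cw m' + 2m) η,
  -- hence at most D η = κ.
  set D := cw * m' + 2 * m + 1
  have hD : 0 < D := by positivity
  set η := κ / D with hη
  have hη0 : 0 < η := by positivity
  have hDη : D * η = κ := mul_div_cancel₀ κ hD.ne'
  have hlim : ∀ c B : ℝ, ∀ᶠ r in 𝓝[>] (0 : ℝ), c * r * B ≤ η := fun c B => by
    have : Tendsto (fun r : ℝ => c * r * B) (𝓝 0) (𝓝 (c * 0 * B)) :=
      (tendsto_id.const_mul c).mul_const B
    rw [mul_zero, zero_mul] at this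
    exact (this.mono_left nhdsWithin_le_nhds).eventually_le_const hη0
  obtain ⟨ε, hε, hunif⟩ := Metric.uniformContinuous_iff.mp
    (hbc.uniformContinuous_of_continuous hb') η hη0
  -- The radius is small enough that balls of radius 2r around `L` stay where b' = b and a' = a,
  -- that those around the compact set `L ∩ T` stay where `b` is smooth, and that Hb', Ha' and b' -
  -- ρ∗b' have size at most η.
  obtain ⟨r, ⟨⟨⟨⟨hrM, hrN⟩, hr1⟩, hr2⟩, hr3⟩, hr⟩ := ((((((eventually_closedBall_subset hχc hM hLM).and
    (eventually_closedBall_subset (hT L hχU hχc) hNo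
      fun x hx => hbT x ⟨hχU hx.1, hx.2⟩)).and
    (hlim ‖(contr : Coord l →L[ℝ] Alt l (j + 1) →L[ℝ] Alt l j)‖ B)).and
    (hlim ‖(contr : Coord l →L[ℝ] Alt l (j + 2) →L[ℝ] Alt l (j + 1))‖ A)).and
    (eventually_nhdsWithin_of_eventually_nhds (eventually_le_nhds hε))).and
    self_mem_nhdsWithin).exists
  have hr : 0 < r := hr
  set φ := mollifier l hr with hφ
  have hφr : φ.rOut = r := rfl
  have nH : ∀ y, ‖homotopyOp φ b' y‖ ≤ η := fun y => (norm_homotopyOp_le φ hB y).trans hr1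
  have nH' : ∀ y, ‖homotopyOp φ a' y‖ ≤ η := fun y => (norm_homotopyOp_le φ hA y).trans hr2
  have nM : ∀ y, ‖b' y - mollify φ b' y‖ ≤ η := fun y => by
    have := φ.dist_normed_convolution_le (μ := volume) (x₀ := y) (ε := η)
      hb'.aestronglyMeasurable fun x hx => (hunif ((Metric.mem_ball.mp hx).trans_le hr3)).le
    rwa [dist_comm, dist_eq_norm] at this
  have cH : Continuous (homotopyOp φ b') := continuous_segAvg _ (continuous_homotopy_kernel φ) hb'
  have cH' : Continuous (homotopyOp φ a') := continuous_segAvg _ (continuous_homotopy_kernel φ) ha'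
  have sM : ContDiff ℝ ∞ (mollify φ b') := contDiff_mollify φ hb'.locallyIntegrable
  -- By the homotopy formula `u` is the strong differential of Hb'.
  set u : Coord l → Alt l (j + 1) := fun y => b' y - mollify φ b' y - homotopyOp φ a' y with hu
  have cu : Continuous u := (hb'.sub sM.continuous).sub cH'
  have nu : ∀ y, ‖u y‖ ≤ 2 * η := fun y =>
    (norm_sub_le _ _).trans (by linarith [nM y, nH' y])
  have hχd : ∀ y ∉ L, fderiv ℝ χ y = 0 := fun y hy => by
    by_contra h0
    exact hy (tsupport_fderiv_subset ℝ (subset_tsupport _ h0))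
  have hχd1 : ∀ y, (∀ᶠ z in 𝓝 y, χ z = 1) → fderiv ℝ χ y = 0 := fun y hy => by
    have : χ =ᶠ[𝓝 y] fun _ => (1 : ℝ) := hy
    rw [this.fderiv_eq]
    simp
  have smH' : ∀ y, Metric.closedBall y r ⊆ M → ContDiffAt ℝ ∞ (homotopyOp φ a') y := fun y hy =>
    contDiffAt_segAvg (continuous_homotopy_kernel φ) hM (contDiffOn_congr_eqOn ha hMU ea) hr hy
  have hball : ∀ x : Coord l, ∀ y ∈ Metric.ball x r,
      Metric.closedBall y r ⊆ Metric.closedBall x (2 * r) := fun x y hy =>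
    Metric.closedBall_subset_closedBall' (by linarith [Metric.mem_ball.mp hy])
  have h0η := hη0.le
  -- The form θ is d(χ Hb'), expanded by the Leibniz rule.
  refine ⟨fun y => χ y • homotopyOp φ b' y,
    fun y => covWedge (fderiv ℝ χ y) (homotopyOp φ b' y) + χ y • u y, L, hχc, hχU, ?_, ?_,
    hχ.continuous.smul cH, ?_, ?_, ?_,
    (hs.homotopyOp hb' ha' φ).smul_cutoff isOpen_univ hχ hχc (subset_univ _), ?_⟩
  · intro y hy
    simp [image_eq_zero_of_notMem_tsupport hy]
  · intro y hy
    simp [image_eq_zero_of_notMem_tsupport hy, hχd y hy]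
  · exact ((covWedge.continuous.comp (hχ.continuous_fderiv (by simp))).clm_apply cH).add
      (hχ.continuous.smul cu)
  · intro y
    rw [norm_smul]
    have := mul_le_mul (hm y) (nH y) (norm_nonneg _) hm0
    have : D * η = cw * m' * η + 2 * (m * η) + η := by ring
    have := mul_nonneg (mul_nonneg hcw hm0') h0η
    have := mul_nonneg hm0 h0η
    linarith
  · intro y
    have h1 : ‖covWedge (fderiv ℝ χ y) (homotopyOp φ b' y)‖ ≤ cw * m' * η :=
      ((covWedge : (Coord l →L[ℝ] ℝ) →L[ℝ] Alt l j →L[ℝ] Alt l (j + 1)).le_opNorm₂ _ _).trans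
        (mul_le_mul (mul_le_mul_of_nonneg_left (hm' y) hcw) (nH y) (norm_nonneg _)
          (mul_nonneg hcw hm0'))
    have h2 : ‖χ y • u y‖ ≤ m * (2 * η) := by
      rw [norm_smul]
      exact mul_le_mul (hm y) (nu y) (norm_nonneg _) hm0
    have : D * η = cw * m' * η + m * (2 * η) + η := by ring
    refine (norm_add_le _ _).trans ?_
    linarith
  · intro x hx
    by_cases hxC : x ∈ C
    -- Near `C` the cutoff is 1, so b - θ = ρ∗b' + Ha'.
    · have hxL : x ∈ L := subset_tsupport _ (by
        have : χ x = 1 := (hχ1 x hxC).self_of_nhds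
        simp [this])
      filter_upwards [(hχ1 x hxC).eventually_nhds, Metric.ball_mem_nhds x hr] with y hy hyr
      have hyM : Metric.closedBall y r ⊆ M := (hball x y hyr).trans (hrM x hxL)
      have hyM' : y ∈ M := hyM (Metric.mem_closedBall_self hr.le)
      refine (sM.contDiffAt.add (smH' y hyM)).congr_of_eventuallyEq ?_
      filter_upwards [hy.eventually_nhds, hM.mem_nhds hyM'] with z hz hzM
      have h1 : χ z = 1 := hz.self_of_nhds
      simp only [hu, h1, hχd1 z hz, eb hzM, map_zero, zero_apply, one_smul]
      abel
    · obtain ⟨hxU, hxT⟩ : x ∈ U ∩ T := hx.resolve_left hxC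
      -- Near a point of `T` in `L`, the form `b` is smooth on the whole range of the averages,
      -- hence so are Hb' and u. Away from `L`, θ vanishes.
      by_cases hxL : x ∈ L
      · filter_upwards [Metric.ball_mem_nhds x hr] with y hyr
        have hyM : Metric.closedBall y r ⊆ M := (hball x y hyr).trans (hrM x hxL)
        have hyN : Metric.closedBall y r ⊆ N := (hball x y hyr).trans (hrN x ⟨hxL, hxT⟩)
        have hyN' : y ∈ N := hyN (Metric.mem_closedBall_self hr.le)
        have hyM' : y ∈ M := hyM (Metric.mem_closedBall_self hr.le)
        have hb's : ContDiffOn ℝ ∞ b' (N ∩ M) :=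
          contDiffOn_congr_eqOn hbN inter_subset_left (eb.mono inter_subset_right)
        have h1 : ContDiffAt ℝ ∞ (homotopyOp φ b') y :=
          contDiffAt_segAvg (continuous_homotopy_kernel φ) (hNo.inter hM) hb's hr
            (subset_inter hyN hyM)
        have h2 : ContDiffAt ℝ ∞ u y :=
          ((hb's.contDiffAt ((hNo.inter hM).mem_nhds ⟨hyN', hyM'⟩)).sub sM.contDiffAt).sub
            (smH' y hyM)
        refine (hbN.contDiffAt (hNo.mem_nhds hyN')).sub (ContDiffAt.add ?_ (hχ.contDiffAt.smul h2))
        exact (covWedge.contDiff.contDiffAt.comp y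
          (hχ.fderiv_right (m := ∞) (by simp)).contDiffAt).clm_apply h1
      · filter_upwards [(hbT x ⟨hxU, hxT⟩), (isClosed_tsupport χ).isOpen_compl.mem_nhds hxL]
          with y hy hyL
        refine hy.congr_of_eventuallyEq ?_
        filter_upwards [(isClosed_tsupport χ).isOpen_compl.mem_nhds hyL] with z hz
        simp [image_eq_zero_of_notMem_tsupport hz, hχd z hz]

end LocalSmoothing

end LInftyForms

end

noncomputable section

set_option maxSynthPendingDepth 3

namespace LInftyForms

open Set Filter Topology

/-! ### Pullback of forms and of strong differentials on Euclidean space -/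

section Pullback

variable {l j : ℕ}

/-- Pullback is linear in the form and polynomial in the linear map. This is known for multilinear
maps and is carried over by the inclusion `L` of alternating maps and a linear left inverse `R`,
continuous by finite dimension. -/
theorem contDiff_compContinuousLinearMap {n : WithTop ℕ∞} :
    ContDiff ℝ n fun p : Alt l j × (Coord l →L[ℝ] Coord l) =>
      p.1.compContinuousLinearMap p.2 := by
  let L : Alt l j →L[ℝ] ContinuousMultilinearMap ℝ (fun _ : Fin j => Coord l) ℝ :=
    ContinuousAlternatingMap.toContinuousMultilinearMapCLM ℝ
  have hL : LinearMap.ker L.toLinearMap = ⊥ := LinearMap.ker_eq_bot.mpr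
    fun _ _ h => ContinuousAlternatingMap.toContinuousMultilinearMap_injective h
  obtain ⟨R, hR⟩ := L.toLinearMap.exists_leftInverse_of_injective hL
  have : FiniteDimensional ℝ (ContinuousMultilinearMap ℝ (fun _ : Fin j => Coord l) ℝ) :=
    FiniteDimensional.of_injective
      (ContinuousMultilinearMap.toMultilinearMapLinear (R' := ℝ) (A := ℝ)
        (M₁ := fun _ : Fin j => Coord l) (M₂ := ℝ))
      ContinuousMultilinearMap.toMultilinearMap_injective
  have key : (fun p : Alt l j × (Coord l →L[ℝ] Coord l) => p.1.compContinuousLinearMap p.2) =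
      fun p => LinearMap.toContinuousLinearMap R
        ((ContinuousMultilinearMap.compContinuousLinearMapContinuousMultilinear ℝ
          (fun _ : Fin j => Coord l) (fun _ => Coord l) ℝ (fun _ => p.2)) (L p.1)) := by
    funext p
    exact (LinearMap.congr_fun hR (p.1.compContinuousLinearMap p.2)).symm
  rw [key]
  refine (LinearMap.toContinuousLinearMap R).contDiff.comp (ContDiff.clm_apply ?_ ?_)
  · exact (ContinuousMultilinearMap.contDiff _).comp (contDiff_pi.mpr fun _ => contDiff_snd)
  · exact L.contDiff.comp contDiff_fst

theorem compContinuousLinearMap_comp (a : Alt l j) (A B : Coord l →L[ℝ] Coord l) :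
    (a.compContinuousLinearMap A).compContinuousLinearMap B =
      a.compContinuousLinearMap (A ∘L B) := rfl

theorem compContinuousLinearMap_id (a : Alt l j) :
    a.compContinuousLinearMap (ContinuousLinearMap.id ℝ (Coord l)) = a := rfl

theorem extDeriv_compContinuousLinearMap {c : Coord l → Alt l j} {τ : Coord l → Coord l}
    {x : Coord l} (hc : DifferentiableAt ℝ c (τ x)) (hτ : ContDiffAt ℝ ∞ τ x) :
    extDeriv (fun y => (c (τ y)).compContinuousLinearMap (fderiv ℝ τ y)) x =
      (extDeriv c (τ x)).compContinuousLinearMap (fderiv ℝ τ x) := by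
  refine extDeriv_pullback hc hτ ?_
  rw [minSmoothness_of_isRCLikeNormedField]
  exact WithTop.coe_le_coe.2 le_top

theorem IsStrongExtDerivOn.congr {b b' : Coord l → Alt l j} {a a' : Coord l → Alt l (j + 1)}
    {V : Set (Coord l)} (h : IsStrongExtDerivOn b a V) (hb : EqOn b b' V) (ha : EqOn a a' V) :
    IsStrongExtDerivOn b' a' V := by
  intro ε hε
  obtain ⟨c, hc, h⟩ := h ε hε
  exact ⟨c, hc, fun y hy => by rw [← hb hy, ← ha hy]; exact h y hy⟩

/-- The approximants are pulled back; by naturality of d the errors grow at most by powers of the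
bound on the derivative of τ. -/
theorem IsStrongExtDerivOn.pullback {b : Coord l → Alt l j} {a : Coord l → Alt l (j + 1)}
    {V W : Set (Coord l)} (h : IsStrongExtDerivOn b a V) (hV : IsOpen V) (hW : IsOpen W)
    {τ : Coord l → Coord l} (hτ : ContDiffOn ℝ ∞ τ W) (hm : MapsTo τ W V) {M : ℝ}
    (hM : ∀ y ∈ W, ‖fderiv ℝ τ y‖ ≤ M) :
    IsStrongExtDerivOn (fun y => (b (τ y)).compContinuousLinearMap (fderiv ℝ τ y))
      (fun y => (a (τ y)).compContinuousLinearMap (fderiv ℝ τ y)) W := by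
  intro ε hε
  -- With a base at least 1, the power j + 1 also dominates the power j needed for the form itself.
  have hM1 : (1 : ℝ) ≤ max M 1 := le_max_right _ _
  have hpos : 0 < (max M 1) ^ (j + 1) := by positivity
  obtain ⟨c, hc, h⟩ := h (ε / (max M 1) ^ (j + 1)) (by positivity)
  have hcd : ∀ y ∈ W, DifferentiableAt ℝ c (τ y) := fun y hy =>
    (hc.contDiffAt (hV.mem_nhds (hm hy))).differentiableAt (by simp)
  refine ⟨fun y => (c (τ y)).compContinuousLinearMap (fderiv ℝ τ y), ?_, fun y hy => ⟨?_, ?_⟩⟩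
  · have h1 : ContDiffOn ℝ ∞ (fun y => fderiv ℝ τ y) W :=
      hτ.fderiv_of_isOpen hW (by simp)
    exact contDiff_compContinuousLinearMap.comp_contDiffOn ((hc.comp hτ hm).prodMk h1)
  · have := ((c (τ y)) - b (τ y)).norm_compContinuousLinearMap_le (fderiv ℝ τ y)
    refine this.trans ?_
    rw [Fintype.card_fin]
    calc _ ≤ (ε / (max M 1) ^ (j + 1)) * (max M 1) ^ (j + 1) := by
          refine mul_le_mul (h _ (hm hy)).1 ?_ (by positivity) (by positivity)
          exact (pow_le_pow_left₀ (norm_nonneg _) ((hM y hy).trans (le_max_left _ _)) j).trans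
            (pow_le_pow_right₀ hM1 (by omega))
      _ = ε := by field_simp
  · rw [extDeriv_compContinuousLinearMap (hcd y hy) (hτ.contDiffAt (hW.mem_nhds hy))]
    have := (extDeriv c (τ y) - a (τ y)).norm_compContinuousLinearMap_le (fderiv ℝ τ y)
    refine this.trans ?_
    rw [Fintype.card_fin]
    calc _ ≤ (ε / (max M 1) ^ (j + 1)) * (max M 1) ^ (j + 1) := by
          refine mul_le_mul (h _ (hm hy)).2 ?_ (by positivity) (by positivity)
          exact pow_le_pow_left₀ (norm_nonneg _) ((hM y hy).trans (le_max_left _ _)) _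
      _ = ε := by field_simp

end Pullback

/-! ### Forms in charts and change of chart -/

section Charts

set_option linter.unusedSectionVars false

variable {l j : ℕ} {K : Type*} [TopologicalSpace K] [ChartedSpace (Coord l) K]
  [IsManifold (𝓡 l) ∞ K]

local notation "𝒜" => IsManifold.maximalAtlas (𝓡 l) ∞ K

variable {e e' : OpenPartialHomeomorph K (Coord l)}

theorem mdifferentiableAt_chart (he : e ∈ 𝒜) {x : K} (hx : x ∈ e.source) :
    MDifferentiableAt (𝓡 l) (𝓡 l) e x :=
  ((contMDiffOn_of_mem_maximalAtlas he).contMDiffAt (e.open_source.mem_nhds hx)).mdifferentiableAt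
    (by simp)

theorem mdifferentiableAt_chart_symm (he : e ∈ 𝒜) {y : Coord l} (hy : y ∈ e.target) :
    MDifferentiableAt (𝓡 l) (𝓡 l) e.symm y :=
  ((contMDiffOn_symm_of_mem_maximalAtlas he).contMDiffAt
    (e.open_target.mem_nhds hy)).mdifferentiableAt (by simp)

theorem mdifferentiable_chart (he : e ∈ 𝒜) : e.MDifferentiable (𝓡 l) (𝓡 l) :=
  ⟨fun _ hx => (mdifferentiableAt_chart he hx).mdifferentiableWithinAt,
    fun _ hy => (mdifferentiableAt_chart_symm he hy).mdifferentiableWithinAt⟩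

/-- The derivative of a chart, as an endomorphism of `ℝ^l`. -/
def chartDeriv (e : OpenPartialHomeomorph K (Coord l)) (x : K) : Coord l →L[ℝ] Coord l :=
  mfderiv (𝓡 l) (𝓡 l) e x

/-- The derivative of the inverse of a chart, as an endomorphism of `ℝ^l`. -/
def chartSymmDeriv (e : OpenPartialHomeomorph K (Coord l)) (y : Coord l) :
    Coord l →L[ℝ] Coord l :=
  mfderiv (𝓡 l) (𝓡 l) e.symm y

/-- The values of a form, as alternating maps on `ℝ^l`. -/
def Form.val (α : Form l K j) (x : K) : Alt l j := α x

theorem chartRep_apply (e : OpenPartialHomeomorph K (Coord l)) (α : Form l K j) (y : Coord l) :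
    chartRep e α y = (α.val (e.symm y)).compContinuousLinearMap (chartSymmDeriv e y) := rfl

theorem chartDeriv_comp_symm (he : e ∈ 𝒜) {y : Coord l} (hy : y ∈ e.target) :
    chartDeriv e (e.symm y) ∘L chartSymmDeriv e y = ContinuousLinearMap.id ℝ (Coord l) :=
  (mdifferentiable_chart he).comp_symm_deriv hy

theorem chartSymmDeriv_comp (he : e ∈ 𝒜) {x : K} (hx : x ∈ e.source) :
    chartSymmDeriv e (e x) ∘L chartDeriv e x = ContinuousLinearMap.id ℝ (Coord l) :=
  (mdifferentiable_chart he).symm_comp_deriv hx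

theorem contDiffOn_transition (he : e ∈ 𝒜) (he' : e' ∈ 𝒜) :
    ContDiffOn ℝ ∞ (e ∘ e'.symm) (e'.target ∩ e'.symm ⁻¹' e.source) := by
  rw [← contMDiffOn_iff_contDiffOn]
  exact (contMDiffOn_of_mem_maximalAtlas he).comp
    ((contMDiffOn_symm_of_mem_maximalAtlas he').mono inter_subset_left) fun _ hy => hy.2

theorem isOpen_transition (e e' : OpenPartialHomeomorph K (Coord l)) :
    IsOpen (e'.target ∩ e'.symm ⁻¹' e.source) :=
  e'.isOpen_inter_preimage_symm e.open_source

theorem fderiv_transition (he : e ∈ 𝒜) (he' : e' ∈ 𝒜) {y : Coord l} (hy : y ∈ e'.target)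
    (hy' : e'.symm y ∈ e.source) :
    fderiv ℝ (e ∘ e'.symm) y = chartDeriv e (e'.symm y) ∘L chartSymmDeriv e' y := by
  rw [← mfderiv_eq_fderiv]
  exact mfderiv_comp y (mdifferentiableAt_chart he hy') (mdifferentiableAt_chart_symm he' hy)

/-- The chain rule: representations in two charts are pullbacks of each other under the transition
map. Local notions are carried from chart to chart through this identity. -/
theorem chartRep_transition (he : e ∈ 𝒜) (he' : e' ∈ 𝒜) (α : Form l K j) {y : Coord l}
    (hy : y ∈ e'.target) (hy' : e'.symm y ∈ e.source) :
    chartRep e' α y = (chartRep e α ((e ∘ e'.symm) y)).compContinuousLinearMap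
      (fderiv ℝ (e ∘ e'.symm) y) := by
  rw [fderiv_transition he he' hy hy', chartRep_apply, chartRep_apply,
    compContinuousLinearMap_comp, ← ContinuousLinearMap.comp_assoc, Function.comp_apply,
    chartSymmDeriv_comp he hy', ContinuousLinearMap.id_comp, e.left_inv hy']

theorem chartRep_comp_chartDeriv (he : e ∈ 𝒜) (α : Form l K j) {x : K} (hx : x ∈ e.source) :
    (chartRep e α (e x)).compContinuousLinearMap (chartDeriv e x) = α.val x := by
  rw [chartRep_apply, compContinuousLinearMap_comp, chartSymmDeriv_comp he hx,
    compContinuousLinearMap_id, e.left_inv hx]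

theorem Form.ext_chartRep {α β : Form l K j}
    (h : ∀ x : K, ∃ e ∈ 𝒜, x ∈ e.source ∧ chartRep e α (e x) = chartRep e β (e x)) : α = β := by
  funext x
  obtain ⟨e, he, hx, h⟩ := h x
  change α.val x = β.val x
  rw [← chartRep_comp_chartDeriv he α hx, ← chartRep_comp_chartDeriv he β hx, h]

/-- A property of points near the image of `x` in one chart transfers to other charts. -/
theorem eventually_transition {x : K} (hx : x ∈ e.source) (hx' : x ∈ e'.source)
    {P : Coord l → Prop} (h : ∀ᶠ z in 𝓝 (e x), P z) :
    ∀ᶠ y in 𝓝 (e' x), y ∈ e'.target ∩ e'.symm ⁻¹' e.source ∧ P ((e ∘ e'.symm) y) := by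
  have h1 : e'.target ∩ e'.symm ⁻¹' e.source ∈ 𝓝 (e' x) :=
    (isOpen_transition e e').mem_nhds ⟨e'.map_source hx', by simpa [e'.left_inv hx'] using hx⟩
  have h2 : Tendsto (e ∘ e'.symm) (𝓝 (e' x)) (𝓝 (e x)) := by
    refine Tendsto.comp (y := 𝓝 x) (e.continuousAt hx) ?_
    simpa [ContinuousAt, e'.left_inv hx'] using e'.continuousAt_symm (e'.map_source hx')
  exact Filter.Eventually.and h1 (h2.eventually h)

/-! ### Smooth and continuous forms -/

/-- `α` is smooth in a neighbourhood of `x`. -/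
def SmoothNear (α : Form l K j) (x : K) : Prop :=
  ∀ e ∈ 𝒜, x ∈ e.source → ∀ᶠ y in 𝓝 (e x), ContDiffAt ℝ ∞ (chartRep e α) y

theorem contDiffAt_chartRep_transition (he : e ∈ 𝒜) (he' : e' ∈ 𝒜) {α : Form l K j} {y : Coord l}
    (hy : y ∈ e'.target) (hy' : e'.symm y ∈ e.source)
    (h : ContDiffAt ℝ ∞ (chartRep e α) ((e ∘ e'.symm) y)) :
    ContDiffAt ℝ ∞ (chartRep e' α) y := by
  have hW := (isOpen_transition e e').mem_nhds ⟨hy, hy'⟩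
  have hτ := (contDiffOn_transition he he').contDiffAt hW
  have h1 : ContDiffAt ℝ ∞ (fun z => fderiv ℝ (e ∘ e'.symm) z) y := hτ.fderiv_right (by simp)
  refine ContDiffAt.congr_of_eventuallyEq
    (contDiff_compContinuousLinearMap.contDiffAt.comp y ((h.comp y hτ).prodMk h1)) ?_
  filter_upwards [hW] with z hz using chartRep_transition he he' α hz.1 hz.2

theorem SmoothNear.of_chart {α : Form l K j} {x : K} (he : e ∈ 𝒜) (hx : x ∈ e.source)
    (h : ∀ᶠ y in 𝓝 (e x), ContDiffAt ℝ ∞ (chartRep e α) y) : SmoothNear α x := by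
  intro e' he' hx'
  filter_upwards [eventually_transition hx hx' h] with y hy
  exact contDiffAt_chartRep_transition he he' hy.1.1 hy.1.2 hy.2

theorem isSmooth_of_smoothNear {α : Form l K j} (h : ∀ x, SmoothNear α x) : IsSmooth α := by
  intro e he y hy
  have := h (e.symm y) e he (e.map_target hy)
  rw [e.right_inv hy] at this
  exact this.self_of_nhds.contDiffWithinAt

theorem chartRep_eventuallyEq {α β : Form l K j} {x : K} (h : ∀ᶠ z in 𝓝 x, α z = β z)
    (hx : x ∈ e.source) : chartRep e α =ᶠ[𝓝 (e x)] chartRep e β := by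
  have h2 : Tendsto e.symm (𝓝 (e x)) (𝓝 x) := by
    simpa [ContinuousAt, e.left_inv hx] using e.continuousAt_symm (e.map_source hx)
  filter_upwards [h2.eventually h] with y hy
  rw [chartRep, chartRep, hy]

theorem SmoothNear.congr {α β : Form l K j} {x : K} (h : SmoothNear α x)
    (hαβ : ∀ᶠ z in 𝓝 x, α z = β z) : SmoothNear β x := by
  intro e he hx
  filter_upwards [h e he hx, (chartRep_eventuallyEq hαβ hx).eventuallyEq_nhds] with y hy hy'
  exact hy.congr_of_eventuallyEq hy'.symm

theorem isCont_of_continuousAt {α : Form l K j} (h : ∀ x : K, ∃ e ∈ 𝒜, x ∈ e.source ∧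
    ContinuousAt (chartRep e α) (e x)) : IsCont α := by
  intro e' he' y hy
  obtain ⟨e, he, hx, h⟩ := h (e'.symm y)
  have hW := (isOpen_transition e e').mem_nhds ⟨hy, hx⟩
  have hτ := (contDiffOn_transition he he').contDiffAt hW
  have h1 : ContDiffAt ℝ 0 (fun z => fderiv ℝ (e ∘ e'.symm) z) y := hτ.fderiv_right (by simp)
  have h2 : ContinuousAt (chartRep e α ∘ (e ∘ e'.symm)) y :=
    ContinuousAt.comp (f := e ∘ e'.symm) h hτ.continuousAt
  refine ContinuousAt.continuousWithinAt (ContinuousAt.congr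
    (ContinuousAt.comp (f := fun z => (chartRep e α ((e ∘ e'.symm) z),
      fderiv ℝ (e ∘ e'.symm) z))
      (contDiff_compContinuousLinearMap (n := 0)).continuous.continuousAt
      (h2.prodMk h1.continuousAt)) ?_)
  filter_upwards [hW] with z hz using (chartRep_transition he he' α hz.1 hz.2).symm

theorem IsSmooth.isCont {α : Form l K j} (h : IsSmooth α) : IsCont α :=
  fun e he => (h e he).continuousOn

/-! ### Naturality of the exterior derivative -/

/-- `extD` uses a chart that varies with the point; naturality of d under the transition maps makes
the result agree with the differential in any fixed chart. -/
theorem chartRep_extD {α : Form l K j} (hα : IsSmooth α) (he : e ∈ 𝒜) {y : Coord l}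
    (hy : y ∈ e.target) : chartRep e (extD α) y = extDeriv (chartRep e α) y := by
  set c := chartAt (Coord l) (e.symm y) with hc
  have hc' : c ∈ 𝒜 := IsManifold.chart_mem_maximalAtlas _
  have hyc : e.symm y ∈ c.source := mem_chart_source _ _
  have hW := (isOpen_transition c e).mem_nhds ⟨hy, hyc⟩
  have h1 : chartRep e (extD α) y =
      (extDeriv (chartRep c α) ((c ∘ e.symm) y)).compContinuousLinearMap
        (fderiv ℝ (c ∘ e.symm) y) := by
    rw [fderiv_transition hc' he hy hyc, ← compContinuousLinearMap_comp]
    rfl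
  rw [h1, ← extDeriv_compContinuousLinearMap]
  · refine Filter.EventuallyEq.extDeriv_eq ?_
    filter_upwards [hW] with z hz using (chartRep_transition hc' he α hz.1 hz.2).symm
  · exact ((hα c hc').contDiffAt (c.open_target.mem_nhds (c.map_source hyc))).differentiableAt
      (by simp)
  · exact (contDiffOn_transition hc' he).contDiffAt hW

theorem IsSmooth.extD {α : Form l K j} (hα : IsSmooth α) : IsSmooth (extD α) := by
  intro e he
  exact (contDiffOn_extDeriv e.open_target (hα e he)).congr fun y hy => chartRep_extD hα he hy

theorem IsSmooth.isWeakExtDeriv_extD {α : Form l K j} (hα : IsSmooth α) :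
    IsWeakExtDeriv α (LInftyForms.extD α) := by
  intro e he k h h' φ h1 h2 h3
  rw [isWeakExtDerivOn_extDeriv e.open_target (hα e he) k h h' φ h1 h2 h3]
  congr 1
  exact setIntegral_congr_fun e.open_target.measurableSet fun y hy => by
    simp only [chartRep_extD hα he hy]

theorem hasBddWeakExtDeriv_of_mem_Omega {g : Metric l K} {α : Form l K j}
    (hα : α ∈ Omega g j) : HasBddWeakExtDeriv g α (extD α) :=
  ⟨hα.1.isCont, hα.2.1, hα.1.extD.isCont, hα.2.2, hα.1.isWeakExtDeriv_extD⟩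

theorem IsWeakExtDeriv.extD_eq {β : Form l K j} {α : Form l K (j + 1)} (h : IsWeakExtDeriv β α)
    (hβ : IsSmooth β) (hα : IsCont α) : extD β = α := by
  refine Form.ext_chartRep fun x => ⟨chartAt _ x, IsManifold.chart_mem_maximalAtlas x,
    mem_chart_source _ x, ?_⟩
  have he : chartAt (Coord l) x ∈ 𝒜 := IsManifold.chart_mem_maximalAtlas x
  rw [chartRep_extD hβ he (mem_chart_target _ x), (h _ he).eq_extDeriv
    (chartAt (Coord l) x).open_target (hβ _ he) (hα _ he) (mem_chart_target _ x)]

/-! ### Local strong approximation on the manifold -/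

/-- Near `x`, the form `β` and its differential `α` are uniform limits, in a chart, of smooth
forms and their differentials. -/
def StrongAt (β : Form l K j) (α : Form l K (j + 1)) (x : K) : Prop :=
  ∃ e ∈ 𝒜, x ∈ e.source ∧ ∃ V, IsOpen V ∧ e x ∈ V ∧ V ⊆ e.target ∧
    IsStrongExtDerivOn (chartRep e β) (chartRep e α) V

/-- Strong differentials pull back under the transition map once the neighbourhood is shrunk so that
its derivative is bounded. -/
theorem StrongAt.exists_chart {β : Form l K j} {α : Form l K (j + 1)} {x : K}
    (h : StrongAt β α x) (he' : e' ∈ 𝒜) (hx' : x ∈ e'.source) :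
    ∃ V, IsOpen V ∧ e' x ∈ V ∧ V ⊆ e'.target ∧
      IsStrongExtDerivOn (chartRep e' β) (chartRep e' α) V := by
  obtain ⟨e, he, hx, V, hV, hxV, hVt, h⟩ := h
  have h1 := eventually_transition hx hx' (hV.mem_nhds hxV)
  have h2 : ContinuousAt (fderiv ℝ (e ∘ e'.symm)) (e' x) := by
    have : ContDiffAt ℝ 0 (fun z => fderiv ℝ (e ∘ e'.symm) z) (e' x) :=
      ((contDiffOn_transition he he').contDiffAt
        ((isOpen_transition e e').mem_nhds h1.self_of_nhds.1)).fderiv_right (by simp)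
    exact this.continuousAt
  have h3 := h2.norm.eventually (gt_mem_nhds (lt_add_one _))
  obtain ⟨W, hW, hWo, hxW⟩ := eventually_nhds_iff.mp (h1.and h3)
  refine ⟨W, hWo, hxW, fun y hy => (hW y hy).1.1.1, ?_⟩
  refine (h.pullback hV hWo ((contDiffOn_transition he he').mono fun y hy => (hW y hy).1.1)
    (fun y hy => (hW y hy).1.2) fun y hy => (hW y hy).2.le).congr ?_ ?_
  · exact fun y hy => (chartRep_transition he he' β (hW y hy).1.1.1 (hW y hy).1.1.2).symm
  · exact fun y hy => (chartRep_transition he he' α (hW y hy).1.1.1 (hW y hy).1.1.2).symm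

/-- Weak differentiability in every chart follows from approximation in one chart at each point,
without any change of variables in the integrals. -/
theorem isWeakExtDeriv_of_strongAt {β : Form l K j} {α : Form l K (j + 1)} (hβ : IsCont β)
    (hα : IsCont α) (h : ∀ x, StrongAt β α x) : IsWeakExtDeriv β α := by
  intro e he
  refine isWeakExtDerivOn_of_strong e.open_target (hβ e he) (hα e he) fun y hy => ?_
  obtain ⟨V, hV, hy', -, hs⟩ := (h (e.symm y)).exists_chart he (e.map_target hy)
  exact ⟨V, hV, by rwa [e.right_inv hy] at hy', hs⟩

theorem StrongAt.congr {β β' : Form l K j} {α α' : Form l K (j + 1)} {x : K}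
    (h : StrongAt β α x) (hβ : ∀ᶠ z in 𝓝 x, β z = β' z) (hα : ∀ᶠ z in 𝓝 x, α z = α' z) :
    StrongAt β' α' x := by
  obtain ⟨e, he, hx, V, hV, hxV, hVt, h⟩ := h
  obtain ⟨W, hW, hWo, hxW⟩ := eventually_nhds_iff.mp
    ((chartRep_eventuallyEq hβ hx).and (chartRep_eventuallyEq hα hx))
  exact ⟨e, he, hx, V ∩ W, hV.inter hWo, ⟨hxV, hxW⟩, inter_subset_left.trans hVt,
    (h.mono inter_subset_left).congr (fun y hy => (hW y hy.2).1) fun y hy => (hW y hy.2).2⟩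

theorem StrongAt.zero_right {β : Form l K j} {α : Form l K (j + 1)} {x : K} (h : StrongAt β α x) :
    StrongAt α (0 : Form l K (j + 2)) x := by
  obtain ⟨e, he, hx, V, hV, hxV, hVt, h⟩ := h
  exact ⟨e, he, hx, V, hV, hxV, hVt, h.extDeriv_eq_zero hV⟩

end Charts

end LInftyForms

end

noncomputable section

set_option maxSynthPendingDepth 3

namespace LInftyForms

open Set Filter Topology

/-! ### Comparison of the Riemannian and the Euclidean norm in a chart -/

section MetricBound

open Bundle in
theorem eventually_norm_trivializationAt_le {B : Type*} [TopologicalSpace B]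
    {F : Type*} [NormedAddCommGroup F] [NormedSpace ℝ F] {E : B → Type*}
    [TopologicalSpace (TotalSpace F E)] [∀ b, TopologicalSpace (E b)] [∀ b, AddCommGroup (E b)]
    [∀ b, Module ℝ (E b)] [∀ b, IsTopologicalAddGroup (E b)] [∀ b, ContinuousConstSMul ℝ (E b)]
    [FiberBundle F E] [VectorBundle ℝ F E] (g : ContinuousRiemannianMetric F E) (x : B) :
    ∃ C, 0 ≤ C ∧ ∀ᶠ y in 𝓝 x, ∀ v : E y,
      ‖(trivializationAt F E x).continuousLinearMapAt ℝ y v‖ ≤ C * √(g.inner y v v) := by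
  let : RiemannianBundle E := ⟨g.toRiemannianMetric⟩
  obtain ⟨C, hC, h⟩ := eventually_norm_trivializationAt_lt F E x
  refine ⟨C, hC.le, h.mono fun y hy v => ?_⟩
  have h1 : ‖v‖ = √(g.inner y v v) := rfl
  rw [← h1]
  exact (((trivializationAt F E x).continuousLinearMapAt ℝ y).le_opNorm v).trans (by gcongr)

variable {l : ℕ} {K : Type*} [TopologicalSpace K] [ChartedSpace (Coord l) K]
  [IsManifold (𝓡 l) ∞ K]

local notation "𝒜" => IsManifold.maximalAtlas (𝓡 l) ∞ K

/-- The length of a tangent vector. -/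
def Metric.length (g : Metric l K) (x : K) (v : Coord l) : ℝ :=
  √(g.inner x (v : TangentSpace (𝓡 l) x) (v : TangentSpace (𝓡 l) x))

theorem eventually_chartAt_le (g : Metric l K) (x : K) :
    ∃ C, 0 ≤ C ∧ ∀ᶠ y in 𝓝 x, ∀ v : Coord l,
      ‖chartDeriv (chartAt (Coord l) x) y v‖ ≤ C * g.length y v := by
  obtain ⟨C, hC, h⟩ := eventually_norm_trivializationAt_le g.toContinuousRiemannianMetric x
  refine ⟨C, hC, ?_⟩
  filter_upwards [h, chart_source_mem_nhds (Coord l) x] with y hy hys v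
  have := hy v
  rw [TangentBundle.continuousLinearMapAt_trivializationAt hys] at this
  exact this

theorem eventually_chart_le (g : Metric l K) {e : OpenPartialHomeomorph K (Coord l)}
    (he : e ∈ 𝒜) {x : K} (hx : x ∈ e.source) :
    ∃ C, 0 ≤ C ∧ ∀ᶠ y in 𝓝 x, ∀ v : Coord l, ‖chartDeriv e y v‖ ≤ C * g.length y v := by
  obtain ⟨C, hC, h⟩ := eventually_chartAt_le g x
  set c := chartAt (Coord l) x
  have hc : c ∈ 𝒜 := IsManifold.chart_mem_maximalAtlas x
  have hxc : x ∈ c.source := mem_chart_source _ x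
  have h2 : ContinuousAt (fderiv ℝ (e ∘ c.symm)) (c x) := by
    have : ContDiffAt ℝ 0 (fun z => fderiv ℝ (e ∘ c.symm) z) (c x) :=
      ((contDiffOn_transition he hc).contDiffAt ((isOpen_transition e c).mem_nhds
        ⟨c.map_source hxc, by simpa [c.left_inv hxc] using hx⟩)).fderiv_right (by simp)
    exact this.continuousAt
  have h3 := (c.continuousAt hxc).eventually (h2.norm.eventually (gt_mem_nhds (lt_add_one _)))
  refine ⟨(‖fderiv ℝ (e ∘ c.symm) (c x)‖ + 1) * C, mul_nonneg (add_nonneg (norm_nonneg _) zero_le_one) hC, ?_⟩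
  filter_upwards [h, h3, c.open_source.mem_nhds hxc, e.open_source.mem_nhds hx] with y hy hy3 hyc hye v
  have h4 : chartDeriv e y = fderiv ℝ (e ∘ c.symm) (c y) ∘L chartDeriv c y := by
    rw [fderiv_transition he hc (c.map_source hyc) (by rwa [c.left_inv hyc]), c.left_inv hyc,
      ContinuousLinearMap.comp_assoc, chartSymmDeriv_comp hc hyc, ContinuousLinearMap.comp_id]
  rw [h4, ContinuousLinearMap.comp_apply, mul_assoc]
  exact (ContinuousLinearMap.le_opNorm _ _).trans
    (mul_le_mul hy3.le (hy v) (norm_nonneg _) (by positivity))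

/-- This constant turns Euclidean bounds on a form in the chart into Riemannian bounds on K. Local
constants are patched by compactness; the reverse inequality is not needed. -/
theorem exists_chart_le_of_isCompact (g : Metric l K) {e : OpenPartialHomeomorph K (Coord l)}
    (he : e ∈ 𝒜) {S : Set K} (hS : IsCompact S) (hSe : S ⊆ e.source) :
    ∃ C, 0 ≤ C ∧ ∀ y ∈ S, ∀ v : Coord l, ‖chartDeriv e y v‖ ≤ C * g.length y v := by
  refine hS.induction_on (p := fun S => ∃ C, 0 ≤ C ∧ ∀ y ∈ S, ∀ v : Coord l,
    ‖chartDeriv e y v‖ ≤ C * g.length y v) ⟨0, le_rfl, by simp⟩ ?_ ?_ ?_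
  · rintro s t hst ⟨C, hC, h⟩
    exact ⟨C, hC, fun y hy => h y (hst hy)⟩
  · rintro s t ⟨C, hC, h⟩ ⟨D, hD, h'⟩
    refine ⟨max C D, le_max_of_le_left hC, ?_⟩
    rintro y (hy | hy) v
    · exact (h y hy v).trans (mul_le_mul_of_nonneg_right (le_max_left _ _) (Real.sqrt_nonneg _))
    · exact (h' y hy v).trans (mul_le_mul_of_nonneg_right (le_max_right _ _) (Real.sqrt_nonneg _))
  · intro x hx
    obtain ⟨C, hC, h⟩ := eventually_chart_le g he (hSe hx)
    exact ⟨{y | ∀ v : Coord l, ‖chartDeriv e y v‖ ≤ C * g.length y v},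
      mem_nhdsWithin_of_mem_nhds h, C, hC, fun y hy => hy⟩

end MetricBound

/-! ### Extension by zero of forms supported in a chart -/

section Push

variable {l j : ℕ} {K : Type*} [TopologicalSpace K] [ChartedSpace (Coord l) K]
  [IsManifold (𝓡 l) ∞ K]

local notation "𝒜" => IsManifold.maximalAtlas (𝓡 l) ∞ K

variable {e : OpenPartialHomeomorph K (Coord l)}

open Classical in
/-- The form on `K` which is represented by `δ` in the chart `e`, extended by zero. -/
def push (e : OpenPartialHomeomorph K (Coord l)) (δ : Coord l → Alt l j) : Form l K j := fun x =>
  if x ∈ e.source then (δ (e x)).compContinuousLinearMap (chartDeriv e x) else (0 : Alt l j)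

omit [IsManifold (𝓡 l) ∞ K] in
theorem push_val_of_mem (δ : Coord l → Alt l j) {x : K} (hx : x ∈ e.source) :
    (push e δ).val x = (δ (e x)).compContinuousLinearMap (chartDeriv e x) := if_pos hx

omit [IsManifold (𝓡 l) ∞ K] in
theorem push_val_of_notMem (δ : Coord l → Alt l j) {x : K} (hx : x ∉ e.source) :
    (push e δ).val x = 0 := if_neg hx

omit [IsManifold (𝓡 l) ∞ K] in
theorem push_eq_zero {δ : Coord l → Alt l j} {L : Set (Coord l)} (hδ : ∀ y ∉ L, δ y = 0) {x : K}
    (hx : x ∉ e.source ∩ e ⁻¹' L) : push e δ x = 0 := by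
  change (push e δ).val x = 0
  by_cases hxe : x ∈ e.source
  · rw [push_val_of_mem δ hxe, hδ _ fun h => hx ⟨hxe, h⟩]
    rfl
  · exact push_val_of_notMem δ hxe

theorem chartRep_push (he : e ∈ 𝒜) (δ : Coord l → Alt l j) {y : Coord l} (hy : y ∈ e.target) :
    chartRep e (push e δ) y = δ y := by
  rw [chartRep_apply, push_val_of_mem δ (e.map_target hy), compContinuousLinearMap_comp,
    chartDeriv_comp_symm he hy, compContinuousLinearMap_id, e.right_inv hy]

theorem StrongAt.zero (x : K) : StrongAt (0 : Form l K j) 0 x := by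
  refine ⟨chartAt _ x, IsManifold.chart_mem_maximalAtlas x, mem_chart_source _ x,
    (chartAt (Coord l) x).target, (chartAt (Coord l) x).open_target, mem_chart_target _ x,
    subset_rfl, fun ε hε => ⟨0, contDiffOn_const, fun y _ => ⟨?_, ?_⟩⟩⟩
  · simpa [chartRep_zero] using hε.le
  · rw [chartRep_zero, show extDeriv (0 : Coord l → Alt l j) y = 0 by
      simpa using extDeriv_smul (0 : ℝ) (0 : Coord l → Alt l j) (x := y)]
    simpa using hε.le

omit [ChartedSpace (Coord l) K] [IsManifold (𝓡 l) ∞ K] in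
theorem isCompact_source_inter_preimage {L : Set (Coord l)} (hL : IsCompact L)
    (hLe : L ⊆ e.target) : IsCompact (e.source ∩ e ⁻¹' L) := by
  have : e.source ∩ e ⁻¹' L = e.symm '' L := (e.symm_image_eq_source_inter_preimage hLe).symm
  rw [this]
  exact hL.image_of_continuousOn (e.continuousOn_symm.mono hLe)

omit [IsManifold (𝓡 l) ∞ K] in
-- The preimage of `L` is compact, hence closed as K is Hausdorff, so the extension by zero vanishes
-- near every point outside the chart domain.
theorem eventually_push_eq_zero [T2Space K] {δ : Coord l → Alt l j} {L : Set (Coord l)}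
    (hL : IsCompact L) (hLe : L ⊆ e.target) (hδ : ∀ y ∉ L, δ y = 0) {x : K}
    (hx : x ∉ e.source) : ∀ᶠ z in 𝓝 x, push e δ z = 0 := by
  filter_upwards [(isCompact_source_inter_preimage hL hLe).isClosed.isOpen_compl.mem_nhds
    fun h : x ∈ e.source ∩ e ⁻¹' L => hx h.1] with z hz using push_eq_zero hδ hz

theorem isCont_push [T2Space K] (he : e ∈ 𝒜) {δ : Coord l → Alt l j} {L : Set (Coord l)}
    (hL : IsCompact L) (hLe : L ⊆ e.target) (hδ : ∀ y ∉ L, δ y = 0) (hc : Continuous δ) :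
    IsCont (push (K := K) e δ) := by
  refine isCont_of_continuousAt fun x => ?_
  by_cases hx : x ∈ e.source
  · refine ⟨e, he, hx, hc.continuousAt.congr ?_⟩
    filter_upwards [e.open_target.mem_nhds (e.map_source hx)] with y hy
      using (chartRep_push he δ hy).symm
  · refine ⟨chartAt _ x, IsManifold.chart_mem_maximalAtlas x, mem_chart_source _ x, ?_⟩
    have : (0 : Coord l → Alt l j) =ᶠ[_] chartRep (chartAt (Coord l) x) (push e δ) :=
      (chartRep_eventuallyEq (β := 0) (eventually_push_eq_zero hL hLe hδ hx)
        (mem_chart_source _ x)).symm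
    exact (continuousAt_const (y := (0 : Alt l j))).congr this

theorem strongAt_push [T2Space K] (he : e ∈ 𝒜) {δ : Coord l → Alt l j}
    {θ : Coord l → Alt l (j + 1)} {L : Set (Coord l)}
    (hL : IsCompact L) (hLe : L ⊆ e.target) (hδ : ∀ y ∉ L, δ y = 0) (hθ : ∀ y ∉ L, θ y = 0)
    (h : IsStrongExtDerivOn δ θ univ) (x : K) : StrongAt (push e δ) (push e θ) x := by
  by_cases hx : x ∈ e.source
  · exact ⟨e, he, hx, e.target, e.open_target, e.map_source hx, subset_rfl,
      (h.mono (subset_univ _)).congr (fun y hy => (chartRep_push he δ hy).symm)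
        fun y hy => (chartRep_push he θ hy).symm⟩
  · exact (StrongAt.zero x).congr ((eventually_push_eq_zero hL hLe hδ hx).mono fun _ h => h.symm)
      ((eventually_push_eq_zero hL hLe hθ hx).mono fun _ h => h.symm)

theorem abs_push_le (g : Metric l K) {δ : Coord l → Alt l j} {L : Set (Coord l)}
    (hδ : ∀ y ∉ L, δ y = 0) {κ C : ℝ} (hκ : ∀ y, ‖δ y‖ ≤ κ) (hC0 : 0 ≤ C)
    (hC : ∀ y ∈ e.source ∩ e ⁻¹' L, ∀ v : Coord l, ‖chartDeriv e y v‖ ≤ C * g.length y v)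
    (x : K) (v : Fin j → Coord l) :
    |(push e δ).val x v| ≤ κ * C ^ j * ∏ i, g.length x (v i) := by
  have hκ0 : 0 ≤ κ := (norm_nonneg _).trans (hκ 0)
  have hl : ∀ i, 0 ≤ g.length x (v i) := fun i => Real.sqrt_nonneg _
  by_cases hx : x ∈ e.source ∩ e ⁻¹' L
  · rw [push_val_of_mem δ hx.1, ContinuousAlternatingMap.compContinuousLinearMap_apply,
      ← Real.norm_eq_abs]
    refine ((δ (e x)).le_opNorm _).trans ?_
    have h1 : ∏ i, ‖chartDeriv e x (v i)‖ ≤ C ^ j * ∏ i, g.length x (v i) := by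
      refine (Finset.prod_le_prod (fun i _ => norm_nonneg _) fun i _ => hC x hx (v i)).trans ?_
      rw [Finset.prod_mul_distrib, Finset.prod_const, Finset.card_univ, Fintype.card_fin]
    rw [mul_assoc]
    exact mul_le_mul (hκ _) h1 (Finset.prod_nonneg fun i _ => norm_nonneg _) hκ0
  · have h0 : (push e δ).val x = 0 := push_eq_zero hδ hx
    rw [h0]
    refine (abs_zero (α := ℝ)).le.trans ?_
    exact mul_nonneg (by positivity) (Finset.prod_nonneg fun i _ => hl i)

end Push

/-! ### Smoothing inside one chart domain of the manifold -/

section Step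

variable {l j : ℕ}

theorem IsWeakExtDerivOn.mono {b : Coord l → Alt l j} {a : Coord l → Alt l (j + 1)}
    {U V : Set (Coord l)} (h : IsWeakExtDerivOn b a U) (hVU : V ⊆ U) :
    IsWeakExtDerivOn b a V := by
  intro k hk hk' φ h1 h2 h3
  have h0 : ∀ y ∉ tsupport φ, topWedge hk (b y) (extDeriv φ y) = 0 := fun y hy => by
    rw [extDeriv_eq_zero_of_notMem_tsupport hy, topWedge_zero_right]
  have h0' : ∀ y ∉ tsupport φ, topWedge hk' (a y) (φ y) = 0 := fun y hy => by
    rw [image_eq_zero_of_notMem_tsupport hy, topWedge_zero_right]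
  have := h k hk hk' φ h1 h2 (h3.trans hVU)
  rw [setIntegral_eq_integral_of_forall_compl_eq_zero fun y hy => h0 y fun h => hy (hVU (h3 h)),
    setIntegral_eq_integral_of_forall_compl_eq_zero fun y hy => h0' y fun h => hy (hVU (h3 h))]
    at this
  rwa [setIntegral_eq_integral_of_forall_compl_eq_zero fun y hy => h0 y fun h => hy (h3 h),
    setIntegral_eq_integral_of_forall_compl_eq_zero fun y hy => h0' y fun h => hy (h3 h)]

variable {K : Type*} [TopologicalSpace K] [ChartedSpace (Coord l) K] [IsManifold (𝓡 l) ∞ K]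

local notation "𝒜" => IsManifold.maximalAtlas (𝓡 l) ∞ K

omit [IsManifold (𝓡 l) ∞ K] in
theorem chartRep_sub (e : OpenPartialHomeomorph K (Coord l)) (α β : Form l K j) :
    chartRep e (α - β) = chartRep e α - chartRep e β := rfl

/-- The local smoothing transported to K. The corrections vanish outside `U`, so that those for a
locally finite family of such sets can be combined. -/
theorem IsWeakExtDeriv.exists_smoothing_on_chart [T2Space K] (g : Metric l K)
    {β : Form l K (j + 1)} {α : Form l K (j + 2)} (hβ : IsCont β) (hα : IsSmooth α)
    (h : IsWeakExtDeriv β α) {e : OpenPartialHomeomorph K (Coord l)} (he : e ∈ 𝒜)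
    {U S C T : Set K} (hU : IsOpen U) (hS : IsCompact S) (hUS : U ⊆ S) (hSe : S ⊆ e.source)
    (hC : IsCompact C) (hCU : C ⊆ U) (hT : IsClosed T) (hβT : ∀ x ∈ T, SmoothNear β x)
    {κ : ℝ} (hκ : 0 < κ) :
    ∃ (Δ : Form l K j) (Θ : Form l K (j + 1)),
      (∀ x ∉ U, Δ x = 0) ∧ (∀ x ∉ U, Θ x = 0) ∧ IsCont Δ ∧ IsCont Θ ∧
      (∀ x (v : Fin j → Coord l), |Δ.val x v| ≤ κ * ∏ i, g.length x (v i)) ∧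
      (∀ x (v : Fin (j + 1) → Coord l), |Θ.val x v| ≤ κ * ∏ i, g.length x (v i)) ∧
      (∀ x, StrongAt Δ Θ x) ∧ ∀ x ∈ C ∪ T, SmoothNear (β - Θ) x := by
  obtain ⟨M, hM0, hM⟩ := exists_chart_le_of_isCompact g he hS hSe
  have hUe := hUS.trans hSe
  set M' := max M 1
  have hM1 : 1 ≤ M' := le_max_right _ _
  have hU' : IsOpen (e.target ∩ e.symm ⁻¹' U) := e.isOpen_inter_preimage_symm hU
  have hM' : ∀ L ⊆ e.target ∩ e.symm ⁻¹' U, ∀ y ∈ e.source ∩ e ⁻¹' L, ∀ v : Coord l,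
      ‖chartDeriv e y v‖ ≤ M' * g.length y v := fun L hL y hy v =>
    (hM y (hUS (by simpa [e.left_inv hy.1] using (hL hy.2).2)) v).trans
      (mul_le_mul_of_nonneg_right (le_max_left _ _) (Real.sqrt_nonneg _))
  obtain ⟨δ, θ, L, hL, hLU, hδL, hθL, hδ, hθ, hδκ, hθκ, hs, hsm⟩ :=
    ((h e he).mono (inter_subset_left (t := e.symm ⁻¹' U))).exists_local_smoothing hU'
      ((hβ e he).mono inter_subset_left) ((hα e he).mono inter_subset_left)
      (hC.image_of_continuousOn (e.continuousOn.mono (hCU.trans hUe)))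
      -- Passing to the Riemannian norm costs M'^k in degree k; as M' ≥ 1, the power j + 1 serves
      -- both degrees j and j + 1.
      (C := e '' C) (T := e.symm ⁻¹' T) (κ := κ / M' ^ (j + 1))
      (by
        rintro _ ⟨x, hx, rfl⟩
        exact ⟨e.map_source (hUe (hCU hx)), by simpa [e.left_inv (hUe (hCU hx))] using hCU hx⟩)
      (fun L hLU hL => by
        have := (e.continuousOn_symm.mono (hLU.trans inter_subset_left)).preimage_isClosed_of_isClosed
          hL.isClosed hT
        exact hL.of_isClosed_subset this inter_subset_left)
      (fun x hx => by
        have := hβT _ hx.2 e he (e.map_target hx.1.1)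
        rwa [e.right_inv hx.1.1] at this)
      (by positivity)
  have hLe := hLU.trans inter_subset_left
  have hoff : ∀ x ∉ U, x ∉ e.source ∩ e ⁻¹' L := fun x hx h =>
    hx (by simpa [e.left_inv h.1] using (hLU h.2).2)
  have hbd : ∀ k ≤ j + 1, κ / M' ^ (j + 1) * M' ^ k ≤ κ := fun k hk => by
    rw [div_mul_eq_mul_div, div_le_iff₀ (by positivity)]
    exact mul_le_mul_of_nonneg_left (pow_le_pow_right₀ hM1 hk) hκ.le
  refine ⟨push e δ, push e θ, fun x hx => push_eq_zero hδL (hoff x hx),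
    fun x hx => push_eq_zero hθL (hoff x hx), isCont_push he hL hLe hδL hδ,
    isCont_push he hL hLe hθL hθ, fun x v => ?_, fun x v => ?_,
    strongAt_push he hL hLe hδL hθL hs, fun x hx => ?_⟩
  · exact (abs_push_le g hδL hδκ (by positivity) (hM' L hLU) x v).trans
      (mul_le_mul_of_nonneg_right (hbd _ (by omega))
        (Finset.prod_nonneg fun i _ => Real.sqrt_nonneg _))
  · exact (abs_push_le g hθL hθκ (by positivity) (hM' L hLU) x v).trans
      (mul_le_mul_of_nonneg_right (hbd _ le_rfl)
        (Finset.prod_nonneg fun i _ => Real.sqrt_nonneg _))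
  · by_cases hxU : x ∈ U
    · have hxe := hUe hxU
      have hx' : e x ∈ e '' C ∪ (e.target ∩ e.symm ⁻¹' U) ∩ e.symm ⁻¹' T := by
        rcases hx with hx | hx
        · exact Or.inl ⟨x, hx, rfl⟩
        · exact Or.inr ⟨⟨e.map_source hxe, by simpa [e.left_inv hxe] using hxU⟩,
            by simpa [e.left_inv hxe] using hx⟩
      refine SmoothNear.of_chart he hxe ?_
      filter_upwards [hsm _ hx', e.open_target.mem_nhds (e.map_source hxe)] with y hy hyt
      refine hy.congr_of_eventuallyEq ?_
      filter_upwards [e.open_target.mem_nhds hyt] with z hz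
      rw [chartRep_sub, Pi.sub_apply, chartRep_push he θ hz]
    -- Outside `U` the correction vanishes near x, because it lives on a compact subset of `U`.
    · have hxT : x ∈ T := hx.resolve_left fun h => hxU (hCU h)
      refine (hβT x hxT).congr ?_
      filter_upwards [(isCompact_source_inter_preimage hL hLe).isClosed.isOpen_compl.mem_nhds
        (hoff x hxU)] with z hz
      have : (β - push e θ) z = β z - push e θ z := rfl
      rw [this, push_eq_zero hθL hz]
      exact (sub_zero (β.val z)).symm

end Step

end LInftyForms

end

noncomputable section

set_option maxSynthPendingDepth 3

namespace LInftyForms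

open Set Filter Topology

/-! ### Gluing over the manifold and the isomorphism in cohomology -/

section Global

variable {l j : ℕ} {K : Type*} [TopologicalSpace K] [ChartedSpace (Coord l) K]
  [IsManifold (𝓡 l) ∞ K]

local notation "𝒜" => IsManifold.maximalAtlas (𝓡 l) ∞ K

/-- A locally finite sequence of open subsets, each of which is empty or relatively compact in a
chart, containing compact subsets that cover the manifold. -/
theorem exists_locallyFinite_cover [T2Space K] [SecondCountableTopology K] :
    ∃ U C : ℕ → Set K, LocallyFinite U ∧ (∀ n, IsCompact (C n)) ∧ (∀ x, ∃ n, x ∈ C n) ∧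
      ∀ n, C n = ∅ ∨ (IsOpen (U n) ∧ C n ⊆ U n ∧ ∃ e ∈ 𝒜, ∃ S, IsCompact S ∧ U n ⊆ S ∧
        S ⊆ e.source) := by
  have : LocallyCompactSpace K := ChartedSpace.locallyCompactSpace (Coord l) K
  obtain ⟨ι, f, -⟩ := SmoothBumpCovering.exists_isSubordinate (𝓡 l) (isClosed_univ (X := K))
    (U := fun _ => univ) fun _ _ => univ_mem
  have hc := f.locallyFinite.countable_univ fun i =>
    ⟨f.c i, by simp⟩
  have : Countable ι := countable_univ_iff.mp hc
  obtain ⟨φ, hφ⟩ := exists_injective_nat ι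
  -- The countable index set of the bump covering is embedded in ℕ; at the unused indices both sets
  -- are empty.
  let U : ℕ → Set K := fun n => {x | ∃ i, φ i = n ∧ x ∈ Function.support (f i)}
  let C : ℕ → Set K := fun n => {x | ∃ i, φ i = n ∧ f i x = 1}
  have hU : ∀ i, U (φ i) = Function.support (f i) := fun i => by
    ext x
    exact ⟨fun ⟨k, hk, hx⟩ => hφ hk ▸ hx, fun hx => ⟨i, rfl, hx⟩⟩
  have hC : ∀ i, C (φ i) = {x | f i x = 1} := fun i => by
    ext x
    exact ⟨fun ⟨k, hk, hx⟩ => hφ hk ▸ hx, fun hx => ⟨i, rfl, hx⟩⟩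
  have hC0 : ∀ n, n ∉ range φ → C n = ∅ := fun n hn =>
    eq_empty_of_forall_notMem fun x ⟨i, hi, _⟩ => hn ⟨i, hi⟩
  have hCU : ∀ i, {x | f i x = 1} ⊆ Function.support (f i) := fun i x (hx : f i x = 1) => by
    simp [hx]
  refine ⟨U, C, fun x => ?_, fun n => ?_, fun x => ?_, fun n => ?_⟩
  · obtain ⟨N, hN, hfin⟩ := f.locallyFinite x
    refine ⟨N, hN, (hfin.image φ).subset ?_⟩
    rintro n ⟨y, ⟨i, rfl, hy⟩, hyN⟩
    exact ⟨i, ⟨y, hy, hyN⟩, rfl⟩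
  · by_cases hn : n ∈ range φ
    · obtain ⟨i, rfl⟩ := hn
      rw [hC]
      exact (f i).hasCompactSupport.isCompact.of_isClosed_subset
        (isClosed_singleton.preimage (f i).continuous) ((hCU i).trans (subset_tsupport _))
    · rw [hC0 n hn]
      exact isCompact_empty
  · exact ⟨φ (f.ind x trivial), f.ind x trivial, rfl, f.apply_ind x trivial⟩
  · by_cases hn : n ∈ range φ
    · obtain ⟨i, rfl⟩ := hn
      rw [hC, hU]
      exact Or.inr ⟨(f i).continuous.isOpen_support, hCU i, chartAt _ (f.c i),
        IsManifold.chart_mem_maximalAtlas _, tsupport (f i), (f i).hasCompactSupport,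
        subset_tsupport _, (f i).tsupport_subset_chartAt_source⟩
    · exact Or.inl (hC0 n hn)

theorem IsStrongExtDerivOn.add {b b' : Coord l → Alt l j} {a a' : Coord l → Alt l (j + 1)}
    {V : Set (Coord l)} (h : IsStrongExtDerivOn b a V) (hV : IsOpen V)
    (h' : IsStrongExtDerivOn b' a' V) : IsStrongExtDerivOn (b + b') (a + a') V := by
  intro ε hε
  obtain ⟨c, hc, h⟩ := h (ε / 2) (by positivity)
  obtain ⟨c', hc', h'⟩ := h' (ε / 2) (by positivity)
  refine ⟨c + c', hc.add hc', fun y hy => ⟨?_, ?_⟩⟩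
  · calc _ = ‖(c y - b y) + (c' y - b' y)‖ := by
          congr 1
          simp only [Pi.add_apply]
          abel
      _ ≤ ε / 2 + ε / 2 := norm_add_le_of_le (h y hy).1 (h' y hy).1
      _ = ε := add_halves ε
  · rw [extDeriv_add ((hc.contDiffAt (hV.mem_nhds hy)).differentiableAt (by simp))
      ((hc'.contDiffAt (hV.mem_nhds hy)).differentiableAt (by simp))]
    calc _ = ‖(extDeriv c y - a y) + (extDeriv c' y - a' y)‖ := by
          congr 1
          simp only [Pi.add_apply]
          abel
      _ ≤ ε / 2 + ε / 2 := norm_add_le_of_le (h y hy).2 (h' y hy).2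
      _ = ε := add_halves ε

theorem StrongAt.add {β β' : Form l K j} {α α' : Form l K (j + 1)} {x : K}
    (h : StrongAt β α x) (h' : StrongAt β' α' x) : StrongAt (β + β') (α + α') x := by
  obtain ⟨e, he, hx, V, hV, hxV, hVt, h⟩ := h
  obtain ⟨V', hV', hxV', -, h'⟩ := h'.exists_chart he hx
  have := (h.mono inter_subset_left).add (hV.inter hV') (h'.mono inter_subset_right)
  rw [← chartRep_add, ← chartRep_add] at this
  exact ⟨e, he, hx, V ∩ V', hV.inter hV', ⟨hxV, hxV'⟩, inter_subset_left.trans hVt, this⟩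

omit [IsManifold (𝓡 l) ∞ K] in
theorem IsCont.sub {α β : Form l K j} (hα : IsCont α) (hβ : IsCont β) : IsCont (α - β) := by
  have := hα.add (hβ.smul (-1))
  rwa [neg_one_smul, ← sub_eq_add_neg] at this

theorem IsBdd.sub {g : Metric l K} {α β : Form l K j} (hα : IsBdd g α) (hβ : IsBdd g β) :
    IsBdd g (α - β) := by
  have := hα.add (hβ.smul (-1))
  rwa [neg_one_smul, ← sub_eq_add_neg] at this

omit [IsManifold (𝓡 l) ∞ K] in
theorem IsWeakExtDeriv.sub {α β : Form l K j} {η θ : Form l K (j + 1)}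
    (hα : IsWeakExtDeriv α η) (hβ : IsWeakExtDeriv β θ) (cα : IsCont α) (cβ : IsCont β)
    (cη : IsCont η) (cθ : IsCont θ) : IsWeakExtDeriv (α - β) (η - θ) := by
  have := hα.add (hβ.smul (-1)) cα (cβ.smul (-1)) cη (cθ.smul (-1))
  rwa [neg_one_smul, ← sub_eq_add_neg, neg_one_smul, ← sub_eq_add_neg] at this

/-- Every value of `α` has norm at most `C`. -/
def NormLE (g : Metric l K) (α : Form l K j) (C : ℝ) : Prop :=
  ∀ x (v : Fin j → Coord l), |α.val x v| ≤ C * ∏ i, g.length x (v i)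

theorem NormLE.isBdd {g : Metric l K} {α : Form l K j} {C : ℝ} (h : NormLE g α C) : IsBdd g α :=
  ⟨C, h⟩

theorem NormLE.add {g : Metric l K} {α β : Form l K j} {C D : ℝ} (hα : NormLE g α C)
    (hβ : NormLE g β D) : NormLE g (α + β) (C + D) := fun x v => by
  rw [add_mul]
  exact (abs_add_le (α.val x v) (β.val x v)).trans (add_le_add (hα x v) (hβ x v))

theorem NormLE.zero {g : Metric l K} {C : ℝ} (hC : 0 ≤ C) : NormLE g (0 : Form l K j) C :=
  fun _ _ => (abs_zero (α := ℝ)).le.trans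
    (mul_nonneg hC (Finset.prod_nonneg fun _ _ => Real.sqrt_nonneg _))

theorem NormLE.mono {g : Metric l K} {α : Form l K j} {C D : ℝ} (h : NormLE g α C) (hCD : C ≤ D) :
    NormLE g α D := fun _ _ => (h _ _).trans
  (mul_le_mul_of_nonneg_right hCD (Finset.prod_nonneg fun _ _ => Real.sqrt_nonneg _))

/-- A partial smoothing of `β`: the form `p.2` differs from `β` by the differential of `p.1`,
both are controlled, and `p.2` is smooth near `T`. -/
structure IsPartialSmoothing (g : Metric l K) (β : Form l K (j + 1)) (T : Set K) (C : ℝ)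
    (p : Form l K j × Form l K (j + 1)) : Prop where
  cont_fst : IsCont p.1
  cont_snd : IsCont p.2
  norm_fst : NormLE g p.1 C
  norm_snd : NormLE g (β - p.2) C
  strong : ∀ x, StrongAt p.1 (β - p.2) x
  smooth : ∀ x ∈ T, SmoothNear p.2 x

/-- β and `p.2` differ by the strong differential of `p.1`, which is closed. The weak differential
is thus still the smooth α, and the smoothing can be repeated in the next chart. -/
theorem IsPartialSmoothing.isWeakExtDeriv {g : Metric l K} {β : Form l K (j + 1)} {T : Set K}
    {C : ℝ} {p : Form l K j × Form l K (j + 1)} (hp : IsPartialSmoothing g β T C p)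
    {α : Form l K (j + 2)} (hα : IsCont α) (hβ : IsCont β) (h : IsWeakExtDeriv β α) :
    IsWeakExtDeriv p.2 α := by
  have h1 : IsWeakExtDeriv (β - p.2) 0 := isWeakExtDeriv_of_strongAt (hβ.sub hp.cont_snd) .zero
    fun x => (hp.strong x).zero_right
  have := h.sub h1 hβ (hβ.sub hp.cont_snd) hα .zero
  rwa [sub_sub_cancel, sub_zero] at this

theorem IsPartialSmoothing.step [T2Space K] {g : Metric l K} {β : Form l K (j + 1)} {T : Set K}
    {D : ℝ} {p : Form l K j × Form l K (j + 1)} (hp : IsPartialSmoothing g β T D p)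
    {α : Form l K (j + 2)} (hα : IsSmooth α) (hβ : IsCont β) (h : IsWeakExtDeriv β α)
    {U C : Set K} (hU : IsOpen U) (hC : IsCompact C) (hCU : C ⊆ U) (hT : IsClosed T)
    {e : OpenPartialHomeomorph K (Coord l)} (he : e ∈ 𝒜) {S : Set K} (hS : IsCompact S)
    (hUS : U ⊆ S) (hSe : S ⊆ e.source) {κ : ℝ} (hκ : 0 < κ) :
    ∃ q, IsPartialSmoothing g β (C ∪ T) (D + κ) q ∧ ∀ x ∉ U, q.1 x = p.1 x ∧ q.2 x = p.2 x := by
  obtain ⟨Δ, Θ, hΔ0, hΘ0, hΔc, hΘc, hΔ, hΘ, hs, hsm⟩ :=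
    (hp.isWeakExtDeriv hα.isCont hβ h).exists_smoothing_on_chart g hp.cont_snd hα he hU hS hUS hSe
      hC hCU hT hp.smooth hκ
  have hsub : β - (p.2 - Θ) = (β - p.2) + Θ := by abel
  refine ⟨(p.1 + Δ, p.2 - Θ), ⟨hp.cont_fst.add hΔc, hp.cont_snd.sub hΘc, hp.norm_fst.add hΔ, ?_, ?_,
    hsm⟩, fun x hx => ⟨?_, ?_⟩⟩
  · rw [hsub]
    exact hp.norm_snd.add hΘ
  · rw [hsub]
    exact fun x => (hp.strong x).add (hs x)
  · change p.1.val x + Δ.val x = p.1.val x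
    rw [show Δ.val x = 0 from hΔ0 x hx, add_zero]
  · change p.2.val x - Θ.val x = p.2.val x
    rw [show Θ.val x = 0 from hΘ0 x hx, sub_zero]

theorem IsCont.of_eventuallyEq {α : Form l K j}
    (h : ∀ x, ∃ β : Form l K j, IsCont β ∧ ∀ᶠ z in 𝓝 x, β z = α z) : IsCont α := by
  refine isCont_of_continuousAt fun x => ⟨chartAt _ x, IsManifold.chart_mem_maximalAtlas x,
    mem_chart_source _ x, ?_⟩
  obtain ⟨β, hβ, h⟩ := h x
  exact ((hβ _ (IsManifold.chart_mem_maximalAtlas x)).continuousAt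
    ((chartAt (Coord l) x).open_target.mem_nhds (mem_chart_target _ x))).congr
      (chartRep_eventuallyEq h (mem_chart_source _ x))

/-- The charts are treated one after another, the n-th with error 2^{-(n+1)}, so the bound after n
steps is 1 - 2^{-n}. By local finiteness the sequence is eventually constant near each point, and
the limit inherits every local property. -/
theorem exists_isPartialSmoothing_univ [T2Space K] [SecondCountableTopology K] (g : Metric l K)
    {β : Form l K (j + 1)} {α : Form l K (j + 2)} (hβ : IsCont β) (hα : IsSmooth α)
    (h : IsWeakExtDeriv β α) : ∃ p, IsPartialSmoothing g β univ 1 p := by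
  obtain ⟨U, C, hUfin, hC, hcov, hUC⟩ := exists_locallyFinite_cover (l := l) (K := K)
  let T : ℕ → Set K := fun n => ⋃ m ∈ Finset.range n, C m
  have hT : ∀ n, IsClosed (T n) := fun n =>
    ((Finset.range n).isCompact_biUnion fun m _ => hC m).isClosed
  have hTs : ∀ n, T (n + 1) = C n ∪ T n := fun n => by
    simp only [T, Finset.range_add_one, Finset.set_biUnion_insert]
  have step : ∀ n (p : {p // IsPartialSmoothing (K := K) (j := j) g β (T n) (1 - (1 / 2) ^ n) p}),
      ∃ q : {p // IsPartialSmoothing g β (T (n + 1)) (1 - (1 / 2) ^ (n + 1)) p},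
        ∀ x ∉ U n, q.1.1 x = p.1.1 x ∧ q.1.2 x = p.1.2 x := by
    rintro n ⟨p, hp⟩
    have hpow : (0 : ℝ) < (1 / 2) ^ (n + 1) := by positivity
    have hsum : 1 - (1 / 2 : ℝ) ^ n + (1 / 2) ^ (n + 1) = 1 - (1 / 2) ^ (n + 1) := by ring
    rcases hUC n with h0 | ⟨hUo, hCU, e, he, S, hS, hUS, hSe⟩
    · refine ⟨⟨p, hp.cont_fst, hp.cont_snd, hp.norm_fst.mono (by linarith),
        hp.norm_snd.mono (by linarith), hp.strong, ?_⟩, fun _ _ => ⟨rfl, rfl⟩⟩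
      rw [hTs, h0, empty_union]
      exact hp.smooth
    · obtain ⟨q, hq, hqp⟩ := hp.step hα hβ h hUo (hC n) hCU (hT n) he hS hUS hSe hpow
      rw [← hTs, hsum] at hq
      exact ⟨⟨q, hq⟩, hqp⟩
  choose next hnext using step
  -- Nothing is smooth yet: T 0 is empty and the bound is 1 - 1 = 0.
  have base : IsPartialSmoothing (K := K) (j := j) g β (T 0) (1 - (1 / 2) ^ 0) (0, β) := by
    refine ⟨.zero, hβ, .zero (by norm_num), ?_, ?_, by simp [T]⟩
    · rw [sub_self]
      exact .zero (by norm_num)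
    · rw [sub_self]
      exact StrongAt.zero
  let s : ∀ n, {p // IsPartialSmoothing (K := K) (j := j) g β (T n) (1 - (1 / 2) ^ n) p} :=
    fun n => Nat.rec ⟨_, base⟩ (fun n p => next n p) n
  have hs : ∀ n, ∀ x ∉ U n, (s (n + 1)).1.1 x = (s n).1.1 x ∧ (s (n + 1)).1.2 x = (s n).1.2 x :=
    fun n => hnext n (s n)
  have hfin1 : LocallyFinite fun n => {x | (s (n + 1)).1.1 x ≠ (s n).1.1 x} :=
    hUfin.subset fun n x hx => by_contra fun hxU => hx (hs n x hxU).1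
  -- Consecutive terms differ only inside `U n`, so near each point the sequence stabilizes.
  obtain ⟨Δ, hΔ⟩ : ∃ F : Form l K j, ∀ x, ∀ᶠ n in atTop, ∀ᶠ y in 𝓝 x, (s n).1.1 y = F y :=
    LocallyFinite.exists_forall_eventually_atTop_eventually_eq' (f := fun n => (s n).1.1) hfin1
  have hfin2 : LocallyFinite fun n => {x | (s (n + 1)).1.2 x ≠ (s n).1.2 x} :=
    hUfin.subset fun n x hx => by_contra fun hxU => hx (hs n x hxU).2
  obtain ⟨γ, hγ⟩ : ∃ F : Form l K (j + 1), ∀ x, ∀ᶠ n in atTop, ∀ᶠ y in 𝓝 x, (s n).1.2 y = F y :=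
    LocallyFinite.exists_forall_eventually_atTop_eventually_eq' (f := fun n => (s n).1.2) hfin2
  have hle : ∀ n, 1 - (1 / 2 : ℝ) ^ n ≤ 1 := fun n => sub_le_self _ (by positivity)
  have hsubγ : ∀ {n : ℕ} {x : K}, (s n).1.2 x = γ x → (β - (s n).1.2) x = (β - γ) x :=
    fun {n x} hx => by
      change β.val x - (s n).1.2.val x = β.val x - γ.val x
      rw [show (s n).1.2.val x = γ.val x from hx]
  refine ⟨(Δ, γ), ?_, ?_, fun x v => ?_, fun x v => ?_, fun x => ?_, fun x _ => ?_⟩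
  · refine IsCont.of_eventuallyEq fun x => ?_
    obtain ⟨n, hn⟩ := (hΔ x).exists
    exact ⟨(s n).1.1, (s n).2.cont_fst, hn⟩
  · refine IsCont.of_eventuallyEq fun x => ?_
    obtain ⟨n, hn⟩ := (hγ x).exists
    exact ⟨(s n).1.2, (s n).2.cont_snd, hn⟩
  · obtain ⟨n, hn⟩ := (hΔ x).exists
    have := (s n).2.norm_fst.mono (hle n) x v
    rwa [show (s n).1.1.val x = Δ.val x from hn.self_of_nhds] at this
  · obtain ⟨n, hn⟩ := (hγ x).exists
    have := (s n).2.norm_snd.mono (hle n) x v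
    rwa [show (β - (s n).1.2).val x = (β - γ).val x from
      hsubγ hn.self_of_nhds] at this
  · obtain ⟨n, hn, hn'⟩ := ((hΔ x).and (hγ x)).exists
    exact ((s n).2.strong x).congr hn (hn'.mono fun z hz => hsubγ hz)
  · obtain ⟨m, hm⟩ := hcov x
    obtain ⟨n, hn, hmn⟩ := ((hγ x).and (eventually_gt_atTop m)).exists
    exact ((s n).2.smooth x (mem_biUnion (Finset.mem_range.mpr hmn) hm)).congr hn

/-- A bounded form with smooth weak differential differs from a smooth one by a coboundary. -/
theorem HasBddWeakExtDeriv.exists_mem_Omega [T2Space K] [SecondCountableTopology K]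
    {g : Metric l K} {β : Form l K j} {α : Form l K (j + 1)} (h : HasBddWeakExtDeriv g β α)
    (hα : IsSmooth α) : ∃ γ ∈ Omega g j, extD γ = α ∧ β - γ ∈ WeakCoboundaries g j := by
  obtain ⟨hβc, hβb, hαc, hαb, hw⟩ := h
  cases j with
  | zero =>
    -- No coboundaries are available in degree 0, so β itself has to be smooth.
    have hβ : IsSmooth β := fun e he =>
      (hw e he).contDiffOn_zero e.open_target (hβc e he) (hα e he)
    have hd := hw.extD_eq hβ hαc
    exact ⟨β, ⟨hβ, hβb, by rwa [hd]⟩, hd, by rw [sub_self]; exact zero_mem _⟩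
  | succ j =>
    obtain ⟨⟨Δ, γ⟩, hp⟩ := exists_isPartialSmoothing_univ g hβc hα hw
    have hγ : IsSmooth γ := isSmooth_of_smoothNear fun x => hp.smooth x trivial
    have hd := (hp.isWeakExtDeriv hαc hβc hw).extD_eq hγ hαc
    have hγb : IsBdd g γ := by
      have := hβb.sub hp.norm_snd.isBdd
      rwa [sub_sub_cancel] at this
    refine ⟨γ, ⟨hγ, hγb, by rwa [hd]⟩, hd, Δ, hp.cont_fst, hp.norm_fst.isBdd,
      hβc.sub hp.cont_snd, hp.norm_snd.isBdd, ?_⟩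
    exact isWeakExtDeriv_of_strongAt hp.cont_fst (hβc.sub hp.cont_snd) hp.strong

theorem cocycles_le_weakCocycles (g : Metric l K) (j : ℕ) : Cocycles g j ≤ WeakCocycles g j := by
  rintro z ⟨hz, hd⟩
  have := hasBddWeakExtDeriv_of_mem_Omega hz
  rwa [hd] at this

theorem coboundaries_le_weakCoboundaries (g : Metric l K) (j : ℕ) :
    Coboundaries g j ≤ WeakCoboundaries g j := by
  cases j with
  | zero => exact le_rfl
  | succ j =>
    rintro _ ⟨β, hβ, rfl⟩
    exact ⟨β, hasBddWeakExtDeriv_of_mem_Omega hβ⟩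

/-- Injectivity: a bounded weak primitive of a smooth form can be replaced by a smooth bounded one
with the same differential. -/
theorem mem_coboundaries_of_mem_weakCoboundaries [T2Space K] [SecondCountableTopology K]
    {g : Metric l K} {z : Form l K j} (hz : IsSmooth z) (h : z ∈ WeakCoboundaries g j) :
    z ∈ Coboundaries g j := by
  cases j with
  | zero => exact h
  | succ j =>
    obtain ⟨β, hβ⟩ := h
    obtain ⟨γ, hγ, hd, -⟩ := hβ.exists_mem_Omega hz
    exact ⟨γ, hγ, hd⟩

/-- The map in cohomology induced by the inclusion. -/
def cohomologyMap (g : Metric l K) (j : ℕ) : Cohomology g j →ₗ[ℝ] WeakCohomology g j :=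
  Submodule.mapQ _ _ (Submodule.inclusion (cocycles_le_weakCocycles g j)) fun _ hz =>
    coboundaries_le_weakCoboundaries g j hz

theorem cohomologyMap_injective [T2Space K] [SecondCountableTopology K] (g : Metric l K) (j : ℕ) :
    Function.Injective (cohomologyMap g j) := by
  rw [← LinearMap.ker_eq_bot, LinearMap.ker_eq_bot']
  intro q hq
  obtain ⟨z, rfl⟩ := Submodule.Quotient.mk_surjective _ q
  rw [Submodule.Quotient.mk_eq_zero]
  have h1 : (Submodule.Quotient.mk (Submodule.inclusion (cocycles_le_weakCocycles g j) z) :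
    WeakCohomology g j) = 0 := hq
  rw [Submodule.Quotient.mk_eq_zero] at h1
  exact mem_coboundaries_of_mem_weakCoboundaries z.2.1.1 h1

theorem cohomologyMap_surjective [T2Space K] [SecondCountableTopology K] (g : Metric l K)
    (j : ℕ) : Function.Surjective (cohomologyMap g j) := by
  intro q
  obtain ⟨⟨β, hβ⟩, rfl⟩ := Submodule.Quotient.mk_surjective _ q
  -- A weak cocycle has the smooth weak differential 0, so it is cohomologous to a smooth cocycle.
  obtain ⟨γ, hγ, hd, hβγ⟩ := HasBddWeakExtDeriv.exists_mem_Omega hβ .zero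
  refine ⟨Submodule.Quotient.mk ⟨γ, hγ, hd⟩, ((Submodule.Quotient.eq _).mpr ?_).symm⟩
  exact hβγ

end Global

end LInftyForms

end

theorem mainTheorem6 {l : ℕ} {K : Type*} [TopologicalSpace K] [T2Space K]
    [SecondCountableTopology K] [ChartedSpace (EuclideanSpace ℝ (Fin l)) K]
    [IsManifold (𝓡 l) ∞ K] (g : LInftyForms.Metric l K) (j : ℕ) :
    -- the inclusion is a well-defined cochain map
    (∀ α ∈ LInftyForms.Omega g j,
      LInftyForms.HasBddWeakExtDeriv g α (LInftyForms.extD α)) ∧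
    -- it induces an isomorphism on cohomology
    ∃ f : LInftyForms.Cohomology g j ≃ₗ[ℝ] LInftyForms.WeakCohomology g j,
      ∀ z : LInftyForms.Cocycles g j,
        ∃ hz : (z : LInftyForms.Form l K j) ∈ LInftyForms.WeakCocycles g j,
          f (Submodule.Quotient.mk z) = Submodule.Quotient.mk ⟨z, hz⟩ :=
  ⟨fun _ => LInftyForms.hasBddWeakExtDeriv_of_mem_Omega,
    LinearEquiv.ofBijective (LInftyForms.cohomologyMap g j)
      ⟨LInftyForms.cohomologyMap_injective g j, LInftyForms.cohomologyMap_surjective g j⟩,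
    fun z => ⟨LInftyForms.cocycles_le_weakCocycles g j z.2, rfl⟩⟩
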